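/- An $\omega$-category is a set $A$ with maps $s_n=d_n^-$, $t_n=d_n^+\colon A\to A$ and partial compositions $x*_ny$ ($n\ge 0$), defined exactly when $t_nx=s_ny$, such that: $d_m^\beta d_n^\alpha=d_m^\beta$ if $m<n$ and $d_m^\beta d_n^\alpha=d_n^\alpha$ if $m\ge n$; $s_nx*_nx=x=x*_nt_nx$; $s_n(x*_ny)=s_nx$, $t_n(x*_ny)=t_ny$, and $d_m^\alpha(x*_ny)=d_m^\alpha x*_nd_m^\alpha y$ for $m\ne n$; each $*_n$ is associative, and $(x*_ny)*_m(z*_nw)=(x*_mz)*_n(y*_mw)$ for $m\neq n$, whenever both sides are defined; and every $x$ satisfies $s_nx=t_nx=x$ for some $n$, the least such $n$ being its dimension. An $\omega$-functor preserves all $s_n$, $t_n$, $*_n$; $\omega Cat$ is the resulting category. An $\omega$-category is a strict globular $\omega$-groupoid if for every morphism $x$ of dimension at least $1$ and every $r\ge 0$ there is $x'$ with $x*_rx'=s_rx=t_rx'$ and $x'*_rx=s_rx'=t_rx$. Let $\mathcal C$ be an $\omega$-category that is non-contracting, i.e. $s_1x$ and $t_1x$ have dimension $1$ for every $x$ of dimension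 at least $1$. Its path $\omega$-category $\mathbb P\mathcal C$ consists of the morphisms of $\mathcal C$ of dimension at least $1$, with $n$-source, $n$-target and $n$-composition equal to $s_{n+1}$, $t_{n+1}$, $*_{n+1}$ of $\mathcal C$. Let $\mathcal R^-$ be the equivalence relation on $\mathbb P\mathcal C$ generated by $x\sim x*_0y$ for all $x,y\in\mathbb P\mathcal C$ such that $x*_0y$ is defined in $\mathcal C$ and belongs to $\mathbb P\mathcal C$. Let $\mathbb U$ be the forgetful functor from $\omega Cat$ to globular sets, where $(\mathbb U\mathcal D)_n$ is the set of morphisms of $\mathcal D$ of dimension at most $n$; let $\mathbb F$ be its left adjoint, and let $\phi\colon\mathbb U\mathbb P\mathcal C\to\mathbb U\mathbb P\mathcal C/\mathcal R^-$ be the quotient map. The negative semi-path $\omega$-category $\mathbb P^-\mathcal C$ is the pushout in $\omega Cat$ of $\mathbb F(\phi)\colon\mathbb F\mathbb U\mathbb P\mathcal C\to\mathbb F(\mathbb U\mathbb P\mathcal C/\mathcal R^-)$ and of the counit $\mathbb F\mathbb U\mathbb P\mathcal C\to\mathbb P\mathcal C$. Let $\Delta^n$ be the $\omega$-category associated to the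 $n$-simplex (Street's $n$-th oriental, with the convention that the source, resp. the target, of a face $(\sigma_0<\dots<\sigma_p)$ is made of the faces obtained by removing some $\sigma_i$ with $i$ even, resp. odd), which is functorial in the ordered set $[n]=\{0<\dots<n\}$. The branching semi-globular nerve of $\mathcal C$ is the simplicial set $\mathcal N^{gl^-}(\mathcal C)=\omega Cat(\Delta^*,\mathbb P^-\mathcal C)$. **Proposition.** Let $\mathcal C$ be a non-contracting $\omega$-category whose path $\omega$-category $\mathbb P\mathcal C$ is a strict globular $\omega$-groupoid. Then the simplicial set $\mathcal N^{gl^-}(\mathcal C)$ satisfies the Kan condition, i.e. it is a Kan complex: every simplicial map $\Lambda^n_k\to\mathcal N^{gl^-}(\mathcal C)$ with $n\ge 1$ and $0\le k\le n$ extends to the standard $n$-simplex. -/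

import Mathlib

open CategoryTheory

universe u v w

/-! ### Strict globular omega-categories (one-sorted form) -/

/-- The two signs; `neg` stands for sources and `pos` for targets. -/
inductive Sgn : Type
  | neg : Sgn
  | pos : Sgn

/-- A strict globular omega-category: a set with `n`-sources `d neg n`, `n`-targets `d pos n` and
partially defined compositions `comp n x y`, defined when the `n`-target of `x` is the `n`-source
of `y`, all of whose elements have finite dimension. -/
structure OmegaCat : Type (u + 1) where
  carrier : Type u
  d : Sgn → ℕ → carrier → carrier
  comp : ∀ (n : ℕ) (x y : carrier), d .pos n x = d .neg n y → carrier
  d_d_of_lt : ∀ (β α : Sgn) {m n : ℕ} (x : carrier), m < n → d β m (d α n x) = d β m x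
  d_d_of_le : ∀ (β α : Sgn) {m n : ℕ} (x : carrier), n ≤ m → d β m (d α n x) = d α n x
  id_comp : ∀ (n : ℕ) (x : carrier) (h : d .pos n (d .neg n x) = d .neg n x),
    comp n (d .neg n x) x h = x
  comp_id : ∀ (n : ℕ) (x : carrier) (h : d .pos n x = d .neg n (d .pos n x)),
    comp n x (d .pos n x) h = x
  src_comp : ∀ (n : ℕ) (x y : carrier) (h : d .pos n x = d .neg n y),
    d .neg n (comp n x y h) = d .neg n x
  tgt_comp : ∀ (n : ℕ) (x y : carrier) (h : d .pos n x = d .neg n y),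
    d .pos n (comp n x y h) = d .pos n y
  d_comp : ∀ (α : Sgn) (m n : ℕ) (x y : carrier) (h : d .pos n x = d .neg n y)
    (h' : d .pos n (d α m x) = d .neg n (d α m y)), m ≠ n →
    d α m (comp n x y h) = comp n (d α m x) (d α m y) h'
  assoc : ∀ (n : ℕ) (x y z : carrier) (h₁ : d .pos n x = d .neg n y)
    (h₂ : d .pos n (comp n x y h₁) = d .neg n z) (h₃ : d .pos n y = d .neg n z)
    (h₄ : d .pos n x = d .neg n (comp n y z h₃)),
    comp n (comp n x y h₁) z h₂ = comp n x (comp n y z h₃) h₄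
  interchange : ∀ (m n : ℕ) (x y z w : carrier) (h₁ : d .pos n x = d .neg n y)
    (h₂ : d .pos n z = d .neg n w)
    (h₃ : d .pos m (comp n x y h₁) = d .neg m (comp n z w h₂))
    (h₄ : d .pos m x = d .neg m z) (h₅ : d .pos m y = d .neg m w)
    (h₆ : d .pos n (comp m x z h₄) = d .neg n (comp m y w h₅)), m ≠ n →
    comp m (comp n x y h₁) (comp n z w h₂) h₃ = comp n (comp m x z h₄) (comp m y w h₅) h₆
  finite_dim : ∀ x : carrier, ∃ n : ℕ, ∀ α : Sgn, d α n x = x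

/-- An omega-functor. -/
@[ext]
structure OmegaFunctor (C : OmegaCat.{u}) (D : OmegaCat.{v}) : Type (max u v) where
  toFun : C.carrier → D.carrier
  map_d : ∀ (α : Sgn) (n : ℕ) (x : C.carrier), toFun (C.d α n x) = D.d α n (toFun x)
  map_comp : ∀ (n : ℕ) (x y : C.carrier) (h : C.d .pos n x = C.d .neg n y)
    (h' : D.d .pos n (toFun x) = D.d .neg n (toFun y)),
    toFun (C.comp n x y h) = D.comp n (toFun x) (toFun y) h'

namespace OmegaFunctor

/-- The identity omega-functor. -/
def id (C : OmegaCat.{u}) : OmegaFunctor C C where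
  toFun x := x
  map_d _ _ _ := rfl
  map_comp _ _ _ _ _ := rfl

theorem composable {C : OmegaCat.{u}} {D : OmegaCat.{v}} (f : OmegaFunctor C D) {n : ℕ}
    {x y : C.carrier} (h : C.d .pos n x = C.d .neg n y) :
    D.d .pos n (f.toFun x) = D.d .neg n (f.toFun y) := by
  rw [← f.map_d, ← f.map_d, h]

/-- Composition of omega-functors, `f` first. -/
def comp {C : OmegaCat.{u}} {D : OmegaCat.{v}} {E : OmegaCat.{w}} (f : OmegaFunctor C D)
    (g : OmegaFunctor D E) : OmegaFunctor C E where
  toFun x := g.toFun (f.toFun x)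
  map_d α n x := by rw [f.map_d, g.map_d]
  map_comp n x y h h' := by rw [f.map_comp n x y h (f.composable h), g.map_comp]

end OmegaFunctor

namespace OmegaCat

/-- The dimension of a morphism: the least `n` such that its `n`-source and `n`-target are
the morphism itself. -/
noncomputable def dim (C : OmegaCat.{u}) (x : C.carrier) : ℕ :=
  sInf {n : ℕ | C.d .neg n x = x ∧ C.d .pos n x = x}

/-- The `1`-source and the `1`-target of each morphism of dimension at least `1` are
`1`-dimensional. -/
def NonContracting (C : OmegaCat.{u}) : Prop :=
  ∀ x : C.carrier, 1 ≤ C.dim x → C.dim (C.d .neg 1 x) = 1 ∧ C.dim (C.d .pos 1 x) = 1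

/-- A strict globular omega-groupoid: each morphism of positive dimension is invertible for
each of the compositions. -/
def IsGroupoid (C : OmegaCat.{u}) : Prop :=
  ∀ x : C.carrier, 1 ≤ C.dim x → ∀ r : ℕ,
    ∃ (y : C.carrier) (h : C.d .pos r x = C.d .neg r y) (h' : C.d .pos r y = C.d .neg r x),
      C.comp r x y h = C.d .neg r x ∧ C.comp r y x h' = C.d .neg r y

theorem d_comp_composable (C : OmegaCat.{u}) (α : Sgn) {m n : ℕ} {x y : C.carrier}
    (h : C.d .pos n x = C.d .neg n y) (hmn : m ≠ n) :
    C.d .pos n (C.d α m x) = C.d .neg n (C.d α m y) := by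
  rcases lt_or_gt_of_ne hmn with hlt | hgt
  · rw [C.d_d_of_le _ _ _ hlt.le, C.d_d_of_le _ _ _ hlt.le, ← C.d_d_of_lt α .pos x hlt, h,
      C.d_d_of_lt _ _ _ hlt]
  · rw [C.d_d_of_lt _ _ _ hgt, C.d_d_of_lt _ _ _ hgt, h]

theorem d_eq_of_d_eq (C : OmegaCat.{u}) {α : Sgn} {n : ℕ} {x : C.carrier} (h : C.d α n x = x)
    (β : Sgn) : C.d β n x = x := by
  rw [← h, C.d_d_of_le _ _ _ le_rfl]

theorem one_le_dim_iff (C : OmegaCat.{u}) (α : Sgn) (x : C.carrier) :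
    1 ≤ C.dim x ↔ C.d α 0 x ≠ x := by
  rw [Nat.one_le_iff_ne_zero, not_iff_not, dim, Nat.sInf_eq_zero]
  constructor
  · rintro (h | h)
    · exact C.d_eq_of_d_eq h.1 α
    · obtain ⟨n, hn⟩ := C.finite_dim x
      exact absurd (show n ∈ {n : ℕ | C.d .neg n x = x ∧ C.d .pos n x = x} from ⟨hn _, hn _⟩)
        (by rw [h]; simp)
  · intro h
    exact Or.inl ⟨C.d_eq_of_d_eq h _, C.d_eq_of_d_eq h _⟩

theorem one_le_dim_d (C : OmegaCat.{u}) {x : C.carrier} (hC : C.NonContracting)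
    (hx : 1 ≤ C.dim x) (α : Sgn) (n : ℕ) : 1 ≤ C.dim (C.d α (n + 1) x) := by
  have h1 : 1 ≤ C.dim (C.d .neg 1 x) := (hC x hx).1.ge
  have h2 : 1 ≤ C.dim (C.d α 1 x) := by
    cases α
    · exact h1
    · exact (hC x hx).2.ge
  rw [C.one_le_dim_iff .neg] at h2 ⊢
  intro h
  apply h2
  rw [C.d_d_of_lt _ _ _ (Nat.succ_pos n)] at h
  rw [C.d_d_of_lt _ _ _ one_pos]
  rcases Nat.eq_zero_or_pos n with rfl | hn
  · exact h
  · rw [← C.d_d_of_lt α α x (show 1 < n + 1 by omega), ← h, C.d_d_of_le _ _ _ (Nat.zero_le 1)]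

theorem one_le_dim_comp (C : OmegaCat.{u}) {x y : C.carrier} (hC : C.NonContracting)
    (hx : 1 ≤ C.dim x) (n : ℕ) (h : C.d .pos (n + 1) x = C.d .neg (n + 1) y) :
    1 ≤ C.dim (C.comp (n + 1) x y h) := by
  by_contra hc
  rw [C.one_le_dim_iff .neg, not_not] at hc
  have h1 := C.one_le_dim_d hC hx .neg n
  rw [← C.src_comp (n + 1) x y h, ← hc, C.d_d_of_le _ _ _ (Nat.zero_le _), hc,
    C.one_le_dim_iff .neg] at h1
  exact h1 hc

/-- The path omega-category of a non-contracting omega-category: its elements are the morphisms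
of dimension at least `1`, and the indices of its operations are shifted by one. -/
def path (C : OmegaCat.{u}) (hC : C.NonContracting) : OmegaCat.{u} where
  carrier := {x : C.carrier // 1 ≤ C.dim x}
  d α n x := ⟨C.d α (n + 1) x.1, C.one_le_dim_d hC x.2 α n⟩
  comp n x y h := ⟨C.comp (n + 1) x.1 y.1 (congrArg Subtype.val h), C.one_le_dim_comp hC x.2 n _⟩
  d_d_of_lt β α _ _ x h := Subtype.ext (C.d_d_of_lt β α x.1 (Nat.succ_lt_succ h))
  d_d_of_le β α _ _ x h := Subtype.ext (C.d_d_of_le β α x.1 (Nat.succ_le_succ h))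
  id_comp n x _ := Subtype.ext (C.id_comp (n + 1) x.1 _)
  comp_id n x _ := Subtype.ext (C.comp_id (n + 1) x.1 _)
  src_comp n x y _ := Subtype.ext (C.src_comp (n + 1) x.1 y.1 _)
  tgt_comp n x y _ := Subtype.ext (C.tgt_comp (n + 1) x.1 y.1 _)
  d_comp α m n x y _ h' hmn := Subtype.ext (C.d_comp α (m + 1) (n + 1) x.1 y.1 _
    (congrArg Subtype.val h') (fun e => hmn (Nat.succ_injective e)))
  assoc n x y z _ _ h₃ h₄ := Subtype.ext (C.assoc (n + 1) x.1 y.1 z.1 _ _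
    (congrArg Subtype.val h₃) (congrArg Subtype.val h₄))
  interchange m n x y z w _ _ _ h₄ h₅ h₆ hmn := Subtype.ext (C.interchange (m + 1) (n + 1)
    x.1 y.1 z.1 w.1 _ _ _ (congrArg Subtype.val h₄) (congrArg Subtype.val h₅)
    (congrArg Subtype.val h₆) (fun e => hmn (Nat.succ_injective e)))
  finite_dim x := by
    obtain ⟨n, hn⟩ := C.finite_dim x.1
    exact ⟨n, fun α => Subtype.ext (by
      change C.d α (n + 1) x.1 = x.1
      conv_lhs => rw [← hn α]
      rw [C.d_d_of_le _ _ _ (Nat.le_succ n), hn])⟩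

end OmegaCat

/-! ### Omega-categories given by generators and relations -/

/-- Formal expressions in the operations of an omega-category. -/
inductive OmegaTerm (X : Type u) : Type u
  | gen : X → OmegaTerm X
  | d : Sgn → ℕ → OmegaTerm X → OmegaTerm X
  | comp : ℕ → OmegaTerm X → OmegaTerm X → OmegaTerm X

/-- `OmegaRel E s t` says that the expressions `s` and `t` are both meaningful, and equal,
in the omega-category generated by `X` with the relations `s = x` for `E s x`. In particular
`OmegaRel E t t` says that `t` is meaningful. -/
inductive OmegaRel {X : Type u} (E : OmegaTerm X → X → Prop) : OmegaTerm X → OmegaTerm X → Prop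
  | gen (x : X) : OmegaRel E (.gen x) (.gen x)
  | base {s : OmegaTerm X} {x : X} : E s x → OmegaRel E s (.gen x)
  | symm {s t : OmegaTerm X} : OmegaRel E s t → OmegaRel E t s
  | trans {s t r : OmegaTerm X} : OmegaRel E s t → OmegaRel E t r → OmegaRel E s r
  | d (α : Sgn) (n : ℕ) {s t : OmegaTerm X} : OmegaRel E s t → OmegaRel E (.d α n s) (.d α n t)
  | comp (n : ℕ) {s s' t t' : OmegaTerm X} : OmegaRel E s s' → OmegaRel E t t' →
      OmegaRel E (.d .pos n s) (.d .neg n t) → OmegaRel E (.comp n s t) (.comp n s' t')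
  | d_d_of_lt (β α : Sgn) {m n : ℕ} {t : OmegaTerm X} : m < n → OmegaRel E t t →
      OmegaRel E (.d β m (.d α n t)) (.d β m t)
  | d_d_of_le (β α : Sgn) {m n : ℕ} {t : OmegaTerm X} : n ≤ m → OmegaRel E t t →
      OmegaRel E (.d β m (.d α n t)) (.d α n t)
  | id_comp (n : ℕ) {t : OmegaTerm X} : OmegaRel E t t → OmegaRel E (.comp n (.d .neg n t) t) t
  | comp_id (n : ℕ) {t : OmegaTerm X} : OmegaRel E t t → OmegaRel E (.comp n t (.d .pos n t)) t
  | src_comp (n : ℕ) {s t : OmegaTerm X} : OmegaRel E s s → OmegaRel E t t →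
      OmegaRel E (.d .pos n s) (.d .neg n t) → OmegaRel E (.d .neg n (.comp n s t)) (.d .neg n s)
  | tgt_comp (n : ℕ) {s t : OmegaTerm X} : OmegaRel E s s → OmegaRel E t t →
      OmegaRel E (.d .pos n s) (.d .neg n t) → OmegaRel E (.d .pos n (.comp n s t)) (.d .pos n t)
  | d_comp (α : Sgn) {m n : ℕ} {s t : OmegaTerm X} : m ≠ n → OmegaRel E s s → OmegaRel E t t →
      OmegaRel E (.d .pos n s) (.d .neg n t) →
      OmegaRel E (.d α m (.comp n s t)) (.comp n (.d α m s) (.d α m t))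
  | assoc (n : ℕ) {r s t : OmegaTerm X} : OmegaRel E r r → OmegaRel E s s → OmegaRel E t t →
      OmegaRel E (.d .pos n r) (.d .neg n s) → OmegaRel E (.d .pos n s) (.d .neg n t) →
      OmegaRel E (.comp n (.comp n r s) t) (.comp n r (.comp n s t))
  | interchange {m n : ℕ} {x y z w : OmegaTerm X} : m ≠ n → OmegaRel E x x → OmegaRel E y y →
      OmegaRel E z z → OmegaRel E w w →
      OmegaRel E (.d .pos n x) (.d .neg n y) → OmegaRel E (.d .pos n z) (.d .neg n w) →
      OmegaRel E (.d .pos m (.comp n x y)) (.d .neg m (.comp n z w)) →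
      OmegaRel E (.d .pos m x) (.d .neg m z) → OmegaRel E (.d .pos m y) (.d .neg m w) →
      OmegaRel E (.d .pos n (.comp m x z)) (.d .neg n (.comp m y w)) →
      OmegaRel E (.comp m (.comp n x y) (.comp n z w)) (.comp n (.comp m x z) (.comp m y w))

namespace OmegaRel

variable {X : Type u} {E : OmegaTerm X → X → Prop}

theorem refl_left {s t : OmegaTerm X} (h : OmegaRel E s t) : OmegaRel E s s := h.trans h.symm

theorem refl_right {s t : OmegaTerm X} (h : OmegaRel E s t) : OmegaRel E t t := h.symm.trans h

theorem d_composable (α : Sgn) {m n : ℕ} {s t : OmegaTerm X} (hs : OmegaRel E s s)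
    (ht : OmegaRel E t t) (h : OmegaRel E (.d .pos n s) (.d .neg n t)) (hmn : m ≠ n) :
    OmegaRel E (.d .pos n (.d α m s)) (.d .neg n (.d α m t)) := by
  rcases lt_or_gt_of_ne hmn with hlt | hgt
  · exact (d_d_of_le _ _ hlt.le hs).trans <| (d_d_of_lt α .pos hlt hs).symm.trans <|
      (h.d α m).trans <| (d_d_of_lt α .neg hlt ht).trans (d_d_of_le _ _ hlt.le ht).symm
  · exact (d_d_of_lt _ _ hgt hs).trans <| h.trans (d_d_of_lt _ _ hgt ht).symm

/-- `t` has dimension at most `n`. -/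
def DimLE (E : OmegaTerm X → X → Prop) (n : ℕ) (t : OmegaTerm X) : Prop :=
  ∀ α, OmegaRel E (.d α n t) t

theorem DimLE.mono {n m : ℕ} {t : OmegaTerm X} (h : DimLE E n t) (hnm : n ≤ m) :
    DimLE E m t := fun α =>
  ((h α).d α m).symm.trans ((d_d_of_le α α hnm (h α).refl_right).trans (h α))

theorem DimLE.congr {n : ℕ} {s t : OmegaTerm X} (h : DimLE E n t) (hst : OmegaRel E s t) :
    DimLE E n s := fun α => (hst.d α n).trans ((h α).trans hst.symm)

theorem DimLE.d {s : OmegaTerm X} (hs : OmegaRel E s s) (α : Sgn) (n : ℕ) :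
    DimLE E n (.d α n s) := fun β => d_d_of_le β α le_rfl hs

theorem DimLE.comp {n k l : ℕ} {s t : OmegaTerm X} (hs : DimLE E k s) (ht : DimLE E l t)
    (h : OmegaRel E (.d .pos n s) (.d .neg n t)) :
    DimLE E (max (max k l) (n + 1)) (.comp n s t) := fun α => by
  have hs' := (hs.mono (show k ≤ max (max k l) (n + 1) by omega)) α
  have ht' := (ht.mono (show l ≤ max (max k l) (n + 1) by omega)) α
  have hne : max (max k l) (n + 1) ≠ n := by omega
  exact (OmegaRel.d_comp α hne hs'.refl_right ht'.refl_right h).trans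
    (OmegaRel.comp n hs' ht' (d_composable α hs'.refl_right ht'.refl_right h hne))

theorem induction {Q : OmegaTerm X → Prop}
    (hcongr : ∀ {s t : OmegaTerm X}, OmegaRel E s t → Q t → Q s)
    (hgen : ∀ x, Q (.gen x))
    (hd : ∀ (α : Sgn) (n : ℕ) {t : OmegaTerm X}, OmegaRel E t t → Q t → Q (.d α n t))
    (hcomp : ∀ (n : ℕ) {s t : OmegaTerm X}, OmegaRel E s s → OmegaRel E t t →
      OmegaRel E (.d .pos n s) (.d .neg n t) → Q s → Q t → Q (.comp n s t))
    {s t : OmegaTerm X} (h : OmegaRel E s t) : Q s ∧ Q t := by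
  have key : ∀ {s t : OmegaTerm X}, OmegaRel E s t → Q t → Q s ∧ Q t :=
    fun h ht => ⟨hcongr h ht, ht⟩
  induction h with
  | gen x => exact ⟨hgen x, hgen x⟩
  | base h => exact key (.base h) (hgen _)
  | symm _ ih => exact ih.symm
  | trans _ _ ih₁ ih₂ => exact ⟨ih₁.1, ih₂.2⟩
  | d α n h ih => exact key (.d α n h) (hd α n h.refl_right ih.2)
  | comp n h₁ h₂ h ih₁ ih₂ _ =>
    exact (key (OmegaRel.comp n h₁ h₂ h).symm
      (hcomp n h₁.refl_left h₂.refl_left h ih₁.1 ih₂.1)).symm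
  | d_d_of_lt β α hlt h ih => exact key (.d_d_of_lt β α hlt h) (hd _ _ h ih.1)
  | d_d_of_le β α hle h ih => exact key (.d_d_of_le β α hle h) (hd _ _ h ih.1)
  | id_comp n h ih => exact key (.id_comp n h) ih.1
  | comp_id n h ih => exact key (.comp_id n h) ih.1
  | src_comp n hs ht h ihs _ _ => exact key (.src_comp n hs ht h) (hd _ _ hs ihs.1)
  | tgt_comp n hs ht h _ iht _ => exact key (.tgt_comp n hs ht h) (hd _ _ ht iht.1)
  | d_comp α hmn hs ht h ihs iht _ =>
    exact key (.d_comp α hmn hs ht h) (hcomp _ (hs.d _ _) (ht.d _ _)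
      (d_composable α hs ht h hmn) (hd _ _ hs ihs.1) (hd _ _ ht iht.1))
  | assoc n hr hs ht h₁ h₂ ihr ihs iht _ _ =>
    exact key (.assoc n hr hs ht h₁ h₂)
      (hcomp n hr (OmegaRel.comp n hs ht h₂) (h₁.trans (OmegaRel.src_comp n hs ht h₂).symm)
        ihr.1 (hcomp n hs ht h₂ ihs.1 iht.1))
  | interchange hmn hx hy hz hw h₁ h₂ h₃ h₄ h₅ h₆ ihx ihy ihz ihw _ _ _ _ _ _ =>
    exact key (.interchange hmn hx hy hz hw h₁ h₂ h₃ h₄ h₅ h₆)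
      (hcomp _ (.comp _ hx hz h₄) (.comp _ hy hw h₅) h₆
        (hcomp _ hx hz h₄ ihx.1 ihz.1) (hcomp _ hy hw h₅ ihy.1 ihw.1))

theorem exists_dimLE (hE : ∀ x, ∃ n, ∀ α, E (.d α n (.gen x)) x) {s t : OmegaTerm X}
    (h : OmegaRel E s t) : (∃ n, DimLE E n s) ∧ ∃ n, DimLE E n t := by
  refine induction (Q := fun t => ∃ n, DimLE E n t) ?_ ?_ ?_ ?_ h
  · rintro s t h ⟨n, hn⟩
    exact ⟨n, hn.congr h⟩
  · intro x
    obtain ⟨n, hn⟩ := hE x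
    exact ⟨n, fun α => .base (hn α)⟩
  · intro α n t ht _
    exact ⟨n, .d ht α n⟩
  · rintro n s t _ _ h ⟨k, hk⟩ ⟨l, hl⟩
    exact ⟨_, hk.comp hl h⟩

/-- Meaningful expressions modulo provable equality. -/
def setoid (E : OmegaTerm X → X → Prop) : Setoid {t : OmegaTerm X // OmegaRel E t t} where
  r s t := OmegaRel E s.1 t.1
  iseqv := ⟨fun t => t.2, fun h => h.symm, fun h h' => h.trans h'⟩

end OmegaRel

namespace OmegaCat

section Presented

variable {X : Type u} (E : OmegaTerm X → X → Prop)

/-- Underlying set of the omega-category generated by `X` with the relations `E`. -/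
def PresentedCarrier : Type u := Quotient (OmegaRel.setoid E)

variable {E}

/-- The class of a meaningful expression. -/
def PresentedCarrier.mk (t : OmegaTerm X) (ht : OmegaRel E t t) : PresentedCarrier E :=
  Quotient.mk (OmegaRel.setoid E) ⟨t, ht⟩

theorem PresentedCarrier.exists_rep (q : PresentedCarrier E) :
    ∃ (t : OmegaTerm X) (ht : OmegaRel E t t), q = mk t ht := by
  obtain ⟨t, rfl⟩ := Quotient.exists_rep q
  exact ⟨t.1, t.2, rfl⟩

theorem PresentedCarrier.mk_eq_mk {s t : OmegaTerm X} {hs : OmegaRel E s s}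
    {ht : OmegaRel E t t} : mk s hs = mk t ht ↔ OmegaRel E s t :=
  ⟨fun h => Quotient.exact h, fun h => Quotient.sound h⟩

/-- The operation `d α n` on classes of expressions. -/
def PresentedCarrier.d (α : Sgn) (n : ℕ) : PresentedCarrier E → PresentedCarrier E :=
  Quotient.map' (s₁ := OmegaRel.setoid E) (s₂ := OmegaRel.setoid E)
    (fun t => ⟨.d α n t.1, t.2.d α n⟩) (fun _ _ h => OmegaRel.d α n h)

theorem PresentedCarrier.d_mk (α : Sgn) (n : ℕ) (t : OmegaTerm X) (ht : OmegaRel E t t) :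
    d α n (mk t ht) = mk (.d α n t) (ht.d α n) := rfl

theorem PresentedCarrier.composable_out {n : ℕ} {x y : PresentedCarrier E}
    (h : d .pos n x = d .neg n y) :
    OmegaRel E (.d .pos n (Quotient.out x).1) (.d .neg n (Quotient.out y).1) := by
  rw [← Quotient.out_eq x, ← Quotient.out_eq y] at h
  exact Quotient.exact h

/-- Composition of classes of expressions. -/
noncomputable def PresentedCarrier.comp (n : ℕ) (x y : PresentedCarrier E)
    (h : d .pos n x = d .neg n y) : PresentedCarrier E :=
  mk (.comp n (Quotient.out x).1 (Quotient.out y).1)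
    (OmegaRel.comp n (Quotient.out x).2 (Quotient.out y).2 (composable_out h))

theorem PresentedCarrier.comp_mk (n : ℕ) (s t : OmegaTerm X) (hs : OmegaRel E s s)
    (ht : OmegaRel E t t) (h : d .pos n (mk s hs) = d .neg n (mk t ht)) :
    comp n (mk s hs) (mk t ht) h = mk (.comp n s t) (.comp n hs ht (mk_eq_mk.1 h)) := by
  have h₁ : OmegaRel E (Quotient.out (mk s hs)).1 s :=
    Quotient.exact (Quotient.out_eq (mk s hs))
  have h₂ : OmegaRel E (Quotient.out (mk t ht)).1 t :=
    Quotient.exact (Quotient.out_eq (mk t ht))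
  exact mk_eq_mk.2 (OmegaRel.comp n h₁ h₂ (composable_out h))

open PresentedCarrier in
/-- The omega-category generated by the elements of `X`, subject to the relations `s = x`
for `E s x`. The hypothesis `hE` makes each generator finite-dimensional. -/
noncomputable def presented (E : OmegaTerm X → X → Prop)
    (hE : ∀ x, ∃ n, ∀ α, E (.d α n (.gen x)) x) : OmegaCat.{u} where
  carrier := PresentedCarrier E
  d := PresentedCarrier.d
  comp := PresentedCarrier.comp
  d_d_of_lt β α _ _ x h := by
    obtain ⟨x, hx, rfl⟩ := x.exists_rep
    exact mk_eq_mk.2 (.d_d_of_lt β α h hx)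
  d_d_of_le β α _ _ x h := by
    obtain ⟨x, hx, rfl⟩ := x.exists_rep
    exact mk_eq_mk.2 (.d_d_of_le β α h hx)
  id_comp n x h := by
    obtain ⟨x, hx, rfl⟩ := x.exists_rep
    exact (comp_mk _ _ _ _ _ _).trans (mk_eq_mk.2 (.id_comp n hx))
  comp_id n x h := by
    obtain ⟨x, hx, rfl⟩ := x.exists_rep
    exact (comp_mk _ _ _ _ _ _).trans (mk_eq_mk.2 (.comp_id n hx))
  src_comp n x y h := by
    obtain ⟨x, hx, rfl⟩ := x.exists_rep
    obtain ⟨y, hy, rfl⟩ := y.exists_rep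
    rw [comp_mk]
    exact mk_eq_mk.2 (.src_comp n hx hy (mk_eq_mk.1 h))
  tgt_comp n x y h := by
    obtain ⟨x, hx, rfl⟩ := x.exists_rep
    obtain ⟨y, hy, rfl⟩ := y.exists_rep
    rw [comp_mk]
    exact mk_eq_mk.2 (.tgt_comp n hx hy (mk_eq_mk.1 h))
  d_comp α m n x y h h' hmn := by
    obtain ⟨x, hx, rfl⟩ := x.exists_rep
    obtain ⟨y, hy, rfl⟩ := y.exists_rep
    rw [comp_mk]
    refine Eq.trans ?_ (comp_mk _ _ _ _ _ h').symm
    exact mk_eq_mk.2 (.d_comp α hmn hx hy (mk_eq_mk.1 h))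
  assoc n x y z h₁ h₂ h₃ h₄ := by
    obtain ⟨x, hx, rfl⟩ := x.exists_rep
    obtain ⟨y, hy, rfl⟩ := y.exists_rep
    obtain ⟨z, hz, rfl⟩ := z.exists_rep
    simp only [comp_mk]
    exact mk_eq_mk.2 (.assoc n hx hy hz (mk_eq_mk.1 h₁) (mk_eq_mk.1 h₃))
  interchange m n x y z w h₁ h₂ h₃ h₄ h₅ h₆ hmn := by
    obtain ⟨x, hx, rfl⟩ := x.exists_rep
    obtain ⟨y, hy, rfl⟩ := y.exists_rep
    obtain ⟨z, hz, rfl⟩ := z.exists_rep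
    obtain ⟨w, hw, rfl⟩ := w.exists_rep
    simp only [comp_mk] at h₃ h₆ ⊢
    exact mk_eq_mk.2 (.interchange hmn hx hy hz hw (mk_eq_mk.1 h₁) (mk_eq_mk.1 h₂)
      (mk_eq_mk.1 h₃) (mk_eq_mk.1 h₄) (mk_eq_mk.1 h₅) (mk_eq_mk.1 h₆))
  finite_dim x := by
    obtain ⟨x, hx, rfl⟩ := x.exists_rep
    obtain ⟨n, hn⟩ := (OmegaRel.exists_dimLE hE hx).1
    exact ⟨n, fun α => mk_eq_mk.2 (hn α)⟩

end Presented

section Lift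

variable {X : Type u} {E : OmegaTerm X → X → Prop} (D : OmegaCat.{v}) (f : X → D.carrier)

/-- `y` is the value in `D` of an expression when each generator `x` has the value `f x`. -/
def Eval : OmegaTerm X → D.carrier → Prop
  | .gen x, y => y = f x
  | .d α n t, y => ∃ z, Eval t z ∧ y = D.d α n z
  | .comp n s t, y => ∃ a b, Eval s a ∧ Eval t b ∧
      ∃ h : D.d .pos n a = D.d .neg n b, y = D.comp n a b h

variable {D f}

theorem Eval.unique {t : OmegaTerm X} {y z : D.carrier} (hy : Eval D f t y) (hz : Eval D f t z) :
    y = z := by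
  induction t generalizing y z with
  | gen x => exact Eq.trans hy (Eq.symm hz)
  | d α n t ih =>
    obtain ⟨a, ha, rfl⟩ := hy
    obtain ⟨b, hb, rfl⟩ := hz
    rw [ih ha hb]
  | comp n s t ihs iht =>
    obtain ⟨a, b, ha, hb, h, rfl⟩ := hy
    obtain ⟨a', b', ha', hb', h', rfl⟩ := hz
    obtain rfl := ihs ha ha'
    obtain rfl := iht hb hb'
    rfl

theorem Eval.composable {n : ℕ} {s t : OmegaTerm X} {a b : D.carrier} (ha : Eval D f s a)
    (hb : Eval D f t b)
    (h : ∃ y, Eval D f (.d .pos n s) y ∧ Eval D f (.d .neg n t) y) :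
    D.d .pos n a = D.d .neg n b := by
  obtain ⟨y, h₁, h₂⟩ := h
  have h₃ : Eval D f (.d .pos n s) (D.d .pos n a) := ⟨a, ha, rfl⟩
  have h₄ : Eval D f (.d .neg n t) (D.d .neg n b) := ⟨b, hb, rfl⟩
  exact (h₃.unique h₁).trans (h₂.unique h₄)

theorem Eval.exists_of_rel (hf : ∀ s x, E s x → Eval D f s (f x)) {s t : OmegaTerm X}
    (h : OmegaRel E s t) : ∃ y, Eval D f s y ∧ Eval D f t y := by
  induction h with
  | gen x => exact ⟨f x, rfl, rfl⟩
  | base h => exact ⟨_, hf _ _ h, rfl⟩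
  | symm _ ih => obtain ⟨y, h₁, h₂⟩ := ih; exact ⟨y, h₂, h₁⟩
  | trans _ _ ih₁ ih₂ =>
    obtain ⟨y, h₁, h₂⟩ := ih₁
    obtain ⟨z, h₃, h₄⟩ := ih₂
    obtain rfl := h₂.unique h₃
    exact ⟨y, h₁, h₄⟩
  | d α n _ ih => obtain ⟨y, h₁, h₂⟩ := ih; exact ⟨_, ⟨y, h₁, rfl⟩, y, h₂, rfl⟩
  | comp n _ _ _ ih₁ ih₂ ih =>
    obtain ⟨a, ha, ha'⟩ := ih₁
    obtain ⟨b, hb, hb'⟩ := ih₂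
    have h := ha.composable hb ih
    exact ⟨_, ⟨a, b, ha, hb, h, rfl⟩, a, b, ha', hb', h, rfl⟩
  | d_d_of_lt β α hlt _ ih =>
    obtain ⟨y, h, -⟩ := ih
    exact ⟨_, ⟨_, ⟨y, h, rfl⟩, rfl⟩, y, h, D.d_d_of_lt _ _ _ hlt⟩
  | d_d_of_le β α hle _ ih =>
    obtain ⟨y, h, -⟩ := ih
    exact ⟨_, ⟨_, ⟨y, h, rfl⟩, rfl⟩, y, h, D.d_d_of_le _ _ _ hle⟩
  | id_comp n _ ih =>
    obtain ⟨y, h, -⟩ := ih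
    exact ⟨y, ⟨_, y, ⟨y, h, rfl⟩, h, D.d_d_of_le _ _ _ le_rfl, (D.id_comp n y _).symm⟩, h⟩
  | comp_id n _ ih =>
    obtain ⟨y, h, -⟩ := ih
    exact ⟨y, ⟨y, _, h, ⟨y, h, rfl⟩, (D.d_d_of_le _ _ _ le_rfl).symm,
      (D.comp_id n y _).symm⟩, h⟩
  | src_comp n _ _ _ ihs iht ih =>
    obtain ⟨a, ha, -⟩ := ihs
    obtain ⟨b, hb, -⟩ := iht
    have h := ha.composable hb ih
    exact ⟨_, ⟨_, ⟨a, b, ha, hb, h, rfl⟩, rfl⟩, a, ha, D.src_comp _ _ _ _⟩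
  | tgt_comp n _ _ _ ihs iht ih =>
    obtain ⟨a, ha, -⟩ := ihs
    obtain ⟨b, hb, -⟩ := iht
    have h := ha.composable hb ih
    exact ⟨_, ⟨_, ⟨a, b, ha, hb, h, rfl⟩, rfl⟩, b, hb, D.tgt_comp _ _ _ _⟩
  | d_comp α hmn _ _ _ ihs iht ih =>
    obtain ⟨a, ha, -⟩ := ihs
    obtain ⟨b, hb, -⟩ := iht
    have h := ha.composable hb ih
    exact ⟨_, ⟨_, ⟨a, b, ha, hb, h, rfl⟩, rfl⟩, _, _, ⟨a, ha, rfl⟩, ⟨b, hb, rfl⟩,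
      D.d_comp_composable α h hmn, D.d_comp _ _ _ _ _ _ _ hmn⟩
  | assoc n _ _ _ _ _ ihr ihs iht ih₁ ih₂ =>
    obtain ⟨a, ha, -⟩ := ihr
    obtain ⟨b, hb, -⟩ := ihs
    obtain ⟨c, hc, -⟩ := iht
    have h₁ := ha.composable hb ih₁
    have h₂ := hb.composable hc ih₂
    exact ⟨_, ⟨_, c, ⟨a, b, ha, hb, h₁, rfl⟩, hc, (D.tgt_comp _ _ _ _).trans h₂, rfl⟩,
      a, _, ha, ⟨b, c, hb, hc, h₂, rfl⟩, h₁.trans (D.src_comp _ _ _ _).symm,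
      D.assoc _ _ _ _ _ _ _ _⟩
  | interchange hmn _ _ _ _ _ _ _ _ _ _ ihx ihy ihz ihw ih₁ ih₂ ih₃ ih₄ ih₅ ih₆ =>
    obtain ⟨a, ha, -⟩ := ihx
    obtain ⟨b, hb, -⟩ := ihy
    obtain ⟨c, hc, -⟩ := ihz
    obtain ⟨e, he, -⟩ := ihw
    have h₁ := ha.composable hb ih₁
    have h₂ := hc.composable he ih₂
    have h₄ := ha.composable hc ih₄
    have h₅ := hb.composable he ih₅
    have k₁ : Eval D f (.comp _ _ _) (D.comp _ a b h₁) := ⟨a, b, ha, hb, h₁, rfl⟩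
    have k₂ : Eval D f (.comp _ _ _) (D.comp _ c e h₂) := ⟨c, e, hc, he, h₂, rfl⟩
    have k₄ : Eval D f (.comp _ _ _) (D.comp _ a c h₄) := ⟨a, c, ha, hc, h₄, rfl⟩
    have k₅ : Eval D f (.comp _ _ _) (D.comp _ b e h₅) := ⟨b, e, hb, he, h₅, rfl⟩
    have h₃ := k₁.composable k₂ ih₃
    have h₆ := k₄.composable k₅ ih₆
    exact ⟨_, ⟨_, _, ⟨a, b, ha, hb, h₁, rfl⟩, ⟨c, e, hc, he, h₂, rfl⟩, h₃, rfl⟩,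
      _, _, ⟨a, c, ha, hc, h₄, rfl⟩, ⟨b, e, hb, he, h₅, rfl⟩, h₆,
      D.interchange _ _ _ _ _ _ _ _ _ _ _ _ hmn⟩

variable (hE : ∀ x, ∃ n, ∀ α, E (.d α n (.gen x)) x)

/-- The class of a generator. -/
def presentedGen (x : X) : (presented E hE).carrier := PresentedCarrier.mk (.gen x) (.gen x)

theorem exists_eval (hf : ∀ s x, E s x → Eval D f s (f x)) (q : (presented E hE).carrier) :
    ∃ y : D.carrier, ∀ (t : OmegaTerm X) (ht : OmegaRel E t t), q = PresentedCarrier.mk t ht →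
      Eval D f t y := by
  obtain ⟨t, ht, rfl⟩ := PresentedCarrier.exists_rep q
  obtain ⟨y, hy, -⟩ := Eval.exists_of_rel hf ht
  refine ⟨y, fun s hs h => ?_⟩
  obtain ⟨z, hz, hz'⟩ := Eval.exists_of_rel hf (PresentedCarrier.mk_eq_mk.1 h)
  obtain rfl := hy.unique hz
  exact hz'

/-- The omega-functor on a presented omega-category that is determined by the values of the
generators. -/
noncomputable def presentedLift (hf : ∀ s x, E s x → Eval D f s (f x)) :
    OmegaFunctor (presented E hE) D where
  toFun q := (exists_eval hE hf q).choose
  map_d α n q := by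
    obtain ⟨t, ht, rfl⟩ := PresentedCarrier.exists_rep q
    have h₁ := (exists_eval hE hf (PresentedCarrier.mk t ht)).choose_spec t ht rfl
    have h₂ := (exists_eval hE hf ((presented E hE).d α n (PresentedCarrier.mk t ht))).choose_spec
      _ (ht.d α n) rfl
    have h₃ : Eval D f (.d α n t) (D.d α n _) := ⟨_, h₁, rfl⟩
    exact h₂.unique h₃
  map_comp n x y h h' := by
    obtain ⟨s, hs, rfl⟩ := PresentedCarrier.exists_rep x
    obtain ⟨t, ht, rfl⟩ := PresentedCarrier.exists_rep y
    have h₁ := (exists_eval hE hf (PresentedCarrier.mk s hs)).choose_spec s hs rfl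
    have h₂ := (exists_eval hE hf (PresentedCarrier.mk t ht)).choose_spec t ht rfl
    have h₃ := (exists_eval hE hf ((presented E hE).comp n _ _ h)).choose_spec _ _
      (PresentedCarrier.comp_mk n s t hs ht h)
    have h₄ : Eval D f (.comp n s t) (D.comp n _ _ h') := ⟨_, _, h₁, h₂, h', rfl⟩
    exact h₃.unique h₄

theorem presentedLift_gen (hf : ∀ s x, E s x → Eval D f s (f x)) (x : X) :
    (presentedLift hE hf).toFun (presentedGen hE x) = f x :=
  (exists_eval hE hf _).choose_spec (.gen x) (.gen x) rfl

theorem presented_induction {P : (presented E hE).carrier → Prop}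
    (hgen : ∀ x, P (presentedGen hE x))
    (hd : ∀ (α : Sgn) (n : ℕ) q, P q → P ((presented E hE).d α n q))
    (hcomp : ∀ (n : ℕ) q r h, P q → P r → P ((presented E hE).comp n q r h))
    (q : (presented E hE).carrier) : P q := by
  obtain ⟨t, ht, rfl⟩ := PresentedCarrier.exists_rep q
  refine (OmegaRel.induction (Q := fun t => ∀ ht : OmegaRel E t t, P (PresentedCarrier.mk t ht))
    ?_ ?_ ?_ ?_ ht).1 ht
  · intro s t h hP hs
    have hs' := hP h.refl_right
    rwa [← PresentedCarrier.mk_eq_mk.2 h] at hs'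
  · exact fun x _ => hgen x
  · exact fun α n t ht hP _ => hd α n (PresentedCarrier.mk t ht) (hP ht)
  · intro n s t hs ht h h₁ h₂ _
    have hst : PresentedCarrier.d .pos n (PresentedCarrier.mk s hs) =
        PresentedCarrier.d .neg n (PresentedCarrier.mk t ht) := PresentedCarrier.mk_eq_mk.2 h
    have h' := hcomp n (PresentedCarrier.mk s hs) (PresentedCarrier.mk t ht) hst (h₁ hs) (h₂ ht)
    have e := PresentedCarrier.comp_mk n s t hs ht hst
    exact e ▸ h'

theorem presented_hom_ext {g h : OmegaFunctor (presented E hE) D}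
    (hgh : ∀ x, g.toFun (presentedGen hE x) = h.toFun (presentedGen hE x)) : g = h := by
  ext q
  induction q using presented_induction with
  | hgen x => exact hgh x
  | hd α n q ih => rw [g.map_d, h.map_d, ih]
  | hcomp n q r hqr ihq ihr =>
    rw [g.map_comp n q r hqr (g.composable hqr), h.map_comp n q r hqr (h.composable hqr)]
    congr 1

end Lift

end OmegaCat

/-! ### Globular sets, the free omega-category on a globular set, pushouts -/

/-- A globular set: sets `obj n` with source and target maps `d neg n`, `d pos n` from
`obj (n + 1)` to `obj n` satisfying the globular identities. -/
structure GlobSet : Type (u + 1) where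
  obj : ℕ → Type u
  d : Sgn → ∀ n : ℕ, obj (n + 1) → obj n
  d_d : ∀ (β : Sgn) (n : ℕ) (x : obj (n + 2)), d β n (d .neg (n + 1) x) = d β n (d .pos (n + 1) x)

/-- A morphism of globular sets. -/
structure GlobHom (G H : GlobSet.{u}) : Type u where
  app : ∀ n : ℕ, G.obj n → H.obj n
  map_d : ∀ (α : Sgn) (n : ℕ) (x : G.obj (n + 1)), app n (G.d α n x) = H.d α n (app (n + 1) x)

namespace GlobHom

/-- The identity morphism. -/
def id (G : GlobSet.{u}) : GlobHom G G where
  app _ x := x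
  map_d _ _ _ := rfl

/-- Composition of morphisms, `f` first. -/
def comp {G H K : GlobSet.{u}} (f : GlobHom G H) (g : GlobHom H K) : GlobHom G K where
  app n x := g.app n (f.app n x)
  map_d α n x := by rw [f.map_d, g.map_d]

end GlobHom

namespace OmegaCat

/-- The underlying globular set of an omega-category: `obj n` is the set of morphisms of
dimension at most `n`. -/
def glob (D : OmegaCat.{u}) : GlobSet.{u} where
  obj n := {x : D.carrier // ∀ α, D.d α n x = x}
  d α n x := ⟨D.d α n x.1, fun _ => D.d_d_of_le _ _ _ le_rfl⟩
  d_d β n x := Subtype.ext <| by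
    change D.d β n (D.d .neg (n + 1) x.1) = D.d β n (D.d .pos (n + 1) x.1)
    rw [D.d_d_of_lt _ _ _ n.lt_succ_self, D.d_d_of_lt _ _ _ n.lt_succ_self]

/-- The relations of the free omega-category on a globular set `G`: an element of `G.obj n` has
dimension at most `n`, and its source and target in dimension `n - 1` are those of `G`. -/
inductive FreeRel (G : GlobSet.{u}) : OmegaTerm (Σ n, G.obj n) → (Σ n, G.obj n) → Prop
  | dim (α : Sgn) (n : ℕ) (x : G.obj n) : FreeRel G (.d α n (.gen ⟨n, x⟩)) ⟨n, x⟩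
  | d (α : Sgn) (n : ℕ) (x : G.obj (n + 1)) :
      FreeRel G (.d α n (.gen ⟨n + 1, x⟩)) ⟨n, G.d α n x⟩

theorem FreeRel.finite_dim (G : GlobSet.{u}) (x : Σ n, G.obj n) :
    ∃ n, ∀ α, FreeRel G (.d α n (.gen x)) x := ⟨x.1, fun α => .dim α x.1 x.2⟩

/-- The free omega-category generated by a globular set. -/
noncomputable def free (G : GlobSet.{u}) : OmegaCat.{u} := presented (FreeRel G) (FreeRel.finite_dim G)

/-- The inclusion of the generators into the free omega-category. -/
noncomputable def freeUnit (G : GlobSet.{u}) : GlobHom G (free G).glob where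
  app n x := ⟨presentedGen (FreeRel.finite_dim G) ⟨n, x⟩,
    fun α => PresentedCarrier.mk_eq_mk.2 (.base (.dim α n x))⟩
  map_d α n x := Subtype.ext (PresentedCarrier.mk_eq_mk.2 (OmegaRel.base (.d α n x)).symm)

/-- The omega-functor on the free omega-category that extends a morphism of globular sets. -/
noncomputable def freeLift {G : GlobSet.{u}} {D : OmegaCat.{u}} (φ : GlobHom G D.glob) :
    OmegaFunctor (free G) D :=
  presentedLift (f := fun x => (φ.app x.1 x.2).1) (FreeRel.finite_dim G) <| by
    rintro _ _ (⟨α, n, x⟩ | ⟨α, n, x⟩)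
    · exact ⟨_, rfl, ((φ.app n x).2 α).symm⟩
    · exact ⟨_, rfl, congrArg Subtype.val (φ.map_d α n x)⟩

theorem freeLift_unit {G : GlobSet.{u}} {D : OmegaCat.{u}} (φ : GlobHom G D.glob) (n : ℕ)
    (x : G.obj n) : (freeLift φ).toFun ((freeUnit G).app n x).1 = (φ.app n x).1 :=
  presentedLift_gen _ _ _

theorem free_hom_ext {G : GlobSet.{u}} {D : OmegaCat.{u}} {f g : OmegaFunctor (free G) D}
    (h : ∀ n x, f.toFun ((freeUnit G).app n x).1 = g.toFun ((freeUnit G).app n x).1) : f = g :=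
  presented_hom_ext _ fun x => h x.1 x.2

/-- Functoriality of the free omega-category. -/
noncomputable def freeMap {G H : GlobSet.{u}} (φ : GlobHom G H) :
    OmegaFunctor (free G) (free H) := freeLift (φ.comp (freeUnit H))

/-- The counit of the free-forgetful adjunction. -/
noncomputable def freeCounit (D : OmegaCat.{u}) : OmegaFunctor (free D.glob) D :=
  freeLift (GlobHom.id D.glob)

section Pushout

variable {S A B : OmegaCat.{u}} (f : OmegaFunctor S A) (g : OmegaFunctor S B)

/-- The relations of the pushout: those of `A`, those of `B`, and `f s = g s`. -/
inductive PushoutRel :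
    OmegaTerm (A.carrier ⊕ B.carrier) → A.carrier ⊕ B.carrier → Prop
  | d_left (α : Sgn) (n : ℕ) (a : A.carrier) :
      PushoutRel (.d α n (.gen (.inl a))) (.inl (A.d α n a))
  | d_right (α : Sgn) (n : ℕ) (b : B.carrier) :
      PushoutRel (.d α n (.gen (.inr b))) (.inr (B.d α n b))
  | comp_left (n : ℕ) (a a' : A.carrier) (h : A.d .pos n a = A.d .neg n a') :
      PushoutRel (.comp n (.gen (.inl a)) (.gen (.inl a'))) (.inl (A.comp n a a' h))
  | comp_right (n : ℕ) (b b' : B.carrier) (h : B.d .pos n b = B.d .neg n b') :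
      PushoutRel (.comp n (.gen (.inr b)) (.gen (.inr b'))) (.inr (B.comp n b b' h))
  | glue (s : S.carrier) : PushoutRel (.gen (.inl (f.toFun s))) (.inr (g.toFun s))

theorem PushoutRel.finite_dim (x : A.carrier ⊕ B.carrier) :
    ∃ n, ∀ α, PushoutRel f g (.d α n (.gen x)) x := by
  rcases x with a | b
  · obtain ⟨n, hn⟩ := A.finite_dim a
    refine ⟨n, fun α => ?_⟩
    have h := PushoutRel.d_left (f := f) (g := g) α n a
    rwa [hn α] at h
  · obtain ⟨n, hn⟩ := B.finite_dim b
    refine ⟨n, fun α => ?_⟩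
    have h := PushoutRel.d_right (f := f) (g := g) α n b
    rwa [hn α] at h

/-- The pushout of two omega-functors. -/
noncomputable def pushout : OmegaCat.{u} := presented (PushoutRel f g) (PushoutRel.finite_dim f g)

/-- The first omega-functor into the pushout. -/
noncomputable def pushoutInl : OmegaFunctor A (pushout f g) where
  toFun a := presentedGen (PushoutRel.finite_dim f g) (.inl a)
  map_d α n a := PresentedCarrier.mk_eq_mk.2 (OmegaRel.base (.d_left α n a)).symm
  map_comp n a a' h h' := Eq.trans
    (PresentedCarrier.mk_eq_mk.2 (OmegaRel.base (.comp_left n a a' h)).symm)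
    (PresentedCarrier.comp_mk _ _ _ _ _ h').symm

/-- The second omega-functor into the pushout. -/
noncomputable def pushoutInr : OmegaFunctor B (pushout f g) where
  toFun b := presentedGen (PushoutRel.finite_dim f g) (.inr b)
  map_d α n b := PresentedCarrier.mk_eq_mk.2 (OmegaRel.base (.d_right α n b)).symm
  map_comp n b b' h h' := Eq.trans
    (PresentedCarrier.mk_eq_mk.2 (OmegaRel.base (.comp_right n b b' h)).symm)
    (PresentedCarrier.comp_mk _ _ _ _ _ h').symm

theorem pushout_condition : f.comp (pushoutInl f g) = g.comp (pushoutInr f g) :=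
  OmegaFunctor.ext (funext fun s => PresentedCarrier.mk_eq_mk.2 (.base (.glue s)))

variable {f g}

theorem pushout_exists_desc {D : OmegaCat.{v}} (h : OmegaFunctor A D) (k : OmegaFunctor B D)
    (hk : f.comp h = g.comp k) : ∃! l : OmegaFunctor (pushout f g) D,
      (pushoutInl f g).comp l = h ∧ (pushoutInr f g).comp l = k := by
  have hf : ∀ s x, PushoutRel f g s x →
      Eval D (Sum.elim h.toFun k.toFun) s (Sum.elim h.toFun k.toFun x) := by
    rintro _ _ (⟨α, n, a⟩ | ⟨α, n, b⟩ | ⟨n, a, a', e⟩ | ⟨n, b, b', e⟩ | ⟨s⟩)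
    · exact ⟨_, rfl, h.map_d α n a⟩
    · exact ⟨_, rfl, k.map_d α n b⟩
    · exact ⟨_, _, rfl, rfl, h.composable e, h.map_comp n a a' e _⟩
    · exact ⟨_, _, rfl, rfl, k.composable e, k.map_comp n b b' e _⟩
    · exact (congrFun (congrArg OmegaFunctor.toFun hk) s).symm
  have hl := presentedLift_gen (PushoutRel.finite_dim f g) hf
  refine ⟨presentedLift (PushoutRel.finite_dim f g) hf, ⟨?_, ?_⟩, ?_⟩
  · exact OmegaFunctor.ext (funext fun a => hl (.inl a))
  · exact OmegaFunctor.ext (funext fun b => hl (.inr b))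
  · rintro l ⟨rfl, rfl⟩
    refine presented_hom_ext _ ?_
    rintro (a | b)
    · exact (hl (.inl a)).symm
    · exact (hl (.inr b)).symm

end Pushout

/-! ### The negative semi-path omega-category -/

section SemiPath

variable (C : OmegaCat.{u}) (hC : C.NonContracting)

/-- `GermStep x z` says that `z` is the composite of `x` with some `y` along a `0`-morphism,
all three being elements of the path omega-category. -/
def GermStep (x z : (C.path hC).carrier) : Prop :=
  ∃ (y : (C.path hC).carrier) (h : C.d .pos 0 x.1 = C.d .neg 0 y.1), z.1 = C.comp 0 x.1 y.1 h

/-- The equivalence relation on the path omega-category generated by `GermStep`. -/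
def germSetoid : Setoid (C.path hC).carrier := Relation.EqvGen.setoid (C.GermStep hC)

theorem germSetoid_d (α : Sgn) (n : ℕ) {x y : (C.path hC).carrier}
    (h : (C.germSetoid hC).r x y) :
    (C.germSetoid hC).r ((C.path hC).d α n x) ((C.path hC).d α n y) := by
  induction h with
  | rel x z h =>
    obtain ⟨y, h, hz⟩ := h
    refine .rel _ _ ⟨(C.path hC).d α n y, C.d_comp_composable α h (Nat.succ_ne_zero n), ?_⟩
    change C.d α (n + 1) z.1 = _
    rw [hz]
    exact C.d_comp _ _ _ _ _ _ _ (Nat.succ_ne_zero n)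
  | refl x => exact .refl _
  | symm _ _ _ ih => exact .symm _ _ ih
  | trans _ _ _ _ _ ih₁ ih₂ => exact .trans _ _ _ ih₁ ih₂

/-- The quotient of the underlying globular set of the path omega-category by `germSetoid`. -/
def germGlob : GlobSet.{u} where
  obj n := Quotient ((C.germSetoid hC).comap (fun x : (C.path hC).glob.obj n => x.1))
  d α n := Quotient.map ((C.path hC).glob.d α n) (fun _ _ h => C.germSetoid_d hC α n h)
  d_d β n := by
    rintro ⟨x⟩
    exact congrArg (Quotient.mk _) ((C.path hC).glob.d_d β n x)

/-- The quotient morphism of globular sets. -/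
def germProj : GlobHom (C.path hC).glob (C.germGlob hC) where
  app _ x := Quotient.mk _ x
  map_d _ _ _ := rfl

/-- The negative semi-path omega-category: the pushout of the free omega-functor on the quotient
morphism `germProj` and of the counit at the path omega-category. -/
noncomputable def semiPath : OmegaCat.{u} :=
  pushout (freeMap (C.germProj hC)) (freeCounit (C.path hC))

end SemiPath

end OmegaCat

/-! ### The omega-categories of the simplices -/

namespace Simplex

/-- The `p`-dimensional faces of the `n`-simplex: strictly increasing sequences
`σ 0 < ... < σ p` in `{0, ..., n}`. -/
abbrev Face (n p : ℕ) : Type := Fin (p + 1) ↪o Fin (n + 1)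

/-- The `p`-chains of the `n`-simplex. -/
abbrev Chain (n p : ℕ) : Type := Face n p →₀ ℤ

/-- The boundary, the alternating sum of the faces obtained by removing one vertex. -/
noncomputable def boundary (n p : ℕ) : Chain n (p + 1) →ₗ[ℤ] Chain n p :=
  Finsupp.linearCombination ℤ fun σ : Face n (p + 1) =>
    ∑ i : Fin (p + 2), (-1 : ℤ) ^ (i : ℕ) •
      Finsupp.single ((Fin.succAboveOrderEmb i).trans σ) (1 : ℤ)

/-- The augmentation of `0`-chains. -/
noncomputable def augmentation (n : ℕ) : Chain n 0 →ₗ[ℤ] ℤ :=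
  Finsupp.linearCombination ℤ fun _ : Face n 0 => (1 : ℤ)

/-- A morphism of the omega-category of the `n`-simplex, given by the formal sums `chain neg p`
and `chain pos p` of the `p`-dimensional faces that occur in its `p`-source and `p`-target.
A face has the faces with an even index removed in its source, those with an odd index
removed in its target. -/
@[ext]
structure Cell (n : ℕ) : Type where
  chain : Sgn → ∀ p : ℕ, Chain n p
  nonneg : ∀ (α : Sgn) (p : ℕ), 0 ≤ chain α p
  augmentation_eq : ∀ α : Sgn, augmentation n (chain α 0) = 1
  boundary_eq : ∀ (α : Sgn) (p : ℕ), boundary n p (chain α (p + 1)) = chain .neg p - chain .pos p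

namespace Cell

variable {n : ℕ}

/-- The `m`-source (`α = neg`) and `m`-target (`α = pos`). -/
noncomputable def d (α : Sgn) (m : ℕ) (x : Cell n) : Cell n where
  chain β p := if p < m then x.chain β p else if p = m then x.chain α p else 0
  nonneg β p := by
    split_ifs
    exacts [x.nonneg _ _, x.nonneg _ _, le_rfl]
  augmentation_eq β := by
    split_ifs with h₁ h₂
    exacts [x.augmentation_eq _, x.augmentation_eq _, absurd (Nat.pos_of_ne_zero (Ne.symm h₂)) h₁]
  boundary_eq β p := by
    rcases lt_trichotomy (p + 1) m with h | h | h
    · simp [h, (Nat.lt_succ_self p).trans h, x.boundary_eq]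
    · subst h
      simp [x.boundary_eq]
    · have h₁ : ¬ p + 1 < m := by omega
      have h₂ : p + 1 ≠ m := by omega
      have h₃ : ¬ p < m := by omega
      simp [h₁, h₂, h₃]

theorem chain_eq_of_d_eq {m : ℕ} {x y : Cell n} (h : d .pos m x = d .neg m y) (β : Sgn) {p : ℕ}
    (hp : p < m) : x.chain β p = y.chain β p := by
  have := congrFun (congrFun (congrArg chain h) β) p
  simpa [d, hp] using this

theorem chain_pos_eq_of_d_eq {m : ℕ} {x y : Cell n} (h : d .pos m x = d .neg m y) :
    x.chain .pos m = y.chain .neg m := by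
  have := congrFun (congrFun (congrArg chain h) .neg) m
  simpa [d] using this

/-- Composition along an `m`-dimensional morphism. -/
noncomputable def comp (m : ℕ) (x y : Cell n) (h : d .pos m x = d .neg m y) : Cell n where
  chain β p := if p < m then x.chain β p else if p = m then
      (match β with
        | .neg => x.chain .neg p
        | .pos => y.chain .pos p)
    else x.chain β p + y.chain β p
  nonneg β p := by
    have := x.nonneg
    have := y.nonneg
    split_ifs
    · exact x.nonneg _ _
    · cases β
      exacts [x.nonneg _ _, y.nonneg _ _]
    · exact add_nonneg (x.nonneg _ _) (y.nonneg _ _)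
  augmentation_eq β := by
    split_ifs with h₁ h₂
    · exact x.augmentation_eq _
    · cases β
      exacts [x.augmentation_eq _, y.augmentation_eq _]
    · exact absurd (Nat.pos_of_ne_zero (Ne.symm h₂)) h₁
  boundary_eq β p := by
    rcases lt_trichotomy (p + 1) m with hp | hp | hp
    · simp [hp, (Nat.lt_succ_self p).trans hp, x.boundary_eq]
    · subst hp
      cases β
      · simp [x.boundary_eq]
      · simp [y.boundary_eq, chain_eq_of_d_eq h _ (Nat.lt_succ_self p)]
    · have h₁ : ¬ p + 1 < m := by omega
      have h₂ : p + 1 ≠ m := by omega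
      have h₃ : ¬ p < m := by omega
      rcases eq_or_ne p m with rfl | h₄
      · simp [x.boundary_eq, y.boundary_eq, chain_pos_eq_of_d_eq h]
      · simp [h₁, h₂, h₃, h₄, x.boundary_eq, y.boundary_eq]
        abel

end Cell

theorem isEmpty_face {n p : ℕ} (h : n < p) : IsEmpty (Face n p) :=
  ⟨fun σ => by
    have := Fintype.card_le_of_embedding σ.toEmbedding
    simp at this
    omega⟩

end Simplex

open Simplex in
/-- The omega-category `Δⁿ` associated to the `n`-dimensional simplex (the `n`-th oriental), as
the omega-category of the augmented directed complex of chains of the `n`-simplex. The face `x`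
of dimension `p` is the cell whose `p`-chain is `x` itself and whose `q`-chains for `q < p` are
the iterated sources and targets; the composite of two cells contains the faces of both. -/
noncomputable def simplexOmega (n : ℕ) : OmegaCat.{0} where
  carrier := Cell n
  d := Cell.d
  comp := Cell.comp
  d_d_of_lt β α m k x h := by
    refine Cell.ext (funext fun γ => funext fun p => ?_)
    simp only [Cell.d]
    split_ifs <;> first | rfl | omega
  d_d_of_le β α m k x h := by
    refine Cell.ext (funext fun γ => funext fun p => ?_)
    simp only [Cell.d]
    split_ifs <;> first | rfl | omega
  id_comp m x h := by
    refine Cell.ext (funext fun γ => funext fun p => ?_)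
    cases γ <;> simp only [Cell.d, Cell.comp] <;> split_ifs <;> first | rfl | omega | simp
  comp_id m x h := by
    refine Cell.ext (funext fun γ => funext fun p => ?_)
    cases γ <;> simp only [Cell.d, Cell.comp] <;> split_ifs <;> first | rfl | omega | simp
  src_comp m x y h := by
    refine Cell.ext (funext fun γ => funext fun p => ?_)
    simp only [Cell.d, Cell.comp]
    split_ifs <;> rfl
  tgt_comp m x y h := by
    refine Cell.ext (funext fun γ => funext fun p => ?_)
    simp only [Cell.d, Cell.comp]
    split_ifs with h₁ h₂
    · exact Cell.chain_eq_of_d_eq h γ h₁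
    · rfl
    · rfl
  d_comp α m k x y h h' hmk := by
    refine Cell.ext (funext fun γ => funext fun p => ?_)
    rcases lt_or_gt_of_ne hmk with hlt | hgt <;> cases γ <;> simp only [Cell.d, Cell.comp] <;>
      split_ifs <;> first | rfl | omega
  assoc k x y z h₁ h₂ h₃ h₄ := by
    refine Cell.ext (funext fun γ => funext fun p => ?_)
    cases γ <;> simp only [Cell.comp] <;> split_ifs <;> first | rfl | omega | abel
  interchange m k x y z w h₁ h₂ h₃ h₄ h₅ h₆ hmk := by
    refine Cell.ext (funext fun γ => funext fun p => ?_)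
    cases γ <;> simp only [Cell.comp] <;> split_ifs <;> first | rfl | omega | abel
  finite_dim x := by
    refine ⟨n + 1, fun α => Cell.ext (funext fun γ => funext fun p => ?_)⟩
    rcases Nat.lt_or_ge p (n + 1) with h | h
    · simp only [Cell.d, h, if_true]
    · have := isEmpty_face (show n < p from h)
      exact Subsingleton.elim _ _

namespace Simplex

/-- The face with the given sequence of vertices as a chain; it is `0` when the sequence is not
strictly increasing. -/
noncomputable def bracket {n p : ℕ} (w : Fin (p + 1) → Fin (n + 1)) : Chain n p :=
  open Classical in
  if h : StrictMono w then Finsupp.single (OrderEmbedding.ofStrictMono w h) 1 else 0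

theorem bracket_of_strictMono {n p : ℕ} {w : Fin (p + 1) → Fin (n + 1)} (h : StrictMono w) :
    bracket w = Finsupp.single (OrderEmbedding.ofStrictMono w h) 1 := by
  simp [bracket, h]

theorem bracket_of_not {n p : ℕ} {w : Fin (p + 1) → Fin (n + 1)} (h : ¬ StrictMono w) :
    bracket w = 0 := by
  simp [bracket, h]

theorem bracket_coe {n p : ℕ} (σ : Face n p) : bracket σ = Finsupp.single σ 1 := by
  rw [bracket_of_strictMono σ.strictMono]
  congr 1

theorem bracket_nonneg {n p : ℕ} (w : Fin (p + 1) → Fin (n + 1)) : 0 ≤ bracket w := by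
  by_cases h : StrictMono w
  · rw [bracket_of_strictMono h]
    exact Finsupp.single_nonneg.2 zero_le_one
  · rw [bracket_of_not h]

theorem boundary_bracket {n p : ℕ} {w : Fin (p + 2) → Fin (n + 1)} (hw : Monotone w) :
    boundary n p (bracket w) =
      ∑ i : Fin (p + 2), (-1 : ℤ) ^ (i : ℕ) • bracket (w ∘ i.succAbove) := by
  by_cases h : StrictMono w
  · rw [bracket_of_strictMono h, boundary, Finsupp.linearCombination_single, one_smul]
    refine Finset.sum_congr rfl fun i _ => ?_
    rw [← bracket_coe]
    rfl
  · rw [bracket_of_not h, map_zero]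
    obtain ⟨j, hj⟩ : ∃ j : Fin (p + 1), w j.castSucc = w j.succ := by
      by_contra hc
      push Not at hc
      exact h (Fin.strictMono_iff_lt_succ.2 fun j =>
        lt_of_le_of_ne (hw (Fin.castSucc_lt_succ).le) (hc j))
    have hne : j.castSucc ≠ j.succ := (Fin.castSucc_lt_succ).ne
    symm
    rw [← Finset.sum_subset (Finset.subset_univ {j.castSucc, j.succ}), Finset.sum_pair hne]
    · have : w ∘ j.castSucc.succAbove = w ∘ j.succ.succAbove := by
        funext k
        simp only [Function.comp]
        rcases lt_trichotomy k j with hk | rfl | hk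
        · rw [Fin.succAbove_of_castSucc_lt _ _ (by simpa using hk),
            Fin.succAbove_of_castSucc_lt _ _
              ((Fin.castSucc_lt_castSucc_iff.2 hk).trans Fin.castSucc_lt_succ)]
        · rw [Fin.succAbove_castSucc_self, Fin.succAbove_succ_self, hj]
        · rw [Fin.succAbove_of_le_castSucc _ _ (by simpa using hk.le),
            Fin.succAbove_of_le_castSucc _ _ (by
              rw [Fin.le_def]; simp; omega)]
      rw [this, Fin.val_castSucc, Fin.val_succ, pow_succ]
      simp
    · intro i _ hi
      simp only [Finset.mem_insert, Finset.mem_singleton, not_or] at hi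
      rw [bracket_of_not, smul_zero]
      intro hs
      obtain ⟨a, ha⟩ := Fin.exists_succAbove_eq (Ne.symm hi.1)
      obtain ⟨b, hb⟩ := Fin.exists_succAbove_eq (Ne.symm hi.2)
      have : a = b := hs.injective (by simp [ha, hb, hj])
      exact hne (by rw [← ha, ← hb, this])

/-- The map on chains induced by a monotone map: a face is sent to its image if the map is
injective on it, and to `0` otherwise. -/
noncomputable def push {m n : ℕ} (f : Fin (m + 1) →o Fin (n + 1)) (p : ℕ) :
    Chain m p →ₗ[ℤ] Chain n p :=
  Finsupp.linearCombination ℤ fun σ : Face m p => bracket (f ∘ σ)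

theorem push_bracket {m n p : ℕ} (f : Fin (m + 1) →o Fin (n + 1)) {w : Fin (p + 1) → Fin (m + 1)}
    (hw : Monotone w) : push f p (bracket w) = bracket (f ∘ w) := by
  by_cases h : StrictMono w
  · rw [bracket_of_strictMono h, push, Finsupp.linearCombination_single, one_smul]
    rfl
  · rw [bracket_of_not h, map_zero, bracket_of_not]
    intro hs
    exact h (hw.strictMono_of_injective hs.injective.of_comp)

theorem chain_hom_ext {n p : ℕ} {M : Type*} [AddCommGroup M] {g h : Chain n p →ₗ[ℤ] M}
    (H : ∀ σ : Face n p, g (bracket σ) = h (bracket σ)) : g = h := by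
  refine Finsupp.lhom_ext' fun σ => LinearMap.ext_ring ?_
  simpa [bracket_coe] using H σ

theorem push_nonneg {m n : ℕ} (f : Fin (m + 1) →o Fin (n + 1)) (p : ℕ) {c : Chain m p}
    (hc : 0 ≤ c) : 0 ≤ push f p c := by
  rw [push, Finsupp.linearCombination_apply]
  exact Finset.sum_nonneg fun σ _ => smul_nonneg (hc σ) (bracket_nonneg _)

theorem augmentation_push {m n : ℕ} (f : Fin (m + 1) →o Fin (n + 1)) (c : Chain m 0) :
    augmentation n (push f 0 c) = augmentation m c := by
  refine LinearMap.congr_fun (f := (augmentation n).comp (push f 0)) (chain_hom_ext fun σ => ?_) c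
  rw [LinearMap.comp_apply, push_bracket f σ.monotone, bracket_coe,
    bracket_of_strictMono (fun a b hab => absurd hab (by omega)), augmentation, augmentation,
    Finsupp.linearCombination_single, Finsupp.linearCombination_single]

theorem boundary_push {m n : ℕ} (f : Fin (m + 1) →o Fin (n + 1)) (p : ℕ) (c : Chain m (p + 1)) :
    boundary n p (push f (p + 1) c) = push f p (boundary m p c) := by
  refine LinearMap.congr_fun (f := (boundary n p).comp (push f (p + 1)))
    (g := (push f p).comp (boundary m p)) (chain_hom_ext fun σ => ?_) c
  rw [LinearMap.comp_apply, LinearMap.comp_apply, push_bracket f σ.monotone,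
    boundary_bracket (f.monotone.comp σ.monotone), boundary_bracket σ.monotone, map_sum]
  refine Finset.sum_congr rfl fun i _ => ?_
  rw [map_smul, push_bracket f (σ.monotone.comp (Fin.strictMono_succAbove i).monotone)]
  rfl

theorem push_id {n : ℕ} (p : ℕ) (c : Chain n p) : push OrderHom.id p c = c := by
  refine LinearMap.congr_fun (f := push OrderHom.id p) (g := LinearMap.id)
    (chain_hom_ext fun σ => ?_) c
  rw [push_bracket _ σ.monotone]
  rfl

theorem push_comp {k m n : ℕ} (f : Fin (k + 1) →o Fin (m + 1)) (g : Fin (m + 1) →o Fin (n + 1))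
    (p : ℕ) (c : Chain k p) : push (g.comp f) p c = push g p (push f p c) := by
  refine LinearMap.congr_fun (f := push (g.comp f) p) (g := (push g p).comp (push f p))
    (chain_hom_ext fun σ => ?_) c
  rw [LinearMap.comp_apply, push_bracket _ σ.monotone, push_bracket _ σ.monotone,
    push_bracket _ (f.monotone.comp σ.monotone)]
  rfl

/-- The map on cells induced by a monotone map. -/
noncomputable def Cell.map {m n : ℕ} (f : Fin (m + 1) →o Fin (n + 1)) (x : Cell m) : Cell n where
  chain α p := push f p (x.chain α p)
  nonneg α p := push_nonneg f p (x.nonneg α p)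
  augmentation_eq α := by rw [augmentation_push, x.augmentation_eq]
  boundary_eq α p := by rw [boundary_push, x.boundary_eq, map_sub]

/-- The omega-functor `Δᵐ → Δⁿ` induced by a monotone map. -/
noncomputable def mapOmega {m n : ℕ} (f : Fin (m + 1) →o Fin (n + 1)) :
    OmegaFunctor (simplexOmega m) (simplexOmega n) where
  toFun := Cell.map f
  map_d α k x := by
    refine Cell.ext (funext fun γ => funext fun p => ?_)
    simp only [simplexOmega, Cell.d, Cell.map]
    split_ifs
    exacts [rfl, rfl, map_zero _]
  map_comp k x y h h' := by
    refine Cell.ext (funext fun γ => funext fun p => ?_)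
    cases γ <;> simp only [simplexOmega, Cell.comp, Cell.map] <;> split_ifs <;>
      first | rfl | exact map_add _ _ _

end Simplex

/-! ### Nerves -/

namespace OmegaCat

/-- The simplicial nerve of an omega-category: its `n`-simplices are the omega-functors from
`Δⁿ`, and the simplicial operators are the precompositions with the omega-functors induced by
monotone maps. -/
noncomputable def simplicialNerve (D : OmegaCat.{u}) : SSet.{u} where
  obj k := OmegaFunctor (simplexOmega k.unop.len) D
  map f := TypeCat.ofHom fun x => (Simplex.mapOmega f.unop.toOrderHom).comp x
  map_id k := by
    ext x c
    refine congrArg (OmegaFunctor.toFun x) ?_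
    exact Simplex.Cell.ext (funext fun α => funext fun p => Simplex.push_id p _)
  map_comp f g := by
    ext x c
    refine congrArg (OmegaFunctor.toFun x) ?_
    exact Simplex.Cell.ext (funext fun α => funext fun p => Simplex.push_comp _ _ p _)

/-- The branching semi-globular nerve of a non-contracting omega-category (its simplicial
part, without the augmentation). -/
noncomputable def branchingSemiGlobularNerve (C : OmegaCat.{u}) (hC : C.NonContracting) :
    SSet.{u} :=
  (C.semiPath hC).simplicialNerve

end OmegaCat

/-! Every element of `semiPath` is invertible for every composition. The elements with this property
are closed under sources, targets and compositions, and they include all generators: those of the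
free part are classes of path elements, which the pushout identifies with images of path elements.
It remains to see that the nerve of an omega-category `D` whose elements are all invertible is a Kan
complex.

Structure of `D`. The loops at an object `p` form a group for the composition of index 0, on which
the sources and targets of positive index act as endomorphisms `δ`. Interchange forces `x *_(m+1) y
= x (δ⁺_m x)⁻¹ y` (`Loop.comp_succ`) and an Eckmann-Hilton commutation (`Loop.commute`); in
particular the loops with constant 1-source and 1-target form an abelian group. An element whose
0-source and 0-target are joined to `p` by arrows `a` and `b` is `a⁻¹ z b` for a unique loop `z`.

Existence of functors. Choose an arrow out of `p` for each vertex of the simplex and, for each face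
of dimension `j + 1`, any loop of dimension at most `j + 2` with trivial source. Regard these loops
as a homotopy `h` that starts at the constant functor: up to conjugation by the arrows, a cell goes
to `h(target) - h(source) + δ⁺ h(source)`, one dimension after the other. For faces of dimension at
least 2 this is a sum in the abelian group; for edges it is a product in a noncommutative group,
ordered along the path. The result is an omega-functor (`Gauge.functor`).

Rigidity. Functors on the simplex are controlled by the faces through one vertex `k`
(`functor_ext_of_vertex`). In a face containing `k`, a single facet avoids `k`. One side of the
boundary contains only facets through `k`, so its value is known. On the other side the facet
avoiding `k` occurs once, and its value is recovered by cancellation. This needs the cells of a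
simplex to be generated by the atoms (`Cell.induction_of_le`), which rests on the alternating
lexicographic order: the faces in the source of an atom precede it, and those in the target follow
it (`Cell.altLex_top`).

Filling a horn that contains all the facets through `k`. The value at `k` is `p`, the edge joining
`k` to `v` gives the arrow of `v`, and the face spanned by `k` and `σ` gives the loop of `σ`; all
other loops are trivial. By `Gauge.loop_atom` the functor so defined has the prescribed top
component on each face of the horn through `k`, and rigidity on each facet shows that it restricts
to the given functors. -/

/-! ### Invertible elements of omega-categories -/

namespace OmegaCat

/-- `y` is inverse to `x` for the composition of index `r`. -/
def IsInverse (D : OmegaCat.{u}) (r : ℕ) (x y : D.carrier) : Prop :=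
  ∃ (h : D.d .pos r x = D.d .neg r y) (h' : D.d .pos r y = D.d .neg r x),
    D.comp r x y h = D.d .neg r x ∧ D.comp r y x h' = D.d .neg r y

/-- Each element is invertible for each of the compositions. -/
class AllInvertible (D : OmegaCat.{u}) : Prop where
  exists_inverse : ∀ (r : ℕ) (x : D.carrier), ∃ y, D.IsInverse r x y

variable {D : OmegaCat.{u}}

theorem comp_congr {r : ℕ} {x x' y y' : D.carrier} (hx : x = x') (hy : y = y')
    (h : D.d .pos r x = D.d .neg r y) (h' : D.d .pos r x' = D.d .neg r y') :
    D.comp r x y h = D.comp r x' y' h' := by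
  subst hx hy
  rfl

theorem id_comp' {r : ℕ} {e x : D.carrier} (he : e = D.d .neg r x)
    (h : D.d .pos r e = D.d .neg r x) : D.comp r e x h = x := by
  subst he
  exact D.id_comp r x h

theorem comp_id' {r : ℕ} {e x : D.carrier} (he : e = D.d .pos r x)
    (h : D.d .pos r x = D.d .neg r e) : D.comp r x e h = x := by
  subst he
  exact D.comp_id r x h

theorem comp_of_d_eq {r : ℕ} {x y : D.carrier} (hx : D.d .neg r x = x) (hy : D.d .neg r y = y)
    (h : D.d .pos r x = D.d .neg r y) : x = y ∧ D.comp r x y h = y := by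
  have e : x = y := by rw [← D.d_eq_of_d_eq hx .pos, h, hy]
  exact ⟨e, id_comp' (by rw [e, hy]) h⟩

theorem isInverse_self {r : ℕ} {x : D.carrier} (hx : D.d .neg r x = x) : D.IsInverse r x x := by
  have h : D.d .pos r x = D.d .neg r x := (D.d_eq_of_d_eq hx .pos).trans hx.symm
  exact ⟨h, h, (comp_of_d_eq hx hx h).2.trans hx.symm, (comp_of_d_eq hx hx h).2.trans hx.symm⟩

theorem IsInverse.symm {r : ℕ} {x y : D.carrier} (h : D.IsInverse r x y) : D.IsInverse r y x := by
  obtain ⟨h₁, h₂, h₃, h₄⟩ := h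
  exact ⟨h₂, h₁, h₄, h₃⟩

theorem IsInverse.cancel {r : ℕ} {x x' y z : D.carrier} (hx : D.IsInverse r x x')
    (h : D.d .pos r x = D.d .neg r y) (h' : D.d .pos r x = D.d .neg r z)
    (e : D.comp r x y h = D.comp r x z h') : y = z := by
  obtain ⟨h₁, h₂, -, h₄⟩ := hx
  have key : ∀ (w : D.carrier) (hw : D.d .pos r x = D.d .neg r w),
      ∃ k, D.comp r x' (D.comp r x w hw) k = w := fun w hw => by
    have k : D.d .pos r x' = D.d .neg r (D.comp r x w hw) := h₂.trans (D.src_comp _ _ _ _).symm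
    refine ⟨k, ?_⟩
    rw [← D.assoc r x' x w h₂ ((D.tgt_comp _ _ _ _).trans hw)]
    exact id_comp' (by rw [h₄, ← h₁, hw]) _
  obtain ⟨k, hk⟩ := key y h
  obtain ⟨l, hl⟩ := key z h'
  rw [← hk, ← hl]
  exact comp_congr rfl e _ _

theorem IsInverse.cancel_right {r : ℕ} {x x' y z : D.carrier} (hx : D.IsInverse r x x')
    (h : D.d .pos r y = D.d .neg r x) (h' : D.d .pos r z = D.d .neg r x)
    (e : D.comp r y x h = D.comp r z x h') : y = z := by
  obtain ⟨h₁, h₂, h₃, -⟩ := hx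
  have key : ∀ (w : D.carrier) (hw : D.d .pos r w = D.d .neg r x),
      ∃ k, D.comp r (D.comp r w x hw) x' k = w := fun w hw => by
    have k : D.d .pos r (D.comp r w x hw) = D.d .neg r x' := (D.tgt_comp _ _ _ _).trans h₁
    refine ⟨k, ?_⟩
    rw [D.assoc r w x x' hw k h₁ (hw.trans (D.src_comp _ _ _ _).symm)]
    exact comp_id' (by rw [h₃, hw]) _
  obtain ⟨k, hk⟩ := key y h
  obtain ⟨l, hl⟩ := key z h'
  rw [← hk, ← hl]
  exact comp_congr e rfl _ _

theorem IsInverse.unique {r : ℕ} {x y z : D.carrier} (hy : D.IsInverse r x y)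
    (hz : D.IsInverse r x z) : y = z :=
  hy.cancel hy.1 hz.1 (hy.2.2.1.trans hz.2.2.1.symm)

theorem IsInverse.map {E : OmegaCat.{v}} (f : OmegaFunctor D E) {r : ℕ} {x y : D.carrier}
    (h : D.IsInverse r x y) : E.IsInverse r (f.toFun x) (f.toFun y) := by
  obtain ⟨h₁, h₂, h₃, h₄⟩ := h
  refine ⟨f.composable h₁, f.composable h₂, ?_, ?_⟩
  · rw [← f.map_comp r x y h₁, h₃, f.map_d]
  · rw [← f.map_comp r y x h₂, h₄, f.map_d]

theorem IsInverse.d {r m : ℕ} {x y : D.carrier} (α : Sgn) (hr : r < m) (h : D.IsInverse r x y) :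
    D.IsInverse r (D.d α m x) (D.d α m y) := by
  obtain ⟨h₁, h₂, h₃, h₄⟩ := h
  refine ⟨D.d_comp_composable α h₁ hr.ne', D.d_comp_composable α h₂ hr.ne', ?_, ?_⟩
  · rw [← D.d_comp α m r x y h₁ _ hr.ne', h₃, D.d_d_of_le _ _ _ hr.le, D.d_d_of_lt _ _ _ hr]
  · rw [← D.d_comp α m r y x h₂ _ hr.ne', h₄, D.d_d_of_le _ _ _ hr.le, D.d_d_of_lt _ _ _ hr]

theorem IsInverse.d_of_lt {r m : ℕ} {x y : D.carrier} (α : Sgn) (hr : m < r)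
    (h : D.IsInverse r x y) : D.d α m x = D.d α m y := by
  rw [← D.d_d_of_lt α .pos x hr, h.1, D.d_d_of_lt α _ y hr]

theorem exists_inverse_d {x : D.carrier} (hx : ∀ r, ∃ y, D.IsInverse r x y) (α : Sgn) (n r : ℕ) :
    ∃ y, D.IsInverse r (D.d α n x) y := by
  rcases Nat.lt_or_ge r n with h | h
  · obtain ⟨y, hy⟩ := hx r
    exact ⟨_, hy.d α h⟩
  · exact ⟨_, isInverse_self (D.d_d_of_le _ _ _ h)⟩

/-- For `n = r` the inverse is the composite of the inverses in the reverse order. For `n ≠ r` it is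
their composite in the same order, by interchange. -/
theorem exists_inverse_comp {n : ℕ} {x y : D.carrier} (h : D.d .pos n x = D.d .neg n y)
    (hx : ∀ r, ∃ z, D.IsInverse r x z) (hy : ∀ r, ∃ z, D.IsInverse r y z) (r : ℕ) :
    ∃ z, D.IsInverse r (D.comp n x y h) z := by
  obtain ⟨x', hx'⟩ := hx r
  obtain ⟨y', hy'⟩ := hy r
  have hx₀ := hx'
  have hy₀ := hy'
  obtain ⟨hx₁, hx₂, hx₃, hx₄⟩ := hx'
  obtain ⟨hy₁, hy₂, hy₃, hy₄⟩ := hy'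
  rcases eq_or_ne n r with rfl | hne
  · have k : D.d .pos n y' = D.d .neg n x' := by rw [hy₂, ← h, hx₁]
    have a₁ : D.d .pos n (D.comp n x y h) = D.d .neg n (D.comp n y' x' k) := by
      rw [D.tgt_comp, D.src_comp, hy₁]
    have a₂ : D.d .pos n (D.comp n y' x' k) = D.d .neg n (D.comp n x y h) := by
      rw [D.tgt_comp, D.src_comp, hx₂]
    refine ⟨D.comp n y' x' k, a₁, a₂, ?_, ?_⟩
    · have b : D.d .pos n y = D.d .neg n (D.comp n y' x' k) := by rw [D.src_comp, hy₁]
      rw [D.assoc n x y _ h a₁ b (by rw [D.src_comp, h])]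
      refine Eq.trans (comp_congr rfl ?_ _ hx₁) (hx₃.trans (D.src_comp _ _ _ _).symm)
      rw [← D.assoc n y y' x' hy₁ (by rw [D.tgt_comp, k])]
      exact id_comp' (by rw [hy₃, ← k, hy₂]) _
    · have b : D.d .pos n x' = D.d .neg n (D.comp n x y h) := by rw [D.src_comp, hx₂]
      rw [D.assoc n y' x' _ k a₂ b (by rw [D.src_comp, k])]
      refine Eq.trans (comp_congr rfl ?_ _ hy₂) (hy₄.trans (D.src_comp _ _ _ _).symm)
      rw [← D.assoc n x' x y hx₂ (by rw [D.tgt_comp, h])]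
      exact id_comp' (by rw [hx₄, ← h, hx₁]) _
  -- The inverses are composable: for `n < r` an element and its `r`-inverse have the same
  -- `n`-source and `n`-target; for `n > r` the operation `d` preserves `r`-inverses, which are
  -- unique.
  · have k : D.d .pos n x' = D.d .neg n y' := by
      rcases lt_or_gt_of_ne hne with hlt | hgt
      · rw [← hx₀.d_of_lt _ hlt, ← hy₀.d_of_lt _ hlt, h]
      · have := hx₀.d .pos hgt
        rw [h] at this
        exact this.unique (hy₀.d .neg hgt)
    have a₁ : D.d .pos r (D.comp n x y h) = D.d .neg r (D.comp n x' y' k) := by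
      rw [D.d_comp _ _ _ _ _ _ (D.d_comp_composable _ h hne.symm) hne.symm,
        D.d_comp _ _ _ _ _ _ (D.d_comp_composable _ k hne.symm) hne.symm]
      exact comp_congr hx₁ hy₁ _ _
    have a₂ : D.d .pos r (D.comp n x' y' k) = D.d .neg r (D.comp n x y h) := by
      rw [D.d_comp _ _ _ _ _ _ (D.d_comp_composable _ h hne.symm) hne.symm,
        D.d_comp _ _ _ _ _ _ (D.d_comp_composable _ k hne.symm) hne.symm]
      exact comp_congr hx₂ hy₂ _ _
    refine ⟨D.comp n x' y' k, a₁, a₂, ?_, ?_⟩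
    · have c : D.d .pos n (D.comp r x x' hx₁) = D.d .neg n (D.comp r y y' hy₁) := by
        rw [hx₃, hy₃]; exact D.d_comp_composable _ h hne.symm
      rw [D.interchange r n x y x' y' h k a₁ hx₁ hy₁ c hne.symm,
        D.d_comp _ _ _ _ _ _ (D.d_comp_composable _ h hne.symm) hne.symm]
      exact comp_congr hx₃ hy₃ _ _
    · have c : D.d .pos n (D.comp r x' x hx₂) = D.d .neg n (D.comp r y' y hy₂) := by
        rw [hx₄, hy₄]; exact D.d_comp_composable _ k hne.symm
      rw [D.interchange r n x' y' x y k h a₂ hx₂ hy₂ c hne.symm,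
        D.d_comp _ _ _ _ _ _ (D.d_comp_composable _ k hne.symm) hne.symm]
      exact comp_congr hx₄ hy₄ _ _

theorem IsGroupoid.allInvertible (hD : D.IsGroupoid) : D.AllInvertible where
  exists_inverse r x := by
    by_cases h : 1 ≤ D.dim x
    · exact hD x h r
    · rw [D.one_le_dim_iff .neg, not_not] at h
      refine ⟨x, isInverse_self ?_⟩
      rw [← h, D.d_d_of_le _ _ _ (Nat.zero_le r)]

/-- Elements invertible for all `r` at once are closed under the operations, so the generators
suffice. Those from the path omega-category are images of invertible elements under an
omega-functor; those from the free part reduce to them by surjectivity of the quotient map. -/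
theorem allInvertible_semiPath (C : OmegaCat.{u}) (hC : C.NonContracting)
    (hG : (C.path hC).IsGroupoid) : (C.semiPath hC).AllInvertible := by
  have hP := hG.allInvertible
  let i₁ : OmegaFunctor (free (C.germGlob hC)) (C.semiPath hC) :=
    pushoutInl (freeMap (C.germProj hC)) (freeCounit (C.path hC))
  let i₂ : OmegaFunctor (C.path hC) (C.semiPath hC) :=
    pushoutInr (freeMap (C.germProj hC)) (freeCounit (C.path hC))
  have right : ∀ b r, ∃ y, (C.semiPath hC).IsInverse r (i₂.toFun b) y := fun b r => by
    obtain ⟨y, hy⟩ := hP.exists_inverse r b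
    exact ⟨_, hy.map _⟩
  have left : ∀ a r, ∃ y, (C.semiPath hC).IsInverse r (i₁.toFun a) y := fun a => by
    induction a using presented_induction with
    | hgen x =>
      obtain ⟨n, x⟩ := x
      -- The generator is the class of a path element `x`; commutativity of the pushout square at
      -- the generator `x` turns its image into the image of `x` under `i₂`.
      obtain ⟨x, rfl⟩ := Quotient.exists_rep x
      have e := congrFun (congrArg OmegaFunctor.toFun (pushout_condition (freeMap (C.germProj hC))
        (freeCounit (C.path hC)))) ((freeUnit _).app n x).1
      have e' := freeLift_unit ((C.germProj hC).comp (freeUnit _)) n x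
      simp only [OmegaFunctor.comp] at e
      rw [freeMap, e'] at e
      intro r
      obtain ⟨y, hy⟩ := right _ r
      exact ⟨y, e ▸ hy⟩
    | hd α n q ih =>
      have e := i₁.map_d α n q
      exact fun r => (exists_inverse_d ih α n r).imp fun y hy => e ▸ hy
    | hcomp n q r hqr ihq ihr =>
      have e := i₁.map_comp n q r hqr (i₁.composable hqr)
      exact fun r => (exists_inverse_comp (i₁.composable hqr) ihq ihr r).imp fun y hy => e ▸ hy
  have main : ∀ x, ∀ r, ∃ y, (C.semiPath hC).IsInverse r x y := fun x =>
    presented_induction (PushoutRel.finite_dim (freeMap (C.germProj hC)) (freeCounit (C.path hC)))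
      (P := fun x => ∀ r, ∃ y, (C.semiPath hC).IsInverse r x y)
      (fun x => by rcases x with a | b; exacts [left a, right b])
      (fun α n q ih => exists_inverse_d (D := C.semiPath hC) ih α n)
      (fun n q r hqr ihq ihr => exists_inverse_comp (D := C.semiPath hC) hqr ihq ihr) x
  exact ⟨fun r x => main x r⟩

end OmegaCat

/-! ### Atoms of the omega-categories of the simplices -/

namespace Simplex

/-- Alternating lexicographic comparison of two lists, a list being followed by infinite entries:
at the first place where they differ, `true` means that the larger entry belongs to the smaller
list, and `false` the opposite. -/
def AltLex {α : Type*} [LinearOrder α] : Bool → List α → List α → Prop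
  | _, [], [] => False
  | s, [], _ :: _ => s = true
  | s, _ :: _, [] => s = false
  | s, a :: l, b :: l' => (if s then b < a else a < b) ∨ (a = b ∧ AltLex (!s) l l')

namespace AltLex

variable {α β : Type*} [LinearOrder α] [LinearOrder β]

theorem irrefl (s : Bool) (l : List α) : ¬ AltLex s l l := by
  induction l generalizing s with
  | nil => simp [AltLex]
  | cons a l ih => cases s <;> simp [AltLex, ih]

theorem trans {s : Bool} {l₁ l₂ l₃ : List α} (h : AltLex s l₁ l₂) (h' : AltLex s l₂ l₃) :
    AltLex s l₁ l₃ := by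
  induction l₁ generalizing s l₂ l₃ with
  | nil =>
    cases l₂ <;> cases l₃ <;> simp_all [AltLex]
  | cons a l ih =>
    cases l₂ <;> cases l₃
    · simp_all [AltLex]
    · cases s <;> simp_all [AltLex]
    · simp_all [AltLex]
    · rename_i b l' c l''
      simp only [AltLex] at h h' ⊢
      rcases h with h | ⟨rfl, h⟩ <;> rcases h' with h' | ⟨rfl, h'⟩
      · left
        cases s <;> simp at h h' ⊢
        exacts [h.trans h', h'.trans h]
      · exact Or.inl h
      · exact Or.inl h'
      · exact Or.inr ⟨rfl, ih h h'⟩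

theorem map {f : α → β} (hf : StrictMono f) {s : Bool} {l l' : List α} (h : AltLex s l l') :
    AltLex s (l.map f) (l'.map f) := by
  induction l generalizing s l' with
  | nil => cases l' <;> simp_all [AltLex]
  | cons a l ih =>
    cases l' with
    | nil => simp_all [AltLex]
    | cons b l' =>
      simp only [AltLex, List.map_cons] at h ⊢
      rcases h with h | ⟨rfl, h⟩
      · left
        cases s <;> simp at h ⊢ <;> exact hf h
      · exact Or.inr ⟨rfl, ih h⟩

/-- Changing the initial sign reverses the order. This matches the exchange of sources and targets
that occurs when a common initial vertex is added. -/
theorem not {s : Bool} {l l' : List α} : AltLex (!s) l l' ↔ AltLex s l' l := by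
  induction l generalizing s l' with
  | nil => cases l' <;> cases s <;> simp [AltLex]
  | cons a l ih =>
    cases l' with
    | nil => cases s <;> simp [AltLex]
    | cons b l' =>
      simp only [AltLex]
      rw [← ih]
      cases s <;> simp [eq_comm]

end AltLex

/-- The list of the vertices of a face. -/
def vertices {n p : ℕ} (σ : Face n p) : List (Fin (n + 1)) := List.ofFn σ

theorem vertices_comp {n p q : ℕ} (τ : Face n p) (σ : Face p q) :
    vertices (σ.trans τ) = (vertices σ).map τ := by
  simp [vertices, List.map_ofFn]
  rfl

/-- The inclusion of the last facet. -/
def succHom (n : ℕ) : Fin (n + 1) →o Fin (n + 2) := (Fin.succOrderEmb (n + 1)).toOrderHom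

/-- The face obtained by adding an initial vertex. -/
def consFace {n p : ℕ} (σ : Face n p) : Face (n + 1) (p + 1) :=
  OrderEmbedding.ofStrictMono (Fin.cons 0 (Fin.succ ∘ σ)) <| by
    refine Fin.strictMono_iff_lt_succ.2 fun i => ?_
    induction i using Fin.cases with
    | zero => simp
    | succ i => 
      rw [← Fin.succ_castSucc]
      simp

theorem vertices_consFace {n p : ℕ} (σ : Face n p) :
    vertices (consFace σ) = 0 :: (vertices σ).map Fin.succ := by
  simp [vertices, List.map_ofFn, consFace, List.ofFn_succ]
  rfl

/-- The map on chains that adds an initial vertex to each face. -/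
noncomputable def coneChain (n p : ℕ) : Chain n p →ₗ[ℤ] Chain (n + 1) (p + 1) :=
  Finsupp.lmapDomain ℤ ℤ consFace

/-- The map on chains induced by the inclusion of the last facet. -/
noncomputable def shiftChain (n p : ℕ) : Chain n p →ₗ[ℤ] Chain (n + 1) p := push (succHom n) p

theorem bracket_cons {n p : ℕ} (σ : Face n p) :
    bracket (Fin.cons 0 (Fin.succ ∘ σ) : Fin (p + 2) → Fin (n + 2)) =
      Finsupp.single (consFace σ) 1 :=
  bracket_of_strictMono (consFace σ).strictMono

theorem consFace_monotone {n p : ℕ} (σ : Face n p) :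
    Monotone (Fin.cons 0 (Fin.succ ∘ σ) : Fin (p + 2) → Fin (n + 2)) := (consFace σ).monotone

theorem coneChain_bracket {n p : ℕ} (σ : Face n p) : coneChain n p (bracket σ) =
    bracket (Fin.cons 0 (Fin.succ ∘ σ) : Fin (p + 2) → Fin (n + 2)) := by
  rw [bracket_cons, bracket_coe, coneChain, Finsupp.lmapDomain_apply, Finsupp.mapDomain_single]

/-- Removing the new vertex gives the shifted face; removing an old vertex gives the cone on a
facet, with its index, hence its sign, moved by one. -/
theorem boundary_coneChain {n p : ℕ} (c : Chain n (p + 1)) :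
    boundary (n + 1) (p + 1) (coneChain n (p + 1) c) =
      shiftChain n (p + 1) c - coneChain n p (boundary n p c) := by
  refine LinearMap.congr_fun (f := (boundary (n + 1) (p + 1)).comp (coneChain n (p + 1)))
    (g := shiftChain n (p + 1) - (coneChain n p).comp (boundary n p)) (chain_hom_ext fun σ => ?_) c
  rw [LinearMap.comp_apply, LinearMap.sub_apply, LinearMap.comp_apply, coneChain_bracket,
    boundary_bracket (consFace_monotone σ), boundary_bracket σ.monotone, Fin.sum_univ_succ,
    map_sum, shiftChain, push_bracket _ σ.monotone, sub_eq_add_neg, ← Finset.sum_neg_distrib]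
  congr 1
  · simp only [Fin.val_zero, pow_zero, one_smul]
    congr 1
  · refine Finset.sum_congr rfl fun i _ => ?_
    rw [map_smul, Fin.val_succ, pow_succ, mul_neg_one, neg_smul]
    congr 2
    refine Eq.trans ?_ (coneChain_bracket ((Fin.succAboveOrderEmb i).trans σ)).symm
    congr 1
    funext j
    induction j using Fin.cases with
    | zero => simp
    | succ j => simp [Fin.succ_succAbove_succ]

theorem boundary_coneChain_zero {n : ℕ} (c : Chain n 0) :
    boundary (n + 1) 0 (coneChain n 0 c) =
      shiftChain n 0 c - augmentation n c • bracket (fun _ => 0) := by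
  refine LinearMap.congr_fun (f := (boundary (n + 1) 0).comp (coneChain n 0))
    (g := shiftChain n 0 - (augmentation n).smulRight (bracket (fun _ => 0)))
    (chain_hom_ext fun σ => ?_) c
  rw [LinearMap.comp_apply, LinearMap.sub_apply, coneChain_bracket,
    boundary_bracket (consFace_monotone σ), shiftChain, push_bracket _ σ.monotone,
    Fin.sum_univ_two, sub_eq_add_neg]
  congr 1
  · simp only [Fin.val_zero, pow_zero, one_smul]
    congr 1
  · rw [LinearMap.smulRight_apply, bracket_coe, augmentation, Finsupp.linearCombination_single]
    simp only [Fin.val_one, pow_one, one_smul, neg_smul]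
    congr 2
    funext j
    fin_cases j
    rfl

theorem coneChain_nonneg {n p : ℕ} {c : Chain n p} (hc : 0 ≤ c) : 0 ≤ coneChain n p c := by
  rw [coneChain, Finsupp.lmapDomain_apply, Finsupp.mapDomain]
  exact Finset.sum_nonneg fun σ _ => Finsupp.single_nonneg.2 (hc σ)

theorem augmentation_bracket {n : ℕ} (w : Fin 1 → Fin (n + 1)) :
    augmentation n (bracket w) = 1 := by
  rw [bracket_of_strictMono (fun a b hab => absurd hab (by omega)), augmentation,
    Finsupp.linearCombination_single, one_smul]

/-- The cone on a cell, with a new initial vertex. -/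
noncomputable def Cell.cone {n : ℕ} (x : Cell n) : Cell (n + 1) where
  chain
    | .neg, 0 => shiftChain n 0 (x.chain .neg 0)
    | .pos, 0 => bracket (fun _ => 0)
    | .neg, p + 1 => shiftChain n (p + 1) (x.chain .neg (p + 1)) + coneChain n p (x.chain .pos p)
    | .pos, p + 1 => coneChain n p (x.chain .neg p)
  nonneg
    | .neg, 0 => push_nonneg _ _ (x.nonneg _ _)
    | .pos, 0 => bracket_nonneg _
    | .neg, p + 1 => add_nonneg (push_nonneg _ _ (x.nonneg _ _)) (coneChain_nonneg (x.nonneg _ _))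
    | .pos, p + 1 => coneChain_nonneg (x.nonneg _ _)
  augmentation_eq
    | .neg => by simp only [shiftChain, augmentation_push, x.augmentation_eq]
    | .pos => augmentation_bracket _
  boundary_eq
    | .neg, 0 => by
      simp only [map_add, boundary_coneChain_zero, x.augmentation_eq, shiftChain, boundary_push,
        x.boundary_eq, map_sub, one_smul]
      abel
    | .pos, 0 => by
      simp only [boundary_coneChain_zero, x.augmentation_eq, one_smul]
    | .neg, p + 1 => by
      simp only [map_add, boundary_coneChain, shiftChain, boundary_push, x.boundary_eq, map_sub]
      abel
    | .pos, p + 1 => by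
      simp only [boundary_coneChain, x.boundary_eq, map_sub]
      abel

/-- The cell of the simplex itself. -/
noncomputable def Cell.top : ∀ n : ℕ, Cell n
  | 0 =>
    { chain := fun _ p => match p with
        | 0 => bracket id
        | _ + 1 => 0
      nonneg := fun _ p => match p with
        | 0 => bracket_nonneg _
        | _ + 1 => le_rfl
      augmentation_eq := fun _ => augmentation_bracket _
      boundary_eq := fun _ p => by
        rw [sub_self]
        exact map_zero _ }
  | n + 1 => (Cell.top n).cone

namespace Cell

theorem top_chain_of_lt {n p : ℕ} (h : n < p) (α : Sgn) : (top n).chain α p = 0 := by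
  have := isEmpty_face h
  exact Subsingleton.elim _ _

theorem top_chain_self (n : ℕ) (α : Sgn) : (top n).chain α n = bracket id := by
  induction n generalizing α with
  | zero => rfl
  | succ n ih =>
    have key : coneChain n n (bracket id) = bracket id := by
      refine (coneChain_bracket (RelEmbedding.refl _)).trans ?_
      congr 1
      funext i
      induction i using Fin.cases with
      | zero => rfl
      | succ i => rfl
    cases α
    · change shiftChain n (n + 1) ((top n).chain .neg (n + 1)) + coneChain n n _ = _
      rw [top_chain_of_lt n.lt_succ_self, map_zero, zero_add, ih, key]
    · change coneChain n n _ = _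
      rw [ih, key]

theorem exists_of_shiftChain {n p : ℕ} {c : Chain n p} {e : Face (n + 1) p}
    (h : shiftChain n p c e ≠ 0) : ∃ σ, c σ ≠ 0 ∧ vertices e = (vertices σ).map Fin.succ := by
  rw [shiftChain, push, Finsupp.linearCombination_apply, Finsupp.sum, Finsupp.finsetSum_apply] at h
  obtain ⟨σ, hσ, h⟩ := Finset.exists_ne_zero_of_sum_ne_zero h
  refine ⟨σ, Finsupp.mem_support_iff.1 hσ, ?_⟩
  rw [bracket_of_strictMono (w := succHom n ∘ σ) (Fin.strictMono_succ.comp σ.strictMono)] at h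
  rw [Finsupp.smul_apply, Finsupp.single_apply] at h
  split_ifs at h with h'
  · rw [← h', vertices, vertices, List.map_ofFn]
    rfl
  · simp at h

theorem exists_of_coneChain {n p : ℕ} {c : Chain n p} {e : Face (n + 1) (p + 1)}
    (h : coneChain n p c e ≠ 0) : ∃ σ, c σ ≠ 0 ∧ vertices e = 0 :: (vertices σ).map Fin.succ := by
  rw [coneChain, Finsupp.lmapDomain_apply, Finsupp.mapDomain, Finsupp.sum,
    Finsupp.finsetSum_apply] at h
  obtain ⟨σ, hσ, h⟩ := Finset.exists_ne_zero_of_sum_ne_zero h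
  refine ⟨σ, Finsupp.mem_support_iff.1 hσ, ?_⟩
  rw [Finsupp.single_apply] at h
  split_ifs at h with h'
  · rw [← h', vertices_consFace]
  · simp at h

theorem vertices_refl (n : ℕ) : vertices (RelEmbedding.refl _ : Face n n) = List.finRange (n + 1) := by
  rw [vertices, ← List.ofFn_id]
  rfl

/-- Induction along the cone. A face of the last facet starts with a vertex larger than 0 and so
precedes the whole simplex. A face that contains 0 is the cone on a face of the opposite side one
dimension lower: the common first entry 0 flips the sign of the order, which compensates for the
exchange of sides. -/
theorem altLex_top {n q : ℕ} (h : q < n) (e : Face n q) :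
    ((top n).chain .neg q e ≠ 0 → AltLex true (vertices e) (List.finRange (n + 1))) ∧
    ((top n).chain .pos q e ≠ 0 → AltLex true (List.finRange (n + 1)) (vertices e)) := by
  induction n generalizing q with
  | zero => omega
  | succ n ih =>
    have shift : ∀ (c : Chain n q), shiftChain n q c e ≠ 0 →
        AltLex true (vertices e) (List.finRange (n + 2)) := fun c hc => by
      obtain ⟨σ, -, hσ⟩ := exists_of_shiftChain hc
      rw [hσ, List.finRange_succ, vertices, List.ofFn_succ, List.map_cons]
      exact Or.inl (by simp)
    cases q with
    | zero =>
      refine ⟨shift _, fun hc => ?_⟩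
      change bracket (fun _ => 0) e ≠ 0 at hc
      rw [bracket_of_strictMono (fun a b hab => absurd hab (by omega)),
        Finsupp.single_apply] at hc
      split_ifs at hc with h'
      · rw [← h', List.finRange_succ, vertices]
        simp only [List.ofFn_succ, List.ofFn_zero, List.map_cons, AltLex, List.finRange_succ]
        exact Or.inr ⟨rfl, rfl⟩
      · simp at hc
    | succ q =>
      have ih := fun σ => ih (Nat.lt_of_succ_lt_succ h) σ
      constructor
      · intro hc
        change (shiftChain n (q + 1) ((top n).chain .neg (q + 1)) +
          coneChain n q ((top n).chain .pos q)) e ≠ 0 at hc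
        rw [Finsupp.add_apply] at hc
        by_cases hs : shiftChain n (q + 1) ((top n).chain .neg (q + 1)) e = 0
        · rw [hs, zero_add] at hc
          obtain ⟨σ, h₁, h₂⟩ := exists_of_coneChain hc
          rw [h₂, List.finRange_succ]
          exact Or.inr ⟨rfl, (AltLex.not (s := true)).2 (((ih σ).2 h₁).map Fin.strictMono_succ)⟩
        · exact shift _ hs
      · intro hc
        obtain ⟨σ, h₁, h₂⟩ := exists_of_coneChain (c := (top n).chain .neg q) hc
        rw [h₂, List.finRange_succ]
        exact Or.inr ⟨rfl, (AltLex.not (s := true)).2 (((ih σ).1 h₁).map Fin.strictMono_succ)⟩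

/-- The cell of a face. -/
noncomputable def atom {n p : ℕ} (τ : Face n p) : Cell n := (top p).map τ.toOrderHom

theorem map_map {k m n : ℕ} (f : Fin (k + 1) →o Fin (m + 1)) (g : Fin (m + 1) →o Fin (n + 1))
    (x : Cell k) : (x.map f).map g = x.map (g.comp f) :=
  Cell.ext (funext fun _ => funext fun _ => (push_comp f g _ _).symm)

theorem map_atom {m n p : ℕ} (f : Face n m) (τ : Face m p) :
    (atom τ).map f.toOrderHom = atom (τ.trans f) := map_map _ _ _

theorem atom_chain_of_lt {n p q : ℕ} (τ : Face n p) (h : p < q) (α : Sgn) :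
    (atom τ).chain α q = 0 := by
  change push _ _ _ = _
  rw [top_chain_of_lt h, map_zero]

theorem atom_chain_self {n p : ℕ} (τ : Face n p) (α : Sgn) :
    (atom τ).chain α p = Finsupp.single τ 1 := by
  change push _ _ _ = _
  rw [top_chain_self, push_bracket _ monotone_id, ← bracket_coe]
  rfl

theorem exists_of_push {m n p : ℕ} {f : Face n m} {c : Chain m p} {e : Face n p}
    (h : push f.toOrderHom p c e ≠ 0) : ∃ σ, c σ ≠ 0 ∧ e = σ.trans f := by
  rw [push, Finsupp.linearCombination_apply, Finsupp.sum, Finsupp.finsetSum_apply] at h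
  obtain ⟨σ, hσ, h⟩ := Finset.exists_ne_zero_of_sum_ne_zero h
  refine ⟨σ, Finsupp.mem_support_iff.1 hσ, ?_⟩
  have e' : bracket (f.toOrderHom ∘ σ) = Finsupp.single (σ.trans f) 1 := bracket_coe (σ.trans f)
  rw [e', Finsupp.smul_apply, Finsupp.single_apply] at h
  split_ifs at h with h'
  · exact h'.symm
  · simp at h

theorem altLex_atom_neg {n p q : ℕ} {τ : Face n p} (h : q < p) {e : Face n q}
    (he : (atom τ).chain .neg q e ≠ 0) : AltLex true (vertices e) (vertices τ) := by
  obtain ⟨σ, h₁, rfl⟩ := exists_of_push he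
  have := ((altLex_top h σ).1 h₁).map τ.strictMono
  rwa [← vertices_refl, ← vertices_comp, ← vertices_comp] at this

theorem altLex_atom_pos {n p q : ℕ} {τ : Face n p} (h : q < p) {e : Face n q}
    (he : (atom τ).chain .pos q e ≠ 0) : AltLex true (vertices τ) (vertices e) := by
  obtain ⟨σ, h₁, rfl⟩ := exists_of_push he
  have := ((altLex_top h σ).2 h₁).map τ.strictMono
  rwa [← vertices_refl, ← vertices_comp, ← vertices_comp] at this

/-- A common face would both precede and follow `τ` in a strict order. -/
theorem atom_disjoint {n p q : ℕ} (τ : Face n p) (h : q < p) (e : Face n q) :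
    (atom τ).chain .neg q e = 0 ∨ (atom τ).chain .pos q e = 0 := by
  by_contra! hc
  exact AltLex.irrefl _ _ ((altLex_atom_neg h hc.1).trans (altLex_atom_pos h hc.2))

end Cell

end Simplex

/-! ### The cells of the simplices are generated by the atoms -/

namespace Simplex

namespace Cell

/-- The cell which has the chains of `x` below the dimension `q`, the chains `U` and `V` in
dimension `q`, and the chains `H` above. -/
noncomputable def splice {n : ℕ} (x : Cell n) (q : ℕ) (U V : ∀ p, Chain n p)
    (H : Sgn → ∀ p, Chain n p) (hU : 0 ≤ U q) (hV : 0 ≤ V q) (hH : ∀ α p, q < p → 0 ≤ H α p)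
    (hε : q = 0 → augmentation n (U 0) = 1 ∧ augmentation n (V 0) = 1)
    (hUV : ∀ p, p + 1 = q → boundary n p (U (p + 1)) = x.chain .neg p - x.chain .pos p ∧
      boundary n p (V (p + 1)) = x.chain .neg p - x.chain .pos p)
    (hq : ∀ α, boundary n q (H α (q + 1)) = U q - V q)
    (hlt : ∀ α p, q < p → boundary n p (H α (p + 1)) = H .neg p - H .pos p) : Cell n where
  chain β p := if p < q then x.chain β p else if p = q then
      (match β with
        | .neg => U p
        | .pos => V p)
    else H β p
  nonneg β p := by
    split_ifs with h₁ h₂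
    · exact x.nonneg _ _
    · subst h₂
      cases β
      exacts [hU, hV]
    · exact hH _ _ (by omega)
  augmentation_eq β := by
    split_ifs with h₁ h₂
    · exact x.augmentation_eq _
    · cases β
      exacts [(hε h₂.symm).1, (hε h₂.symm).2]
    · omega
  boundary_eq β p := by
    rcases lt_trichotomy (p + 1) q with hp | hp | hp
    · simp [hp, (Nat.lt_succ_self p).trans hp, x.boundary_eq]
    · subst hp
      cases β
      · simp [(hUV p rfl).1]
      · simp [(hUV p rfl).2]
    · have h₁ : ¬ p + 1 < q := by omega
      have h₂ : p + 1 ≠ q := by omega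
      have h₃ : ¬ p < q := by omega
      rcases eq_or_ne p q with rfl | h₄
      · simp [hq]
      · simp [h₁, h₂, h₃, h₄, hlt β p (by omega)]

variable {n : ℕ}

/-- The sum of the chains of the atoms of a family of faces. -/
noncomputable def atomSum (M : Multiset (Σ p, Face n p)) (α : Sgn) (r : ℕ) : Chain n r :=
  (M.map fun b => (atom b.2).chain α r).sum

theorem atomSum_zero (α : Sgn) (r : ℕ) :
    atomSum (0 : Multiset (Σ p, Face n p)) α r = 0 := by
  simp [atomSum]

theorem atomSum_cons (b : Σ p, Face n p) (M : Multiset (Σ p, Face n p)) (α : Sgn) (r : ℕ) :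
    atomSum (b ::ₘ M) α r = (atom b.2).chain α r + atomSum M α r := by
  simp [atomSum]

theorem atomSum_add (M M' : Multiset (Σ p, Face n p)) (α : Sgn) (r : ℕ) :
    atomSum (M + M') α r = atomSum M α r + atomSum M' α r := by
  simp [atomSum]

theorem atomSum_nonneg (M : Multiset (Σ p, Face n p)) (α : Sgn) (r : ℕ) : 0 ≤ atomSum M α r := by
  induction M using Multiset.induction with
  | empty => rw [atomSum_zero]
  | cons b M ih =>
    rw [atomSum_cons]
    exact add_nonneg ((atom b.2).nonneg _ _) ih

theorem boundary_atomSum (M : Multiset (Σ p, Face n p)) (α : Sgn) (r : ℕ) :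
    boundary n r (atomSum M α (r + 1)) = atomSum M .neg r - atomSum M .pos r := by
  induction M using Multiset.induction with
  | empty => simp [atomSum_zero]
  | cons b M ih =>
    rw [atomSum_cons, atomSum_cons, atomSum_cons, map_add, ih, (atom b.2).boundary_eq]
    abel

theorem augmentation_atomSum (M : Multiset (Σ p, Face n p)) (α : Sgn) :
    augmentation n (atomSum M α 0) = M.card := by
  induction M using Multiset.induction with
  | empty => simp [atomSum_zero]
  | cons b M ih =>
    rw [atomSum_cons, map_add, ih, (atom b.2).augmentation_eq, Multiset.card_cons]
    push_cast
    ring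

theorem atomSum_of_lt {M : Multiset (Σ p, Face n p)} {r : ℕ} (h : ∀ b ∈ M, b.1 < r) (α : Sgn) :
    atomSum M α r = 0 := by
  rw [atomSum]
  refine Multiset.sum_eq_zero fun c hc => ?_
  obtain ⟨b, hb, rfl⟩ := Multiset.mem_map.1 hc
  exact atom_chain_of_lt _ (h b hb) _

/-- A nonnegative chain is a sum of faces. -/
theorem exists_multiset {r : ℕ} {c : Chain n r} (hc : 0 ≤ c) :
    ∃ M : Multiset (Σ p, Face n p), (∀ b ∈ M, b.1 = r) ∧ ∀ α, atomSum M α r = c := by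
  induction c using Finsupp.induction with
  | zero => exact ⟨0, by simp, fun α => atomSum_zero α r⟩
  | single_add e k c he _ ih =>
    have hk : 0 ≤ k := by
      have := hc e
      simpa [Finsupp.notMem_support_iff.1 he] using this
    have hc' : 0 ≤ c := fun e' => by
      rcases eq_or_ne e e' with rfl | h
      · rw [Finsupp.notMem_support_iff.1 he]; rfl
      · have := hc e'
        simpa [Finsupp.single_apply, h] using this
    obtain ⟨M, h₁, h₂⟩ := ih hc'
    refine ⟨Multiset.replicate k.toNat ⟨r, e⟩ + M, ?_, fun α => ?_⟩
    · intro b hb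
      rcases Multiset.mem_add.1 hb with hb | hb
      · rw [Multiset.eq_of_mem_replicate hb]
      · exact h₁ b hb
    · rw [atomSum_add, h₂, atomSum, Multiset.map_replicate, Multiset.sum_replicate,
        atom_chain_self, Finsupp.smul_single]
      congr 2
      simp [hk]

theorem exists_minimal {M : Multiset (Σ p, Face n p)} (hM : M ≠ 0) :
    ∃ b ∈ M, ∀ b' ∈ M, ¬ AltLex true (vertices b'.2) (vertices b.2) := by
  induction M using Multiset.induction with
  | empty => exact absurd rfl hM
  | cons a M ih =>
    rcases eq_or_ne M 0 with rfl | h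
    · exact ⟨a, by simp, by simp [AltLex.irrefl]⟩
    · obtain ⟨b, hb, hmin⟩ := ih h
      by_cases hab : AltLex true (vertices a.2) (vertices b.2)
      · refine ⟨a, Multiset.mem_cons_self _ _, fun b' hb' h' => ?_⟩
        rcases Multiset.mem_cons.1 hb' with rfl | hb'
        · exact AltLex.irrefl _ _ h'
        · exact hmin b' hb' (h'.trans hab)
      · refine ⟨b, Multiset.mem_cons_of_mem hb, fun b' hb' => ?_⟩
        rcases Multiset.mem_cons.1 hb' with rfl | hb'
        exacts [hab, hmin b' hb']

/-- A cell which has several atoms above the dimension `q` is a composite. -/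
theorem exists_split {q : ℕ} {x : Cell n} {b : Σ p, Face n p} {M : Multiset (Σ p, Face n p)}
    (hb : ∀ b' ∈ b ::ₘ M, ¬ AltLex true (vertices b'.2) (vertices b.2))
    (hM : ∀ b' ∈ b ::ₘ M, q < b'.1) (hx : ∀ r, q < r → ∀ α, x.chain α r = atomSum (b ::ₘ M) α r) :
    ∃ (y z : Cell n) (h : Cell.d .pos q y = Cell.d .neg q z), x = Cell.comp q y z h ∧
      (∀ r, q < r → ∀ α, y.chain α r = (atom b.2).chain α r) ∧
      ∀ r, q < r → ∀ α, z.chain α r = atomSum M α r := by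
  have hbq : q < b.1 := hM b (Multiset.mem_cons_self _ _)
  set a := atom b.2 with ha
  -- The `q`-chain between the two factors: start from the `q`-source of `x` and replace the
  -- `q`-source of the atom `a` by its `q`-target.
  let mid : ∀ p, Chain n p := fun p => x.chain .neg p - a.chain .neg p + a.chain .pos p
  have hmidε : q = 0 → augmentation n (mid 0) = 1 := fun _ => by
    simp only [mid, map_add, map_sub, x.augmentation_eq, a.augmentation_eq]
    rfl
  have hmidB : ∀ p, p + 1 = q →
      boundary n p (mid (p + 1)) = x.chain .neg p - x.chain .pos p := fun p _ => by
    simp only [mid, map_add, map_sub, x.boundary_eq, a.boundary_eq]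
    abel
  have hmid : 0 ≤ mid q := fun e => by
    by_cases he : a.chain .neg q e = 0
    · have h₁ := x.nonneg .neg q e
      have h₂ := a.nonneg .pos q e
      simp only [mid, Finsupp.add_apply, Finsupp.sub_apply, he, Finsupp.zero_apply] at h₁ h₂ ⊢
      omega
    -- If `e` is in the source of `a`, it is in the target of no atom of the family, since such an
    -- atom would precede `e` and hence `b`, against minimality. As `x⁻ = x⁺ + (sum of sources) -
    -- (sum of targets)` in dimension `q`, the coefficient of `e` in `x⁻` is then at least its
    -- coefficient in the source of `a`.
    · have hlt := altLex_atom_neg hbq he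
      have h₀ : atomSum (b ::ₘ M) .pos q e = 0 := by
        by_contra hne
        have : ∃ b' ∈ b ::ₘ M, (atom b'.2).chain .pos q e ≠ 0 := by
          by_contra! hc
          apply hne
          rw [atomSum, ← Finsupp.applyAddHom_apply, map_multiset_sum]
          refine Multiset.sum_eq_zero fun c hc' => ?_
          simp only [Multiset.map_map, Multiset.mem_map] at hc'
          obtain ⟨b', hb', rfl⟩ := hc'
          exact hc b' hb'
        obtain ⟨b', hb', hne'⟩ := this
        exact hb b' hb' ((altLex_atom_pos (hM b' hb') hne').trans hlt)
      have h₁ : x.chain .neg q = x.chain .pos q + atomSum (b ::ₘ M) .neg q -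
          atomSum (b ::ₘ M) .pos q := by
        rw [add_sub_assoc, ← boundary_atomSum _ .neg, ← hx _ (Nat.lt_succ_self q), x.boundary_eq]
        abel
      have h₂ := DFunLike.congr_fun h₁ e
      have h₃ := x.nonneg .pos q e
      have h₄ := atomSum_nonneg M .neg q e
      have h₅ := a.nonneg .pos q e
      rw [Finsupp.sub_apply, Finsupp.add_apply, h₀, atomSum_cons, Finsupp.add_apply, ← ha] at h₂
      simp only [mid, Finsupp.add_apply, Finsupp.sub_apply, Finsupp.zero_apply] at h₃ h₄ h₅ ⊢
      omega
  have hxM : ∀ r, q < r → ∀ α, x.chain α r = a.chain α r + atomSum M α r := fun r hr α => by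
    rw [hx r hr, atomSum_cons]
  let y : Cell n := splice x q (x.chain .neg) mid a.chain (x.nonneg _ _) hmid
    (fun _ _ _ => a.nonneg _ _) (fun h => ⟨x.augmentation_eq _, hmidε h⟩)
    (fun p hp => ⟨x.boundary_eq _ _, hmidB p hp⟩)
    (fun α => by simp only [mid, a.boundary_eq]; abel) (fun α p _ => a.boundary_eq _ _)
  let z : Cell n := splice x q mid (x.chain .pos) (atomSum M) hmid (x.nonneg _ _)
    (fun _ _ _ => atomSum_nonneg _ _ _) (fun h => ⟨hmidε h, x.augmentation_eq _⟩)
    (fun p hp => ⟨hmidB p hp, x.boundary_eq _ _⟩)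
    (fun α => by
      have h₁ := x.boundary_eq α q
      rw [hxM _ (Nat.lt_succ_self q), map_add, a.boundary_eq] at h₁
      rw [eq_sub_of_add_eq' h₁]
      simp only [mid]
      abel) (fun α p _ => boundary_atomSum M α p)
  have hyz : Cell.d .pos q y = Cell.d .neg q z := by
    refine Cell.ext (funext fun γ => funext fun p => ?_)
    simp only [Cell.d, y, z, splice]
    split_ifs <;> rfl
  refine ⟨y, z, hyz, ?_, fun r hr α => ?_, fun r hr α => ?_⟩
  · refine Cell.ext (funext fun γ => funext fun p => ?_)
    cases γ <;> simp only [Cell.comp, y, z, splice] <;> split_ifs <;>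
      first | rfl | exact hxM _ (by omega) _
  · simp only [y, splice, hr.not_gt, hr.ne', if_false]
  · simp only [z, splice, hr.not_gt, hr.ne', if_false]

/-- Removing an atom from a cell which has the same chains above the dimension `q`. -/
theorem exists_atomSum_of_succ {q : ℕ} {x : Cell n} {b : Σ p, Face n p} (hb : q < b.1)
    (hx : ∀ r, q < r → ∀ α, x.chain α r = (atom b.2).chain α r) :
    ∃ M : Multiset (Σ p, Face n p), (∀ b' ∈ M, b'.1 = q) ∧
      ∀ r, q ≤ r → ∀ α, x.chain α r = atomSum (b ::ₘ M) α r := by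
  set a := atom b.2 with ha
  -- The `(q + 1)`-chains of `x` and `a` coincide, so their boundaries do: what `x` has in addition
  -- to `a` in dimension `q` is the same in the source and in the target.
  have h₁ : x.chain .neg q - a.chain .neg q = x.chain .pos q - a.chain .pos q := by
    have := x.boundary_eq .neg q
    rw [hx _ (Nat.lt_succ_self q), a.boundary_eq] at this
    rw [sub_eq_sub_iff_sub_eq_sub, this]
  -- At each face either the source or the target of `a` vanishes, so one of the two expressions of
  -- the difference is visibly nonnegative.
  have h₂ : 0 ≤ x.chain .neg q - a.chain .neg q := fun e => by
    rcases atom_disjoint b.2 hb e with h | h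
    · rw [Finsupp.sub_apply, h, sub_zero]
      exact x.nonneg _ _ e
    · rw [h₁, Finsupp.sub_apply, h, sub_zero]
      exact x.nonneg _ _ e
  obtain ⟨M, hM, hM'⟩ := exists_multiset h₂
  refine ⟨M, hM, fun r hr α => ?_⟩
  rw [atomSum_cons]
  rcases hr.eq_or_lt with rfl | hr
  · rw [hM' α]
    cases α
    · rw [add_sub_cancel]
    · rw [h₁, add_sub_cancel]
  · rw [atomSum_of_lt (fun b' hb' => by rw [hM b' hb']; exact hr), add_zero, hx r hr]

/-- Induction on `q`, the dimension from which `x` is known as a sum of atoms. For `q = 0` the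
augmentation counts the atoms, so `x` is one atom. For the step, a minimal atom is split off along
`q` until one atom remains above dimension `q`; the rest of the `q`-chain then consists of
`q`-dimensional faces, and `x` is a sum of atoms from dimension `q` on. -/
theorem induction_of_atomSum {N : ℕ} {P : Cell n → Prop}
    (hatom : ∀ (p : ℕ) (τ : Face n p), p ≤ N → P (atom τ))
    (hcomp : ∀ (q : ℕ) (y z : Cell n) (h : Cell.d .pos q y = Cell.d .neg q z), P y → P z →
      P (Cell.comp q y z h)) (q : ℕ) {M : Multiset (Σ p, Face n p)} (hM : M ≠ 0)
    (hMq : ∀ b ∈ M, q ≤ b.1) (hMN : ∀ b ∈ M, b.1 ≤ N) {x : Cell n}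
    (hx : ∀ r, q ≤ r → ∀ α, x.chain α r = atomSum M α r) : P x := by
  induction q generalizing M x with
  | zero =>
    have h := x.augmentation_eq .neg
    rw [hx 0 le_rfl, augmentation_atomSum] at h
    obtain ⟨b, rfl⟩ := Multiset.card_eq_one.1 (by exact_mod_cast h)
    have : x = atom b.2 := Cell.ext <| funext fun α => funext fun r => by
      rw [hx r r.zero_le, atomSum, Multiset.map_singleton, Multiset.sum_singleton]
    rw [this]
    exact hatom _ _ (hMN b (by simp))
  | succ q ih =>
    have single : ∀ (b : Σ p, Face n p), q < b.1 → b.1 ≤ N → ∀ x : Cell n,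
        (∀ r, q < r → ∀ α, x.chain α r = (atom b.2).chain α r) → P x := fun b hb hbN x hx => by
      obtain ⟨M, hM, hM'⟩ := exists_atomSum_of_succ hb hx
      refine ih (Multiset.cons_ne_zero) (fun b' hb' => ?_) (fun b' hb' => ?_) hM' <;>
        rcases Multiset.mem_cons.1 hb' with rfl | hb'
      · exact hb.le
      · exact (hM b' hb').ge
      · exact hbN
      · rw [hM b' hb']; omega
    clear ih
    induction hk : M.card generalizing M x with
    | zero => exact absurd (Multiset.card_eq_zero.1 hk) hM
    | succ k ihk =>
      obtain ⟨b, hbM, hmin⟩ := exists_minimal hM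
      obtain ⟨M, rfl⟩ := Multiset.exists_cons_of_mem hbM
      obtain ⟨y, z, h, rfl, hy, hz⟩ := exists_split hmin hMq hx
      have hyP := single b (hMq b hbM) (hMN b hbM) y hy
      rcases eq_or_ne M 0 with rfl | hne
      · exact single b (hMq b hbM) (hMN b hbM) _ fun r hr α => by
          rw [hx r hr, atomSum_cons, atomSum_zero, add_zero]
      · refine hcomp _ _ _ _ hyP (ihk hne (fun b' hb' => hMq b' (Multiset.mem_cons_of_mem hb'))
          (fun b' hb' => hMN b' (Multiset.mem_cons_of_mem hb')) hz ?_)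
        rw [Multiset.card_cons] at hk
        omega

/-- The cells of dimension at most `N` are generated by the atoms of dimension at most `N`. -/
theorem induction_of_le {N : ℕ} {P : Cell n → Prop}
    (hatom : ∀ (p : ℕ) (τ : Face n p), p ≤ N → P (atom τ))
    (hcomp : ∀ (q : ℕ) (y z : Cell n) (h : Cell.d .pos q y = Cell.d .neg q z), P y → P z →
      P (Cell.comp q y z h)) {x : Cell n} (hx : ∀ r, N < r → ∀ α, x.chain α r = 0) : P x := by
  induction N with
  | zero =>
    have h : x.chain .pos 0 = x.chain .neg 0 := by
      have := x.boundary_eq .neg 0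
      rw [hx _ Nat.zero_lt_one, map_zero] at this
      exact (sub_eq_zero.1 this.symm).symm
    obtain ⟨M, hM, hM'⟩ := exists_multiset (x.nonneg .neg 0)
    refine induction_of_atomSum hatom hcomp 0 (M := M) ?_ (fun _ _ => Nat.zero_le _)
      (fun b hb => (hM b hb).le) fun r _ α => ?_
    · rintro rfl
      have := x.augmentation_eq .neg
      rw [← hM' .neg, atomSum_zero, map_zero] at this
      exact zero_ne_one this
    · rcases Nat.eq_zero_or_pos r with rfl | hr
      · rw [hM' α]; cases α; exacts [rfl, h]
      · rw [hx r hr, atomSum_of_lt fun b hb => by rw [hM b hb]; exact hr]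
  | succ N ih =>
    have h : x.chain .pos (N + 1) = x.chain .neg (N + 1) := by
      have := x.boundary_eq .neg (N + 1)
      rw [hx _ (Nat.lt_succ_self _), map_zero] at this
      exact (sub_eq_zero.1 this.symm).symm
    obtain ⟨M, hM, hM'⟩ := exists_multiset (x.nonneg .neg (N + 1))
    rcases eq_or_ne M 0 with rfl | hne
    · refine ih (fun p τ hp => hatom p τ (by omega)) fun r hr α => ?_
      rcases (show N + 1 ≤ r from hr).eq_or_lt with rfl | hr
      · cases α
        · rw [← hM' .neg, atomSum_zero]
        · rw [h, ← hM' .neg, atomSum_zero]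
      · exact hx r hr α
    · refine induction_of_atomSum hatom hcomp (N + 1) hne (fun b hb => (hM b hb).ge)
        (fun b hb => (hM b hb).le) fun r hr α => ?_
      rcases hr.eq_or_lt with rfl | hr
      · rw [hM' α]; cases α; exacts [rfl, h]
      · rw [hx r hr, atomSum_of_lt fun b hb => by rw [hM b hb]; exact hr]

theorem chain_eq_zero_of_lt {x : Cell n} {r : ℕ} (h : n < r) (α : Sgn) : x.chain α r = 0 := by
  have := isEmpty_face h
  exact Subsingleton.elim _ _

end Cell

end Simplex

/-! ### Omega-functors on the simplices that agree on atoms -/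

namespace OmegaCat

theorem d_neg_comp_eq_self {D : OmegaCat.{u}} {q r : ℕ} {x y : D.carrier}
    (h : D.d .pos r x = D.d .neg r y) (hx : D.d .neg q x = x) (hy : D.d .neg q y = y) :
    D.d .neg q (D.comp r x y h) = D.comp r x y h := by
  rcases Nat.lt_or_ge r q with hr | hr
  · rw [D.d_comp _ _ _ _ _ _ (D.d_comp_composable _ h hr.ne') hr.ne']
    exact comp_congr hx hy _ _
  · have hx' : D.d .neg r x = x := by rw [← hx, D.d_d_of_le _ _ _ hr]
    have hy' : D.d .neg r y = y := by rw [← hy, D.d_d_of_le _ _ _ hr]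
    rw [(comp_of_d_eq hx' hy' h).2, hy]

end OmegaCat

namespace Simplex

variable {n : ℕ}

/-- The facet of a face opposite to the vertex of index `i`. -/
def facet {p : ℕ} (ρ : Face n (p + 1)) (i : Fin (p + 2)) : Face n p :=
  (Fin.succAboveOrderEmb i).trans ρ

theorem facet_injective {p : ℕ} (ρ : Face n (p + 1)) : Function.Injective (facet ρ) := by
  intro i j h
  refine Fin.succAbove_left_injective (funext fun a => ρ.injective ?_)
  exact DFunLike.congr_fun h a

theorem boundary_single {p : ℕ} (ρ : Face n (p + 1)) : boundary n p (Finsupp.single ρ 1) =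
    ∑ i : Fin (p + 2), (-1 : ℤ) ^ (i : ℕ) • Finsupp.single (facet ρ i) (1 : ℤ) := by
  rw [boundary, Finsupp.linearCombination_single, one_smul]
  rfl

theorem boundary_single_facet {p : ℕ} (ρ : Face n (p + 1)) (i : Fin (p + 2)) :
    boundary n p (Finsupp.single ρ 1) (facet ρ i) = (-1 : ℤ) ^ (i : ℕ) := by
  rw [boundary_single, Finsupp.finsetSum_apply, Finset.sum_eq_single i]
  · simp
  · intro j _ hj
    simp [(facet_injective ρ).ne hj]
  · simp

/-- The facets of even index occur in the source of a face, those of odd index in its target. -/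
def facetSgn {p : ℕ} (i : Fin p) : Sgn := if Even (i : ℕ) then .neg else .pos

namespace Cell

theorem atom_boundary {p : ℕ} (ρ : Face n (p + 1)) : boundary n p (Finsupp.single ρ 1) =
    (atom ρ).chain .neg p - (atom ρ).chain .pos p := by
  rw [← atom_chain_self ρ .neg, (atom ρ).boundary_eq]

/-- The boundary of a face is its source minus its target, and these share no face. Nothing cancels,
so the sign of a facet in the boundary decides on which side it lies. -/
theorem exists_facet_of_atom {p : ℕ} {ρ : Face n (p + 1)} {α : Sgn} {σ : Face n p}
    (h : (atom ρ).chain α p σ ≠ 0) : ∃ i, σ = facet ρ i ∧ facetSgn i = α := by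
  have h₁ := DFunLike.congr_fun (atom_boundary ρ) σ
  have h₂ := (atom ρ).nonneg α p σ
  rw [Finsupp.sub_apply] at h₁
  rw [Finsupp.zero_apply] at h₂
  have h₃ : boundary n p (Finsupp.single ρ 1) σ ≠ 0 := by
    rcases atom_disjoint ρ p.lt_succ_self σ with h' | h' <;> cases α <;> omega
  obtain ⟨i, hi⟩ : ∃ i, facet ρ i = σ := by
    by_contra! hc
    apply h₃
    rw [boundary_single, Finsupp.finsetSum_apply]
    refine Finset.sum_eq_zero fun i _ => ?_
    simp [hc i]
  refine ⟨i, hi.symm, ?_⟩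
  subst hi
  rw [boundary_single_facet] at h₁
  rw [facetSgn]
  split_ifs with he
  · rw [he.neg_one_pow] at h₁
    rcases atom_disjoint ρ p.lt_succ_self (facet ρ i) with h' | h' <;> cases α <;> first | rfl | omega
  · rw [(Nat.not_even_iff_odd.1 he).neg_one_pow] at h₁
    rcases atom_disjoint ρ p.lt_succ_self (facet ρ i) with h' | h' <;> cases α <;> first | rfl | omega

theorem atom_facet {p : ℕ} (ρ : Face n (p + 1)) (i : Fin (p + 2)) :
    (atom ρ).chain (facetSgn i) p (facet ρ i) = 1 := by
  have h₁ := DFunLike.congr_fun (atom_boundary ρ) (facet ρ i)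
  have h₂ := (atom ρ).nonneg .neg p (facet ρ i)
  have h₃ := (atom ρ).nonneg .pos p (facet ρ i)
  rw [Finsupp.sub_apply, boundary_single_facet] at h₁
  rw [Finsupp.zero_apply] at h₂ h₃
  rw [facetSgn]
  split_ifs with he
  · rw [he.neg_one_pow] at h₁
    rcases atom_disjoint ρ p.lt_succ_self (facet ρ i) with h' | h' <;> omega
  · rw [(Nat.not_even_iff_odd.1 he).neg_one_pow] at h₁
    rcases atom_disjoint ρ p.lt_succ_self (facet ρ i) with h' | h' <;> omega

theorem d_eq_self_of_chain {q : ℕ} {x : Cell n} (h : ∀ r, q < r → ∀ α, x.chain α r = 0) (α : Sgn) :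
    Cell.d α q x = x := by
  have e : x.chain .neg q = x.chain .pos q := by
    have := x.boundary_eq .neg q
    rw [h _ q.lt_succ_self, map_zero] at this
    exact sub_eq_zero.1 this.symm
  refine Cell.ext (funext fun γ => funext fun r => ?_)
  simp only [Cell.d]
  split_ifs with h₁ h₂
  · rfl
  · subst h₂
    cases α <;> cases γ <;> first | rfl | exact e | exact e.symm
  · exact (h r (by omega) γ).symm

theorem chain_of_d_eq_self {q : ℕ} {x : Cell n} {α : Sgn} (h : Cell.d α q x = x) {r : ℕ}
    (hr : q < r) (β : Sgn) : x.chain β r = 0 := by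
  rw [← h]
  simp [Cell.d, hr.not_gt, hr.ne']

theorem d_atom_of_le {p q : ℕ} (τ : Face n p) (h : p ≤ q) (α : Sgn) :
    Cell.d α q (atom τ) = atom τ :=
  d_eq_self_of_chain (fun _ hr _ => atom_chain_of_lt τ (h.trans_lt hr) _) α

end Cell

open Cell

variable {D : OmegaCat.{u}}

theorem map_cell_d (f : OmegaFunctor (simplexOmega n) D) (α : Sgn) (q : ℕ) (x : Cell n) :
    f.toFun (Cell.d α q x) = D.d α q (f.toFun x) := f.map_d α q x

theorem map_comp_congr {f f' : OmegaFunctor (simplexOmega n) D} {r : ℕ} {y z : Cell n}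
    (h : Cell.d .pos r y = Cell.d .neg r z) (hy : f.toFun y = f'.toFun y)
    (hz : f.toFun z = f'.toFun z) :
    f.toFun (Cell.comp r y z h) = f'.toFun (Cell.comp r y z h) :=
  (f.map_comp r y z h (f.composable h)).trans <| (OmegaCat.comp_congr hy hz _ _).trans
    (f'.map_comp r y z h (f'.composable h)).symm

/-- Omega-functors on a simplex are determined by the values of the atoms. -/
theorem functor_ext {f f' : OmegaFunctor (simplexOmega n) D}
    (h : ∀ (p : ℕ) (τ : Face n p), f.toFun (atom τ) = f'.toFun (atom τ)) : f = f' :=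
  OmegaFunctor.ext <| funext fun _ =>
    induction_of_le (N := n) (P := fun x => f.toFun x = f'.toFun x) (fun p τ _ => h p τ)
      (fun _ _ _ h hy hz => map_comp_congr h hy hz)
      (fun _ hr α => chain_eq_zero_of_lt hr α)

/-- For `r < q` the `q`-chains of a composite add up. For `r ≥ q` both factors are identities for
the composition, which is then trivial. -/
theorem comp_cases {q r : ℕ} {y z : Cell n} (h : Cell.d .pos r y = Cell.d .neg r z)
    (hy : Cell.d .neg q y = y) (hz : Cell.d .neg q z = z) :
    Cell.comp r y z h = z ∧ y = z ∨
      (Cell.comp r y z h).chain .neg q = y.chain .neg q + z.chain .neg q := by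
  rcases Nat.lt_or_ge r q with hr | hr
  · right
    simp [Cell.comp, hr.not_gt, hr.ne']
  · left
    have hy' : (simplexOmega n).d .neg r y = y := by
      rw [← hy]; exact (simplexOmega n).d_d_of_le _ _ _ hr
    have hz' : (simplexOmega n).d .neg r z = z := by
      rw [← hz]; exact (simplexOmega n).d_d_of_le _ _ _ hr
    have := OmegaCat.comp_of_d_eq hy' hz' h
    exact ⟨this.2, this.1⟩

/-- Nonnegative coefficients add in a nontrivial composite, so each `q`-face of a factor is still a
`q`-face of the composite, and the hypothesis passes to the factors. -/
theorem eq_of_support {f f' : OmegaFunctor (simplexOmega n) D} {q : ℕ}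
    (hlt : ∀ p < q, ∀ τ : Face n p, f.toFun (atom τ) = f'.toFun (atom τ)) {x : Cell n}
    (hx : Cell.d .neg q x = x)
    (hq : ∀ τ : Face n q, x.chain .neg q τ ≠ 0 → f.toFun (atom τ) = f'.toFun (atom τ)) :
    f.toFun x = f'.toFun x := by
  refine (induction_of_le (N := q) (P := fun x => Cell.d .neg q x = x ∧
    ((∀ τ : Face n q, x.chain .neg q τ ≠ 0 → f.toFun (atom τ) = f'.toFun (atom τ)) →
      f.toFun x = f'.toFun x)) ?_ ?_ (fun r hr α => chain_of_d_eq_self hx hr α)).2 hq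
  · intro p τ hp
    refine ⟨d_atom_of_le τ hp _, fun h => ?_⟩
    rcases hp.eq_or_lt with rfl | hp
    · exact h τ (by simp [atom_chain_self])
    · exact hlt p hp τ
  · rintro r y z h ⟨hy, hy'⟩ ⟨hz, hz'⟩
    refine ⟨OmegaCat.d_neg_comp_eq_self (D := simplexOmega n) h hy hz, fun H => ?_⟩
    rcases comp_cases h hy hz with ⟨e, -⟩ | e
    · rw [e] at H ⊢
      exact hz' H
    · refine map_comp_congr h (hy' fun τ hτ => H τ ?_) (hz' fun τ hτ => H τ ?_) <;>
      · rw [e, Finsupp.add_apply]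
        have h₁ := y.nonneg .neg q τ
        have h₂ := z.nonneg .neg q τ
        rw [Finsupp.zero_apply] at h₁ h₂
        omega

/-- An equation with the single unknown `τ`. Since `τ` has coefficient 1, it lies in exactly one
factor of a nontrivial composite; the functors agree on the other factor by `eq_of_support`, and
that factor is invertible, so it cancels. -/
theorem eq_atom_of_eq [D.AllInvertible] {f f' : OmegaFunctor (simplexOmega n) D} {q : ℕ}
    (hlt : ∀ p < q, ∀ τ : Face n p, f.toFun (atom τ) = f'.toFun (atom τ)) {x : Cell n}
    (hx : Cell.d .neg q x = x) {τ : Face n q}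
    (hq : ∀ σ : Face n q, σ ≠ τ → x.chain .neg q σ ≠ 0 → f.toFun (atom σ) = f'.toFun (atom σ))
    (hτ : x.chain .neg q τ = 1) (e : f.toFun x = f'.toFun x) :
    f.toFun (atom τ) = f'.toFun (atom τ) := by
  refine (induction_of_le (N := q) (P := fun x => Cell.d .neg q x = x ∧
    ((∀ σ : Face n q, σ ≠ τ → x.chain .neg q σ ≠ 0 → f.toFun (atom σ) = f'.toFun (atom σ)) →
      x.chain .neg q τ = 1 → f.toFun x = f'.toFun x → f.toFun (atom τ) = f'.toFun (atom τ)))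
    ?_ ?_ (fun r hr α => chain_of_d_eq_self hx hr α)).2 hq hτ e
  · intro p σ hp
    refine ⟨d_atom_of_le σ hp _, fun _ h e => ?_⟩
    rcases hp.eq_or_lt with rfl | hp
    · rw [atom_chain_self, Finsupp.single_apply] at h
      split_ifs at h with h'
      · rwa [h'] at e
      · exact absurd h zero_ne_one
    · rw [atom_chain_of_lt σ hp] at h
      exact absurd h zero_ne_one
  · rintro r y z h ⟨hy, hy'⟩ ⟨hz, hz'⟩
    refine ⟨OmegaCat.d_neg_comp_eq_self (D := simplexOmega n) h hy hz, fun H hc E => ?_⟩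
    rcases comp_cases h hy hz with ⟨e, -⟩ | e
    · rw [e] at H hc E
      exact hz' H hc E
    · have hn : ∀ σ, 0 ≤ y.chain .neg q σ ∧ 0 ≤ z.chain .neg q σ :=
        fun σ => ⟨y.nonneg .neg q σ, z.nonneg .neg q σ⟩
      rw [e] at H hc
      simp only [Finsupp.add_apply] at H hc
      have E' : D.comp r (f.toFun y) (f.toFun z) (f.composable h) =
          D.comp r (f'.toFun y) (f'.toFun z) (f'.composable h) :=
        (f.map_comp r y z h _).symm.trans (E.trans (f'.map_comp r y z h _))
      have Hy : ∀ σ : Face n q, σ ≠ τ → y.chain .neg q σ ≠ 0 →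
          f.toFun (atom σ) = f'.toFun (atom σ) := fun σ h₁ h₂ => H σ h₁ (by have := hn σ; omega)
      have Hz : ∀ σ : Face n q, σ ≠ τ → z.chain .neg q σ ≠ 0 →
          f.toFun (atom σ) = f'.toFun (atom σ) := fun σ h₁ h₂ => H σ h₁ (by have := hn σ; omega)
      have hnτ := hn τ
      rcases (show y.chain .neg q τ = 0 ∧ z.chain .neg q τ = 1 ∨
        y.chain .neg q τ = 1 ∧ z.chain .neg q τ = 0 by omega) with ⟨h₁, h₂⟩ | ⟨h₁, h₂⟩
      · refine hz' Hz h₂ ?_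
        have ey : f.toFun y = f'.toFun y :=
          eq_of_support hlt hy fun σ hσ => Hy σ (by rintro rfl; exact hσ h₁) hσ
        obtain ⟨w, hw⟩ := OmegaCat.AllInvertible.exists_inverse (D := D) r (f.toFun y)
        have k : D.d .pos r (f.toFun y) = D.d .neg r (f'.toFun z) := ey ▸ f'.composable h
        exact hw.cancel (f.composable h) k (E'.trans (OmegaCat.comp_congr ey.symm rfl _ _))
      · refine hy' Hy h₁ ?_
        have ez : f.toFun z = f'.toFun z :=
          eq_of_support hlt hz fun σ hσ => Hz σ (by rintro rfl; exact hσ h₂) hσ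
        obtain ⟨w, hw⟩ := OmegaCat.AllInvertible.exists_inverse (D := D) r (f.toFun z)
        have k : D.d .pos r (f'.toFun y) = D.d .neg r (f.toFun z) := ez ▸ f'.composable h
        exact hw.cancel_right (f.composable h) k (E'.trans (OmegaCat.comp_congr rfl ez.symm _ _))

theorem exists_facet_eq {q : ℕ} {τ : Face n q} {k : Fin (n + 1)} (hk : k ∉ Set.range τ) :
    ∃ (ρ : Face n (q + 1)) (i : Fin (q + 2)), ρ i = k ∧ facet ρ i = τ := by
  classical
  let s : Finset (Fin (n + 1)) := insert k (Finset.univ.map τ.toEmbedding)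
  have hs : s.card = q + 2 := by
    rw [Finset.card_insert_of_notMem (by simpa using hk), Finset.card_map]
    simp
  let ρ : Face n (q + 1) := s.orderEmbOfFin hs
  have hρ : Set.range ρ = s := Finset.range_orderEmbOfFin s hs
  obtain ⟨i, hi⟩ : k ∈ Set.range ρ := by rw [hρ]; simp [s]
  refine ⟨ρ, i, hi, OrderEmbedding.range_inj.1 ?_⟩
  have : Set.range (facet ρ i) = Set.range ρ \ {k} := by
    ext v
    constructor
    · rintro ⟨j, rfl⟩
      refine ⟨⟨_, rfl⟩, fun h => Fin.succAbove_ne i j (ρ.injective ?_)⟩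
      exact (Set.mem_singleton_iff.1 h).trans hi.symm
    · rintro ⟨⟨j, rfl⟩, hj⟩
      obtain ⟨a, rfl⟩ := Fin.exists_succAbove_eq (x := j) (y := i) (by rintro rfl; exact hj hi)
      exact Set.mem_range_self (f := facet ρ i) a
  rw [this, hρ]
  ext v
  simp only [s, Finset.coe_insert, Finset.coe_map, Finset.coe_univ, Set.image_univ, Set.mem_sdiff,
    Set.mem_insert_iff, Set.mem_singleton_iff]
  constructor
  · rintro ⟨rfl | h, h'⟩
    exacts [absurd rfl h', h]
  · intro h
    exact ⟨Or.inr h, fun e => hk (e ▸ h)⟩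

theorem mem_range_facet {q : ℕ} {ρ : Face n (q + 1)} {i j : Fin (q + 2)} (h : j ≠ i) :
    ρ i ∈ Set.range (facet ρ j) := by
  obtain ⟨a, ha⟩ := Fin.exists_succAbove_eq h.symm
  exact ⟨a, congrArg ρ ha⟩

theorem d_chain_neg {α : Sgn} {q : ℕ} (x : Cell n) :
    (Cell.d α q x).chain .neg q = x.chain α q := by
  simp [Cell.d]

/-- Two omega-functors on a simplex with values in an omega-groupoid are equal if they agree at
a vertex `k` and, for each face that contains `k`, agreement on the boundary of the face implies
agreement on the face. -/
theorem functor_ext_of_vertex [D.AllInvertible] {f f' : OmegaFunctor (simplexOmega n) D}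
    (k : Fin (n + 1))
    (h₀ : ∀ τ : Face n 0, k ∈ Set.range τ → f.toFun (atom τ) = f'.toFun (atom τ))
    (h : ∀ (q : ℕ) (ρ : Face n (q + 1)) (α : Sgn), k ∈ Set.range ρ →
      D.d α q (f.toFun (atom ρ)) = D.d α q (f'.toFun (atom ρ)) →
      f.toFun (atom ρ) = f'.toFun (atom ρ)) : f = f' := by
  have key : ∀ q : ℕ, (∀ p < q, ∀ τ : Face n p, f.toFun (atom τ) = f'.toFun (atom τ)) ∧
      ∀ τ : Face n q, k ∈ Set.range τ → f.toFun (atom τ) = f'.toFun (atom τ) := by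
    intro q
    induction q with
    | zero => exact ⟨fun p hp => absurd hp (Nat.not_lt_zero p), h₀⟩
    | succ q ih =>
      obtain ⟨hlt, hq⟩ := ih
      have dd : ∀ (x : Cell n) (α : Sgn), Cell.d .neg q (Cell.d α q x) = Cell.d α q x :=
        fun x _ => (simplexOmega n).d_d_of_le _ _ x le_rfl
      have hρ : ∀ ρ : Face n (q + 1), k ∈ Set.range ρ → f.toFun (atom ρ) = f'.toFun (atom ρ) := by
        rintro ρ ⟨i, rfl⟩
        -- The side `α` does not contain the facet opposite to `k`, so all its facets contain `k`
        -- and the functors already agree on it.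
        obtain ⟨α, hα⟩ : ∃ α, facetSgn i ≠ α := by
          cases facetSgn i
          exacts [⟨.pos, by simp⟩, ⟨.neg, by simp⟩]
        refine h q ρ α ⟨i, rfl⟩ ?_
        refine (map_cell_d f α q _).symm.trans (Eq.trans ?_ (map_cell_d f' α q _))
        refine eq_of_support hlt (dd _ _) fun τ hτ => hq τ ?_
        rw [d_chain_neg] at hτ
        obtain ⟨j, rfl, hj⟩ := exists_facet_of_atom hτ
        exact mem_range_facet (by rintro rfl; exact hα hj)
      refine ⟨fun p hp τ => ?_, hρ⟩
      rcases (Nat.lt_succ_iff.1 hp).eq_or_lt with rfl | hp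
      · by_cases hk : k ∈ Set.range τ
        · exact hq τ hk
        -- A `p`-face `τ` that avoids `k` is a facet of the face `ρ` spanned by `τ` and `k`. On its
        -- side of `ρ` all other facets contain `k`, so `τ` is the only unknown.
        · obtain ⟨ρ, i, rfl, rfl⟩ := exists_facet_eq hk
          have e := (map_cell_d f (facetSgn i) p _).trans
            ((congrArg (D.d (facetSgn i) p) (hρ ρ ⟨i, rfl⟩)).trans (map_cell_d f' _ p _).symm)
          refine eq_atom_of_eq hlt (dd _ _) (fun σ hσ hσ' => hq σ ?_) ?_ e
          · rw [d_chain_neg] at hσ'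
            obtain ⟨j, rfl, -⟩ := exists_facet_of_atom hσ'
            exact mem_range_facet (by rintro rfl; exact hσ rfl)
          · rw [d_chain_neg, atom_facet]
      · exact hlt p hp τ
  exact functor_ext fun p τ => (key (p + 1)).1 p p.lt_succ_self τ

end Simplex

/-! ### Loops in an omega-groupoid -/

namespace OmegaCat

variable {D : OmegaCat.{u}}

/-- The `0`-dimensional elements. -/
def Ob (D : OmegaCat.{u}) : Type u := {p : D.carrier // D.d .neg 0 p = p}

theorem Ob.d_eq (p : D.Ob) (α : Sgn) (n : ℕ) : D.d α n p.1 = p.1 := by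
  rw [← p.2, D.d_d_of_le _ _ _ (Nat.zero_le n)]

/-- The elements whose `0`-source and `0`-target are `p`. -/
def Loop (p : D.Ob) : Type u := {x : D.carrier // D.d .neg 0 x = p.1 ∧ D.d .pos 0 x = p.1}

namespace Loop

variable {p : D.Ob}

theorem composable (x y : Loop p) : D.d .pos 0 x.1 = D.d .neg 0 y.1 := x.2.2.trans y.2.1.symm

instance : One (Loop p) := ⟨⟨p.1, p.d_eq _ _, p.d_eq _ _⟩⟩

instance : Mul (Loop p) := ⟨fun x y => ⟨D.comp 0 x.1 y.1 (composable x y),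
  (D.src_comp _ _ _ _).trans x.2.1, (D.tgt_comp _ _ _ _).trans y.2.2⟩⟩

theorem exists_inv [D.AllInvertible] (x : Loop p) : ∃ y : Loop p, D.IsInverse 0 x.1 y.1 := by
  obtain ⟨y, hy⟩ := AllInvertible.exists_inverse 0 x.1
  exact ⟨⟨y, hy.1.symm.trans x.2.2, hy.2.1.trans x.2.1⟩, hy⟩

noncomputable instance [D.AllInvertible] : Inv (Loop p) := ⟨fun x => x.exists_inv.choose⟩

noncomputable instance [D.AllInvertible] : Group (Loop p) :=
  Group.ofLeftAxioms
    (fun x y z => Subtype.ext (D.assoc 0 x.1 y.1 z.1 _ _ (composable _ _) (composable x (y * z))))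
    (fun x => Subtype.ext (id_comp' x.2.1.symm _))
    (fun x => Subtype.ext (by
      have h := x.exists_inv.choose_spec
      exact h.2.2.2.trans x.exists_inv.choose.2.1))

/-- The source and target operations on loops; the index is shifted by one. -/
def δ [D.AllInvertible] (α : Sgn) (m : ℕ) : Loop p →* Loop p where
  toFun x := ⟨D.d α (m + 1) x.1, (D.d_d_of_lt _ _ _ (Nat.succ_pos m)).trans x.2.1,
    (D.d_d_of_lt _ _ _ (Nat.succ_pos m)).trans x.2.2⟩
  map_one' := Subtype.ext (p.d_eq _ _)
  map_mul' _ _ := Subtype.ext (D.d_comp _ _ _ _ _ _ _ (Nat.succ_ne_zero m))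

variable [D.AllInvertible]

theorem δ_δ_of_lt (β α : Sgn) {m n : ℕ} (h : m < n) (x : Loop p) : δ β m (δ α n x) = δ β m x :=
  Subtype.ext (D.d_d_of_lt _ _ _ (Nat.succ_lt_succ h))

theorem δ_δ_of_le (β α : Sgn) {m n : ℕ} (h : n ≤ m) (x : Loop p) : δ β m (δ α n x) = δ α n x :=
  Subtype.ext (D.d_d_of_le _ _ _ (Nat.succ_le_succ h))

theorem composable_succ {m : ℕ} {x y : Loop p} (h : δ .pos m x = δ .neg m y) :
    D.d .pos (m + 1) x.1 = D.d .neg (m + 1) y.1 := congrArg Subtype.val h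

/-- The compositions are determined by the group structure. -/
theorem comp_succ {m : ℕ} {x y : Loop p} (h : δ .pos m x = δ .neg m y) :
    D.comp (m + 1) x.1 y.1 (composable_succ h) = (x * (δ .pos m x)⁻¹ * y).1 := by
  set t := δ .pos m x with ht
  -- The factor `a` has trivial target and `t` is an identity for the composition of index `m + 1`.
  -- Interchange applied to `(a * t) *_(m+1) (1 * y)` then gives `(a *_(m+1) 1) * (t *_(m+1) y) = a
  -- * y`.
  set a := x * t⁻¹ with ha
  have hx : a * t = x := by rw [ha, inv_mul_cancel_right]
  have hta : δ .pos m a = 1 := by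
    rw [ha, map_mul, map_inv, ← ht, ht, δ_δ_of_le _ _ le_rfl, mul_inv_cancel]
  have h₄ : D.d .pos (m + 1) a.1 = D.d .neg (m + 1) (1 : Loop p).1 :=
    composable_succ (by rw [hta, map_one])
  have h₅ : D.d .pos (m + 1) t.1 = D.d .neg (m + 1) y.1 :=
    composable_succ (by rw [ht, δ_δ_of_le _ _ le_rfl, ← ht, h])
  have h₃ : D.d .pos (m + 1) (a * t).1 = D.d .neg (m + 1) (1 * y).1 := by
    rw [hx, one_mul]; exact composable_succ h
  have e₁ : D.comp (m + 1) a.1 (1 : Loop p).1 h₄ = a.1 :=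
    comp_id' ((congrArg Subtype.val hta).symm) _
  have e₂ : D.comp (m + 1) t.1 y.1 h₅ = y.1 := id_comp' (congrArg Subtype.val h) _
  have h₆ : D.d .pos 0 (D.comp (m + 1) a.1 (1 : Loop p).1 h₄) =
      D.d .neg 0 (D.comp (m + 1) t.1 y.1 h₅) := by rw [e₁, e₂]; exact composable a y
  have key := D.interchange (m + 1) 0 a.1 t.1 (1 : Loop p).1 y.1 (composable _ _) (composable _ _)
    h₃ h₄ h₅ h₆ (Nat.succ_ne_zero m)
  refine Eq.trans (comp_congr ?_ ?_ _ _) (key.trans (comp_congr e₁ e₂ _ _))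
  · exact congrArg Subtype.val hx.symm
  · exact congrArg Subtype.val (one_mul y).symm

/-- Eckmann-Hilton: `(1 * y) *_(m+1) (x * 1)` is `y * x` by `comp_succ`, and `(1 *_(m+1) x) * (y
*_(m+1) 1) = x * y` by interchange. -/
theorem commute {m : ℕ} {x y : Loop p} (hx : δ .neg m x = 1) (hy : δ .pos m y = 1) :
    Commute x y := by
  have h₄ : D.d .pos (m + 1) (1 : Loop p).1 = D.d .neg (m + 1) x.1 :=
    composable_succ (by rw [hx, map_one])
  have h₅ : D.d .pos (m + 1) y.1 = D.d .neg (m + 1) (1 : Loop p).1 :=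
    composable_succ (by rw [hy, map_one])
  have h : δ .pos m y = δ .neg m x := hy.trans hx.symm
  have h₃ : D.d .pos (m + 1) (1 * y).1 = D.d .neg (m + 1) (x * 1).1 := by
    rw [one_mul, mul_one]; exact composable_succ h
  have e₁ : D.comp (m + 1) (1 : Loop p).1 x.1 h₄ = x.1 := id_comp' (congrArg Subtype.val hx.symm) _
  have e₂ : D.comp (m + 1) y.1 (1 : Loop p).1 h₅ = y.1 := comp_id' (congrArg Subtype.val hy.symm) _
  have h₆ : D.d .pos 0 (D.comp (m + 1) (1 : Loop p).1 x.1 h₄) =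
      D.d .neg 0 (D.comp (m + 1) y.1 (1 : Loop p).1 h₅) := by rw [e₁, e₂]; exact composable x y
  have key := D.interchange (m + 1) 0 (1 : Loop p).1 y.1 x.1 (1 : Loop p).1 (composable _ _)
    (composable _ _) h₃ h₄ h₅ h₆ (Nat.succ_ne_zero m)
  have e : D.comp (m + 1) y.1 x.1 (composable_succ h) = (y * x).1 := by
    rw [comp_succ h, hy, inv_one, mul_one]
  refine Subtype.ext ?_
  refine Eq.trans ?_ (Eq.trans (key.symm.trans (comp_congr ?_ ?_ _ (composable_succ h))) e)
  · exact (comp_congr e₁ e₂ _ _).symm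
  · exact congrArg Subtype.val (one_mul y)
  · exact congrArg Subtype.val (mul_one x)

end Loop

/-- The `1`-dimensional elements with `0`-source `p`. -/
def Arrow (p : D.Ob) : Type u := {g : D.carrier // D.d .neg 0 g = p.1 ∧ D.d .neg 1 g = g}

namespace Arrow

variable {p : D.Ob}

theorem d_succ (a : Arrow p) (α : Sgn) (m : ℕ) : D.d α (m + 1) a.1 = a.1 := by
  rw [← a.2.2, D.d_d_of_le _ _ _ (by omega)]

variable [D.AllInvertible]

/-- The inverse of an arrow. -/
noncomputable def inv (a : Arrow p) : D.carrier := (AllInvertible.exists_inverse 0 a.1).choose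

theorem isInverse_inv (a : Arrow p) : D.IsInverse 0 a.1 a.inv :=
  (AllInvertible.exists_inverse 0 a.1).choose_spec

theorem d_inv_succ (a : Arrow p) (α : Sgn) (m : ℕ) : D.d α (m + 1) a.inv = a.inv := by
  have h := a.isInverse_inv.d α m.succ_pos
  rw [d_succ] at h
  exact h.unique a.isInverse_inv

theorem pos_inv (a : Arrow p) : D.d .pos 0 a.inv = p.1 := a.isInverse_inv.2.1.trans a.2.1

theorem neg_inv (a : Arrow p) : D.d .neg 0 a.inv = D.d .pos 0 a.1 := a.isInverse_inv.1.symm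

theorem conj_composable₁ (a : Arrow p) (z : Loop p) : D.d .pos 0 a.inv = D.d .neg 0 z.1 :=
  a.pos_inv.trans z.2.1.symm

theorem conj_composable₂ (a : Arrow p) (z : Loop p) (b : Arrow p) :
    D.d .pos 0 (D.comp 0 a.inv z.1 (conj_composable₁ a z)) = D.d .neg 0 b.1 :=
  (D.tgt_comp _ _ _ _).trans (z.2.2.trans b.2.1.symm)

/-- The composite of the inverse of `a`, of the loop `z` and of `b`. -/
noncomputable def conj (a : Arrow p) (z : Loop p) (b : Arrow p) : D.carrier :=
  D.comp 0 (D.comp 0 a.inv z.1 (conj_composable₁ a z)) b.1 (conj_composable₂ a z b)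

theorem neg_conj (a : Arrow p) (z : Loop p) (b : Arrow p) :
    D.d .neg 0 (conj a z b) = D.d .pos 0 a.1 :=
  (D.src_comp _ _ _ _).trans ((D.src_comp _ _ _ _).trans a.neg_inv)

theorem pos_conj (a : Arrow p) (z : Loop p) (b : Arrow p) :
    D.d .pos 0 (conj a z b) = D.d .pos 0 b.1 := D.tgt_comp _ _ _ _

theorem d_conj (a : Arrow p) (z : Loop p) (b : Arrow p) (α : Sgn) (m : ℕ) :
    D.d α (m + 1) (conj a z b) = conj a (Loop.δ α m z) b := by
  rw [conj, D.d_comp _ _ _ _ _ _ (D.d_comp_composable _ (conj_composable₂ a z b)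
    (Nat.succ_ne_zero m)) (Nat.succ_ne_zero m)]
  refine comp_congr ?_ (b.d_succ _ _) _ _
  rw [D.d_comp _ _ _ _ _ _ (D.d_comp_composable _ (conj_composable₁ a z)
    (Nat.succ_ne_zero m)) (Nat.succ_ne_zero m)]
  exact comp_congr (a.d_inv_succ _ _) rfl _ _

theorem conj_one (a : Arrow p) : conj a 1 a = D.d .pos 0 a.1 := by
  have e : D.comp 0 a.inv (1 : Loop p).1 (conj_composable₁ a 1) = a.inv := comp_id' a.pos_inv.symm _
  exact (comp_congr e rfl _ a.isInverse_inv.2.1).trans (a.isInverse_inv.2.2.2.trans a.neg_inv)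

theorem conj_injective {a b : Arrow p} {z z' : Loop p} (h : conj a z b = conj a z' b) : z = z' := by
  obtain ⟨b', hb⟩ := AllInvertible.exists_inverse 0 b.1
  exact Subtype.ext (a.isInverse_inv.symm.cancel _ _ (hb.cancel_right _ _ h))

theorem exists_conj {a b : Arrow p} {w : D.carrier} (h₁ : D.d .neg 0 w = D.d .pos 0 a.1)
    (h₂ : D.d .pos 0 w = D.d .pos 0 b.1) : ∃ z : Loop p, conj a z b = w := by
  have k₂ : D.d .pos 0 w = D.d .neg 0 b.inv := h₂.trans b.neg_inv.symm
  have k₁ : D.d .pos 0 a.1 = D.d .neg 0 (D.comp 0 w b.inv k₂) :=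
    h₁.symm.trans (D.src_comp _ _ _ _).symm
  refine ⟨⟨D.comp 0 a.1 (D.comp 0 w b.inv k₂) k₁, (D.src_comp _ _ _ _).trans a.2.1,
    (D.tgt_comp _ _ _ _).trans ((D.tgt_comp _ _ _ _).trans b.pos_inv)⟩, ?_⟩
  have ha := a.isInverse_inv
  have hb := b.isInverse_inv
  have e₁ : D.comp 0 a.inv (D.comp 0 a.1 (D.comp 0 w b.inv k₂) k₁)
      (ha.2.1.trans (D.src_comp _ _ _ _).symm) = D.comp 0 w b.inv k₂ := by
    rw [← D.assoc 0 a.inv a.1 _ ha.2.1 ((D.tgt_comp _ _ _ _).trans k₁)]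
    exact id_comp' (by rw [ha.2.2.2, D.src_comp, h₁, neg_inv]) _
  have e₂ : D.comp 0 (D.comp 0 w b.inv k₂) b.1 ((D.tgt_comp _ _ _ _).trans hb.2.1) = w := by
    rw [D.assoc 0 w b.inv b.1 k₂ _ hb.2.1 (k₂.trans (D.src_comp _ _ _ _).symm)]
    exact comp_id' (by rw [hb.2.2.2, k₂]) _
  exact (comp_congr e₁ rfl _ _).trans e₂

/-- The inner factors `b` and `b⁻¹` cancel. -/
theorem conj_comp_zero (a b c : Arrow p) (z z' : Loop p)
    (h : D.d .pos 0 (conj a z b) = D.d .neg 0 (conj b z' c)) :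
    D.comp 0 (conj a z b) (conj b z' c) h = conj a (z * z') c := by
  have hb := b.isInverse_inv
  have k₁ : D.d .pos 0 (conj a z b) = D.d .neg 0 (D.comp 0 b.inv z'.1 (conj_composable₁ b z')) :=
    h.trans (D.src_comp _ _ _ _)
  have hz : D.d .pos 0 (D.comp 0 a.inv z.1 (conj_composable₁ a z)) = D.d .neg 0 z'.1 :=
    (D.tgt_comp _ _ _ _).trans (z.composable z')
  have k₂ : D.d .pos 0 (conj a z b) = D.d .neg 0 b.inv := k₁.trans (D.src_comp _ _ _ _)
  have e₁ : D.comp 0 (conj a z b) b.inv k₂ = D.comp 0 a.inv z.1 (conj_composable₁ a z) := by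
    refine (D.assoc 0 _ b.1 b.inv (conj_composable₂ a z b) k₂ hb.1
      ((conj_composable₂ a z b).trans (D.src_comp _ _ _ _).symm)).trans ?_
    exact comp_id' (by rw [hb.2.2.1, ← conj_composable₂ a z b]) _
  have e₂ : D.comp 0 (conj a z b) (D.comp 0 b.inv z'.1 (conj_composable₁ b z')) k₁ =
      D.comp 0 a.inv (z * z').1 (conj_composable₁ a (z * z')) := by
    rw [← D.assoc 0 _ b.inv z'.1 k₂ ((D.tgt_comp _ _ _ _).trans (conj_composable₁ b z'))]
    refine (comp_congr e₁ rfl _ hz).trans ?_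
    exact D.assoc 0 _ _ _ _ _ (z.composable z') _
  have k₃ : D.d .pos 0 (D.comp 0 (conj a z b) (D.comp 0 b.inv z'.1 (conj_composable₁ b z')) k₁) =
      D.d .neg 0 c.1 := (D.tgt_comp _ _ _ _).trans (conj_composable₂ b z' c)
  exact (D.assoc 0 (conj a z b) _ c.1 k₁ k₃ (conj_composable₂ b z' c) h).symm.trans
    (comp_congr e₂ rfl _ _)

/-- The arrows are identities for the composition of index `m + 1`. Two applications of interchange
therefore reduce it to the composition of the loops, which is given by `Loop.comp_succ`. -/
theorem conj_comp_succ (a b : Arrow p) {z z' : Loop p} {m : ℕ}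
    (hz : Loop.δ .pos m z = Loop.δ .neg m z')
    (h : D.d .pos (m + 1) (conj a z b) = D.d .neg (m + 1) (conj a z' b)) :
    D.comp (m + 1) (conj a z b) (conj a z' b) h = conj a (z * (Loop.δ .pos m z)⁻¹ * z') b := by
  have hz' := Loop.composable_succ hz
  have ha : D.d .pos (m + 1) a.inv = D.d .neg (m + 1) a.inv := by rw [d_inv_succ, d_inv_succ]
  have hb : D.d .pos (m + 1) b.1 = D.d .neg (m + 1) b.1 := by rw [d_succ, d_succ]
  have ea : D.comp (m + 1) a.inv a.inv ha = a.inv := id_comp' (a.d_inv_succ _ _).symm _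
  have eb : D.comp (m + 1) b.1 b.1 hb = b.1 := id_comp' (b.d_succ _ _).symm _
  have hm := Nat.succ_ne_zero m
  have h₁ : D.d .pos (m + 1) (D.comp 0 a.inv z.1 (conj_composable₁ a z)) =
      D.d .neg (m + 1) (D.comp 0 a.inv z'.1 (conj_composable₁ a z')) := by
    rw [D.d_comp _ _ _ _ _ _ (D.d_comp_composable _ (conj_composable₁ a z) hm) hm,
      D.d_comp _ _ _ _ _ _ (D.d_comp_composable _ (conj_composable₁ a z') hm) hm]
    exact comp_congr ha hz' _ _
  have e₁ : D.comp (m + 1) (D.comp 0 a.inv z.1 (conj_composable₁ a z))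
      (D.comp 0 a.inv z'.1 (conj_composable₁ a z')) h₁ =
      D.comp 0 a.inv (z * (Loop.δ .pos m z)⁻¹ * z').1 (conj_composable₁ a _) := by
    have e := Loop.comp_succ hz
    rw [D.interchange (m + 1) 0 _ _ _ _ _ _ h₁ ha hz' (by
      rw [ea, e]; exact conj_composable₁ a _) hm]
    exact comp_congr ea e _ _
  have h₆ : D.d .pos 0 (D.comp (m + 1) (D.comp 0 a.inv z.1 (conj_composable₁ a z))
      (D.comp 0 a.inv z'.1 (conj_composable₁ a z')) h₁) =
      D.d .neg 0 (D.comp (m + 1) b.1 b.1 hb) := by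
    rw [e₁, eb]; exact conj_composable₂ a _ b
  refine (D.interchange (m + 1) 0 _ _ _ _ (conj_composable₂ a z b) (conj_composable₂ a z' b) h h₁
    hb h₆ hm).trans ?_
  exact comp_congr e₁ eb _ _

end Arrow

end OmegaCat

/-! ### The omega-functor on a simplex determined by arbitrary loops -/

namespace OmegaCat

namespace Loop

variable {D : OmegaCat.{u}} [D.AllInvertible]

/-- The loops whose `1`-source and `1`-target are the constant loop. -/
noncomputable def core (p : D.Ob) : Subgroup (Loop p) := (δ .neg 0).ker ⊓ (δ .pos 0).ker

variable {p : D.Ob}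

theorem δ_zero_of_mem_core {x : Loop p} (hx : x ∈ core p) (α : Sgn) : δ α 0 x = 1 := by
  cases α
  exacts [hx.1, hx.2]

noncomputable instance : CommGroup (core p) where
  mul_comm x y := Subtype.ext (commute x.2.1 y.2.2)

theorem δ_mem_core {x : Loop p} (hx : x ∈ core p) (α : Sgn) (m : ℕ) : δ α m x ∈ core p := by
  have : ∀ β, δ β 0 (δ α m x) = 1 := fun β => by
    rcases Nat.eq_zero_or_pos m with rfl | hm
    · rw [δ_δ_of_le _ _ le_rfl, δ_zero_of_mem_core hx]
    · rw [δ_δ_of_lt _ _ hm, δ_zero_of_mem_core hx]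
  exact ⟨this _, this _⟩

/-- Both commutations are Eckmann-Hilton, used on opposite sides. The edge part `Gauge.low` has this
shape `x * y`, so the parts of higher dimension commute with it. -/
theorem commute_of_mem_core {a x y : Loop p} (ha : a ∈ core p) (hx : δ .neg 0 x = 1)
    (hy : δ .pos 0 y = 1) : Commute a (x * y) :=
  (commute hx ha.2).symm.mul_right (commute ha.1 hy)

/-- The additive group of the loops whose `1`-source and `1`-target are constant. -/
abbrev Core (p : D.Ob) : Type u := Additive (core p)

/-- The loop of an element of the additive group. -/
def ofCore (u : Core p) : Loop p := u.toMul.1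

theorem ofCore_injective : Function.Injective (ofCore : Core p → Loop p) := fun _ _ h =>
  Additive.toMul.injective (Subtype.ext h)

theorem ofCore_add (u v : Core p) : ofCore (u + v) = ofCore u * ofCore v := rfl

theorem ofCore_sub (u v : Core p) : ofCore (u - v) = ofCore u * (ofCore v)⁻¹ := by
  rw [sub_eq_add_neg, ofCore_add]
  rfl

theorem ofCore_zero : ofCore (0 : Core p) = 1 := rfl

theorem ofCore_mem (u : Core p) : ofCore u ∈ core p := u.toMul.2

/-- The source and target operations on the additive group. -/
noncomputable def coreδ (α : Sgn) (m : ℕ) : Core p →+ Core p where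
  toFun u := .ofMul ⟨δ α m (ofCore u), δ_mem_core (ofCore_mem u) α m⟩
  map_zero' := ofCore_injective (map_one (δ α m))
  map_add' u v := ofCore_injective (map_mul (δ α m) (ofCore u) (ofCore v))

theorem ofCore_coreδ (α : Sgn) (m : ℕ) (u : Core p) :
    ofCore (coreδ α m u) = δ α m (ofCore u) := rfl

end Loop

end OmegaCat

open OmegaCat Simplex

/-- Loops attached to the faces of a simplex; the loop attached to a face of dimension `j + 1`
has dimension `j + 2`, and its source is constant. -/
structure Gauge {D : OmegaCat.{u}} [D.AllInvertible] (n : ℕ) (p : D.Ob) where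
  val : ∀ j : ℕ, Face n (j + 1) → Loop p
  src : ∀ (j : ℕ) (σ : Face n (j + 1)), Loop.δ .neg j (val j σ) = 1
  dim : ∀ (j : ℕ) (σ : Face n (j + 1)), Loop.δ .neg (j + 1) (val j σ) = val j σ

namespace Gauge

open Loop

variable {D : OmegaCat.{u}} [D.AllInvertible] {n : ℕ} {p : D.Ob} (h : Gauge n p)

theorem δ_of_lt {j m : ℕ} (hm : m < j) (σ : Face n (j + 1)) (α : Sgn) :
    δ α m (h.val j σ) = 1 := by
  rw [← δ_δ_of_lt α .neg hm, h.src, map_one]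

theorem δ_of_gt {j m : ℕ} (hm : j < m) (σ : Face n (j + 1)) (α : Sgn) :
    δ α m (h.val j σ) = h.val j σ := by
  rw [← h.dim, δ_δ_of_le _ _ hm]

/-- The loop of a face of dimension at least `2` in the additive group. -/
def coreVal (j : ℕ) (σ : Face n (j + 2)) : Core p :=
  .ofMul ⟨h.val (j + 1) σ, h.δ_of_lt j.succ_pos σ _, h.δ_of_lt j.succ_pos σ _⟩

/-- The sum of the loops of the faces of a chain. -/
noncomputable def chainVal (j : ℕ) : Chain n (j + 2) →ₗ[ℤ] Core p :=
  Finsupp.linearCombination ℤ (h.coreVal j)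

theorem chainVal_single (j : ℕ) (σ : Face n (j + 2)) (k : ℤ) :
    h.chainVal j (Finsupp.single σ k) = k • h.coreVal j σ :=
  Finsupp.linearCombination_single _ _ _

theorem coreδ_chainVal {j m : ℕ} {α : Sgn} {f : Core p →+ Core p}
    (hf : ∀ σ, coreδ α m (h.coreVal j σ) = f (h.coreVal j σ)) (c : Chain n (j + 2)) :
    coreδ α m (h.chainVal j c) = f (h.chainVal j c) := by
  induction c using Finsupp.induction_linear with
  | zero => simp
  | add c c' h₁ h₂ => rw [map_add, map_add, map_add, h₁, h₂]
  | single σ k => rw [chainVal_single, map_zsmul, map_zsmul, hf]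

theorem coreδ_chainVal_of_gt {j m : ℕ} (hm : j + 1 < m) (α : Sgn) (c : Chain n (j + 2)) :
    coreδ α m (h.chainVal j c) = h.chainVal j c :=
  h.coreδ_chainVal (f := AddMonoidHom.id _)
    (fun σ => ofCore_injective (h.δ_of_gt hm σ α)) c

theorem coreδ_chainVal_of_lt {j m : ℕ} (hm : m < j + 1) (α : Sgn) (c : Chain n (j + 2)) :
    coreδ α m (h.chainVal j c) = 0 :=
  h.coreδ_chainVal (f := 0) (fun σ => ofCore_injective (h.δ_of_lt hm σ α)) c

theorem coreδ_chainVal_neg (j : ℕ) (c : Chain n (j + 2)) :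
    coreδ .neg (j + 1) (h.chainVal j c) = 0 :=
  h.coreδ_chainVal (f := 0) (fun σ => ofCore_injective (h.src (j + 1) σ)) c

/-- The component of dimension `j + 3` of the value at a cell, together with the target part of
the component of dimension `j + 2`. -/
noncomputable def term (j : ℕ) (x : Cell n) : Core p :=
  h.chainVal j (x.chain .pos (j + 2)) - h.chainVal j (x.chain .neg (j + 2)) +
    coreδ .pos (j + 1) (h.chainVal j (x.chain .neg (j + 2)))

/-- For `m < j + 1` both sides vanish, the loops being trivial in low dimensions and the cell having
no `(j + 2)`-chain left. For `m = j + 1` the source and target chains of the truncated cell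
coincide, so only the `δ⁺` part survives. For `m > j + 1` nothing changes. -/
theorem coreδ_term (α : Sgn) (m j : ℕ) (x : Cell n) :
    coreδ α m (h.term j x) = h.term j (Cell.d α (m + 1) x) := by
  have dd : ∀ u : Core p, coreδ α m (coreδ .pos (j + 1) u) =
      if m < j + 1 then coreδ α m u else coreδ .pos (j + 1) u := fun u => by
    split_ifs with hm
    · exact ofCore_injective (δ_δ_of_lt _ _ hm _)
    · exact ofCore_injective (δ_δ_of_le _ _ (not_lt.1 hm) _)
  rcases lt_trichotomy m (j + 1) with hm | rfl | hm
  · have h₁ : ¬ j + 2 < m + 1 := by omega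
    have h₂ : j + 2 ≠ m + 1 := by omega
    rw [term, map_add, map_sub, dd, if_pos hm, h.coreδ_chainVal_of_lt hm,
      h.coreδ_chainVal_of_lt hm]
    simp only [term, Cell.d, h₁, h₂, if_false, map_zero, sub_zero, add_zero]
  · rw [term, map_add, map_sub, dd, if_neg (lt_irrefl _)]
    have e : ∀ γ, (Cell.d α (j + 1 + 1) x).chain γ (j + 2) = x.chain α (j + 2) := fun γ => by
      simp [Cell.d]
    rw [term, e, e]
    cases α
    · rw [coreδ_chainVal_neg, coreδ_chainVal_neg, sub_zero, zero_add, sub_self, zero_add]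
    · rw [sub_self, zero_add, sub_add_cancel]
  · have h₁ : j + 2 < m + 1 := by omega
    rw [term, map_add, map_sub, dd, if_neg (by omega), h.coreδ_chainVal_of_gt hm,
      h.coreδ_chainVal_of_gt hm]
    simp only [term, Cell.d, h₁, if_true]

/-- This is the additive form of `x * (δ⁺ x)⁻¹ * y`, the shape that a composition has in the group
of loops. -/
theorem term_comp (j r : ℕ) (x y : Cell n) (hxy : Cell.d .pos r x = Cell.d .neg r y) :
    h.term j (Cell.comp r x y hxy) = h.term j x - h.term j (Cell.d .pos r x) + h.term j y := by
  rcases lt_trichotomy (j + 2) r with hr | rfl | hr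
  · have e := fun β => Cell.chain_eq_of_d_eq hxy β hr
    simp only [term, Cell.d, Cell.comp, hr, if_true, e]
    abel
  · have e := Cell.chain_pos_eq_of_d_eq hxy
    simp only [term, Cell.d, Cell.comp, lt_irrefl, if_true, if_false, e]
    abel
  · have h₁ : ¬ j + 2 < r := by omega
    have h₂ : j + 2 ≠ r := by omega
    simp only [term, Cell.d, Cell.comp, h₁, h₂, if_false, map_zero, map_add]
    abel

/-- The part of the value at a cell which comes from the faces of dimension at least `2`. -/
noncomputable def high (x : Cell n) : Core p := ∑ j ∈ Finset.range n, h.term j x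

theorem coreδ_high (α : Sgn) (m : ℕ) (x : Cell n) :
    coreδ α m (h.high x) = h.high (Cell.d α (m + 1) x) := by
  rw [high, map_sum]
  exact Finset.sum_congr rfl fun j _ => h.coreδ_term α m j x

theorem high_comp (r : ℕ) (x y : Cell n) (hxy : Cell.d .pos r x = Cell.d .neg r y) :
    h.high (Cell.comp r x y hxy) = h.high x - h.high (Cell.d .pos r x) + h.high y := by
  simp only [high, ← Finset.sum_sub_distrib, ← Finset.sum_add_distrib]
  exact Finset.sum_congr rfl fun j _ => h.term_comp j r x y hxy

theorem high_d_zero (α : Sgn) (x : Cell n) : h.high (Cell.d α 0 x) = 0 := by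
  refine Finset.sum_eq_zero fun j _ => ?_
  simp [term, Cell.d]

/-! #### Ordered products along paths -/

/-- The ordered product of the loops of the edges of a `1`-chain whose last vertex is less
than `i`. -/
noncomputable def pathProd (c : Chain n 1) : ℕ → Loop p
  | 0 => 1
  | i + 1 => ((Finset.univ.filter fun e : Face n 1 => (e 1 : ℕ) = i).toList.map fun e =>
      h.val 0 e ^ c e).prod * pathProd c i

theorem pathProd_mem {S : Subgroup (Loop p)} {c : Chain n 1} (hS : ∀ e, h.val 0 e ^ c e ∈ S)
    (i : ℕ) : h.pathProd c i ∈ S := by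
  induction i with
  | zero => exact S.one_mem
  | succ i ih =>
    refine S.mul_mem (S.list_prod_mem fun x hx => ?_) ih
    obtain ⟨e, -, rfl⟩ := List.mem_map.1 hx
    exact hS e

theorem pathProd_eq_one {c : Chain n 1} (hc : ∀ e, h.val 0 e ^ c e = 1) (i : ℕ) :
    h.pathProd c i = 1 :=
  Subgroup.mem_bot.1 (h.pathProd_mem (fun e => Subgroup.mem_bot.2 (hc e)) i)

theorem pathProd_congr {c c' : Chain n 1} {i : ℕ} (hc : ∀ e : Face n 1, (e 1 : ℕ) < i → c e = c' e) :
    h.pathProd c i = h.pathProd c' i := by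
  induction i with
  | zero => rfl
  | succ i ih =>
    rw [pathProd, pathProd, ih fun e he => hc e (by omega)]
    congr 2
    refine List.map_congr_left fun e he => ?_
    rw [hc e (by simp at he; omega)]

/-- The product takes the edges by decreasing last vertex, so chains separated by the vertex `w`
contribute consecutive blocks. -/
theorem pathProd_add {c c' : Chain n 1} {w : ℕ} (hc : ∀ e, c e ≠ 0 → w < (e 1 : ℕ))
    (hc' : ∀ e, c' e ≠ 0 → (e 1 : ℕ) ≤ w) (i : ℕ) :
    h.pathProd (c + c') i = h.pathProd c i * h.pathProd c' i := by
  have hc₀ : ∀ e : Face n 1, (e 1 : ℕ) ≤ w → c e = 0 := fun e he => by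
    by_contra hne; exact absurd (hc e hne) (by omega)
  have hc'₀ : ∀ e : Face n 1, w < (e 1 : ℕ) → c' e = 0 := fun e he => by
    by_contra hne; exact absurd (hc' e hne) (by omega)
  induction i with
  | zero => simp [pathProd]
  | succ i ih =>
    rcases Nat.lt_or_ge w i with hi | hi
    · rw [pathProd, pathProd, pathProd, ih, mul_assoc]
      have e₁ : ((Finset.univ.filter fun e : Face n 1 => (e 1 : ℕ) = i).toList.map fun e =>
          h.val 0 e ^ c' e).prod = 1 := List.prod_eq_one fun x hx => by
        obtain ⟨e, he, rfl⟩ := List.mem_map.1 hx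
        rw [hc'₀ e (by simp at he; omega), zpow_zero]
      rw [e₁, one_mul]
      congr 2
      refine List.map_congr_left fun e he => ?_
      rw [Finsupp.add_apply, hc'₀ e (by simp at he; omega), add_zero]
    · have e₁ : h.pathProd c (i + 1) = 1 := by
        rw [h.pathProd_congr (c' := 0) fun e he => hc₀ e (by omega)]
        exact h.pathProd_eq_one (by simp) _
      rw [e₁, one_mul]
      exact h.pathProd_congr fun e he => by rw [Finsupp.add_apply, hc₀ e (by omega), zero_add]

theorem pathProd_eq_zpow {c : Chain n 1} {σ : Face n 1}
    (hc : ∀ e, e ≠ σ → h.val 0 e ^ c e = 1) {i : ℕ} (hi : (σ 1 : ℕ) < i) :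
    h.pathProd c i = h.val 0 σ ^ c σ := by
  have key : ∀ i, h.pathProd c i = if (σ 1 : ℕ) < i then h.val 0 σ ^ c σ else 1 := fun i => by
    induction i with
    | zero => rfl
    | succ i ih =>
      rw [pathProd, ih]
      have hn := Finset.nodup_toList (Finset.univ.filter fun e : Face n 1 => (e 1 : ℕ) = i)
      by_cases hσ : (σ 1 : ℕ) = i
      · classical
        rw [if_neg (by omega), if_pos (by omega), mul_one,
          List.prod_map_eq_pow_single σ _ fun e he _ => hc e he,
          List.count_eq_one_of_mem hn (by simpa using hσ), pow_one]
      · have e₁ : ((Finset.univ.filter fun e : Face n 1 => (e 1 : ℕ) = i).toList.map fun e =>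
            h.val 0 e ^ c e).prod = 1 := List.prod_eq_one fun x hx => by
          obtain ⟨e, he, rfl⟩ := List.mem_map.1 hx
          exact hc e (by rintro rfl; exact hσ (by simpa using he))
        rw [e₁, one_mul]
        congr 1
        exact propext ⟨fun h => by omega, fun h => by omega⟩
  rw [key, if_pos hi]

end Gauge

/-! ### The edge part and the loop attached to a cell; compositions of positive index -/

namespace Gauge

open Loop

variable {D : OmegaCat.{u}} [D.AllInvertible] {n : ℕ} {p : D.Ob} (h : Gauge n p)

/-- The ordered product of the loops of the edges of a `1`-chain. -/
noncomputable def path (c : Chain n 1) : Loop p := h.pathProd c (n + 1)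

theorem δ_neg_path (c : Chain n 1) : δ .neg 0 (h.path c) = 1 :=
  h.pathProd_mem (S := (δ .neg 0).ker) (fun e => Subgroup.zpow_mem _ (h.src 0 e) _) _

theorem δ_succ_path (α : Sgn) (m : ℕ) (c : Chain n 1) : δ α (m + 1) (h.path c) = h.path c :=
  h.pathProd_mem (S := (δ α (m + 1)).eqLocus (MonoidHom.id _))
    (fun e => Subgroup.zpow_mem _ (h.δ_of_gt m.succ_pos e α) _) _

theorem path_zero : h.path 0 = 1 := h.pathProd_eq_one (by simp) _

/-- The part of the value at a cell which comes from the edges. -/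
noncomputable def low (x : Cell n) : Loop p :=
  h.path (x.chain .pos 1) * ((h.path (x.chain .neg 1))⁻¹ * δ .pos 0 (h.path (x.chain .neg 1)))

/-- For `m = 0` the two `1`-chains of the truncated cell coincide, so two of the three factors
cancel. For larger `m` the loops of the edges have dimension at most 2 and are fixed. -/
theorem δ_low (α : Sgn) (m : ℕ) (x : Cell n) : δ α m (h.low x) = h.low (Cell.d α (m + 1) x) := by
  cases m with
  | zero =>
    have e : ∀ γ, (Cell.d α (0 + 1) x).chain γ 1 = x.chain α 1 := fun γ => by simp [Cell.d]
    simp only [low, e, map_mul, map_inv, mul_inv_cancel_left, δ_δ_of_le _ _ le_rfl]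
    cases α
    · simp only [δ_neg_path, inv_one, one_mul]
    · simp only [inv_mul_cancel, mul_one]
  | succ m =>
    have e : ∀ γ, (Cell.d α (m + 1 + 1) x).chain γ 1 = x.chain γ 1 := fun γ => by simp [Cell.d]
    simp only [low, e, map_mul, map_inv, δ_succ_path, δ_δ_of_le _ _ (Nat.zero_le _)]

theorem δ_pos_low_factor (x : Cell n) :
    δ .pos 0 ((h.path (x.chain .neg 1))⁻¹ * δ .pos 0 (h.path (x.chain .neg 1))) = 1 := by
  rw [map_mul, map_inv, δ_δ_of_le _ _ le_rfl, inv_mul_cancel]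

theorem commute_low (u : Core p) (x : Cell n) : Commute (ofCore u) (h.low x) :=
  commute_of_mem_core (ofCore_mem u) (h.δ_neg_path _) (h.δ_pos_low_factor x)

theorem low_comp_succ (m : ℕ) (x y : Cell n) (hxy : Cell.d .pos (m + 1) x = Cell.d .neg (m + 1) y) :
    h.low (Cell.comp (m + 1) x y hxy) =
      h.low x * (h.low (Cell.d .pos (m + 1) x))⁻¹ * h.low y := by
  cases m with
  | zero =>
    have e := Cell.chain_pos_eq_of_d_eq hxy
    have e₁ : (Cell.comp (0 + 1) x y hxy).chain .neg 1 = x.chain .neg 1 := by simp [Cell.comp]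
    have e₂ : (Cell.comp (0 + 1) x y hxy).chain .pos 1 = y.chain .pos 1 := by simp [Cell.comp]
    rw [← δ_low]
    simp only [low, e₁, e₂, map_mul, map_inv, δ_δ_of_le _ _ le_rfl, e, inv_mul_cancel, mul_one]
    set a := h.path (y.chain .pos 1) with ha
    set b := h.path (y.chain .neg 1) with hb
    set c := h.path (x.chain .neg 1) with hc
    -- The first element has trivial source because path products do; in the second the conjugate of
    -- a loop with trivial target is taken up to the factor `(δ⁺ b)⁻¹`, chosen so that the whole
    -- target is trivial.
    have hcomm := (commute (m := 0) (x := a * b⁻¹) (y := b * (c⁻¹ * δ .pos 0 c) * (δ .pos 0 b)⁻¹)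
      (by rw [map_mul, map_inv, ha, hb, δ_neg_path, δ_neg_path, inv_one, mul_one])
      (by simp only [map_mul, map_inv, δ_δ_of_le _ _ le_rfl, inv_mul_cancel, mul_one,
        mul_inv_cancel])).eq
    calc a * (c⁻¹ * δ .pos 0 c)
        = a * b⁻¹ * (b * (c⁻¹ * δ .pos 0 c) * (δ .pos 0 b)⁻¹) * δ .pos 0 b := by group
      _ = _ := by rw [hcomm]; group
  | succ m =>
    have e₁ : ∀ γ, (Cell.comp (m + 1 + 1) x y hxy).chain γ 1 = x.chain γ 1 := fun γ => by
      simp [Cell.comp]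
    have e₂ : ∀ γ, (Cell.d .pos (m + 1 + 1) x).chain γ 1 = x.chain γ 1 := fun γ => by simp [Cell.d]
    have e₃ : ∀ γ, y.chain γ 1 = x.chain γ 1 := fun γ =>
      (Cell.chain_eq_of_d_eq hxy γ (by omega)).symm
    simp only [low, e₁, e₂, e₃, mul_inv_cancel, one_mul]

/-- The loop attached to a cell. -/
noncomputable def loop (x : Cell n) : Loop p := ofCore (h.high x) * h.low x

theorem δ_loop (α : Sgn) (m : ℕ) (x : Cell n) :
    δ α m (h.loop x) = h.loop (Cell.d α (m + 1) x) := by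
  rw [loop, map_mul, ← ofCore_coreδ, coreδ_high, δ_low, loop]

theorem loop_d_zero (α : Sgn) (x : Cell n) : h.loop (Cell.d α 0 x) = 1 := by
  have e : ∀ γ, (Cell.d α 0 x).chain γ 1 = 0 := fun γ => by simp [Cell.d]
  simp [loop, high_d_zero, low, e, path_zero, ofCore_zero]

/-- The edge part and the part of higher dimension satisfy the formula separately, and elements of
the core move freely past the edge parts. -/
theorem loop_comp_succ (m : ℕ) (x y : Cell n)
    (hxy : Cell.d .pos (m + 1) x = Cell.d .neg (m + 1) y) :
    h.loop (Cell.comp (m + 1) x y hxy) =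
      h.loop x * (δ .pos m (h.loop x))⁻¹ * h.loop y := by
  rw [δ_loop]
  simp only [loop, high_comp, low_comp_succ, ofCore_add, ofCore_sub]
  have h₁ := fun u => h.commute_low u x
  have h₂ := fun u => h.commute_low u (Cell.d .pos (m + 1) x)
  set A := h.high x
  set B := h.high (Cell.d .pos (m + 1) x)
  set C := h.high y
  set a := h.low x
  set b := h.low (Cell.d .pos (m + 1) x)
  set c := h.low y
  rw [mul_inv_rev, (h₂ B).inv_inv.eq.symm]
  simp only [mul_assoc]
  rw [← (h₁ B).inv_left.left_comm, ← (h₂ C).inv_right.left_comm, ← (h₁ C).left_comm]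

end Gauge

/-! ### The vertices at the ends of a cell, and the position of its edges -/

namespace Simplex

theorem bracket_vertex_injective {n : ℕ} {v w : Fin (n + 1)}
    (h : (bracket (fun _ => v) : Chain n 0) = bracket (fun _ => w)) : v = w := by
  have hs : ∀ u : Fin (n + 1), StrictMono (fun _ : Fin 1 => u) :=
    fun u a b hab => absurd hab (by omega)
  rw [bracket_of_strictMono (hs v), bracket_of_strictMono (hs w)] at h
  have := Finsupp.single_left_injective (one_ne_zero) h
  exact DFunLike.congr_fun this 0

namespace Cell

variable {n : ℕ}

/-- A nonnegative `0`-chain is a sum of vertices, and its augmentation is their number. -/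
theorem exists_vertex (α : Sgn) (x : Cell n) :
    ∃ v : Fin (n + 1), x.chain α 0 = bracket (fun _ => v) := by
  obtain ⟨M, hM, hM'⟩ := Cell.exists_multiset (x.nonneg α 0)
  have e := x.augmentation_eq α
  rw [← hM' .neg, Cell.augmentation_atomSum] at e
  obtain ⟨⟨q, τ⟩, rfl⟩ := Multiset.card_eq_one.1 (by exact_mod_cast e)
  obtain rfl : q = 0 := hM _ (Multiset.mem_singleton_self _)
  refine ⟨τ (0 : Fin 1), ?_⟩
  rw [← hM' .neg, Cell.atomSum, Multiset.map_singleton, Multiset.sum_singleton,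
    Cell.atom_chain_self, ← bracket_coe]
  congr 1
  funext i
  exact congrArg τ (Subsingleton.elim (α := Fin 1) i 0)

/-- The vertex which is the `0`-source or the `0`-target of a cell. -/
noncomputable def vertex (α : Sgn) (x : Cell n) : Fin (n + 1) :=
  (exists_vertex α x).choose

theorem chain_zero (α : Sgn) (x : Cell n) : x.chain α 0 = bracket (fun _ => vertex α x) :=
  (exists_vertex α x).choose_spec

theorem vertex_eq_of_chain {α β : Sgn} {x y : Cell n} (h : x.chain α 0 = y.chain β 0) :
    vertex α x = vertex β y :=
  bracket_vertex_injective ((chain_zero α x).symm.trans (h.trans (chain_zero β y)))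

theorem vertex_eq {α : Sgn} {x : Cell n} {v : Fin (n + 1)}
    (h : x.chain α 0 = bracket (fun _ => v)) : vertex α x = v :=
  bracket_vertex_injective ((chain_zero α x).symm.trans h)

/-- Pairing the boundary of the `1`-chain with `ψ` gives `ψ(source) - ψ(target) ≤ 0`. It is also the
sum of the increments of `ψ` over the edges, with nonnegative coefficients, and each increment is
nonnegative. Hence all of them vanish on the support. -/
theorem potential {x : Cell n} {ψ : Fin (n + 1) → ℤ} (hψ : Monotone ψ)
    (h : ψ (vertex .neg x) ≤ ψ (vertex .pos x)) {α : Sgn} {e : Face n 1}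
    (he : x.chain α 1 e ≠ 0) : ψ (e 0) = ψ (e 1) := by
  let L : Chain n 0 →ₗ[ℤ] ℤ := Finsupp.linearCombination ℤ fun v : Face n 0 => ψ (v 0)
  have hL : ∀ v : Fin (n + 1), L (bracket fun _ => v) = ψ v := fun v => by
    rw [bracket_of_strictMono (fun a b hab => absurd hab (by omega)),
      Finsupp.linearCombination_single, one_smul]
    rfl
  have h₁ : ∀ c : Chain n 1, L (boundary n 0 c) = c.sum fun e k => k * (ψ (e 1) - ψ (e 0)) := by
    intro c
    have : L.comp (boundary n 0) =
        Finsupp.linearCombination ℤ fun e : Face n 1 => ψ (e 1) - ψ (e 0) := by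
      refine Finsupp.lhom_ext' fun e => LinearMap.ext_ring ?_
      rw [LinearMap.comp_apply, LinearMap.comp_apply, LinearMap.comp_apply, Finsupp.lsingle_apply,
        boundary_single e, Finsupp.linearCombination_single, one_smul,
        Fin.sum_univ_two (f := fun i : Fin 2 => (-1 : ℤ) ^ (i : ℕ) •
          (Finsupp.single (facet e i) (1 : ℤ) : Chain n 0)), map_add, map_smul, map_smul,
        Finsupp.linearCombination_single, Finsupp.linearCombination_single]
      simp only [Fin.val_zero, pow_zero, Fin.val_one, pow_one, one_smul, neg_smul, sub_eq_add_neg]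
      rfl
    exact (LinearMap.congr_fun this c).trans (Finsupp.linearCombination_apply _ _)
  have h₂ := h₁ (x.chain α 1)
  rw [x.boundary_eq, map_sub, chain_zero, chain_zero, hL, hL] at h₂
  have h₃ : ∀ e ∈ (x.chain α 1).support, 0 ≤ x.chain α 1 e * (ψ (e 1) - ψ (e 0)) := fun e _ =>
    mul_nonneg (x.nonneg α 1 e) (sub_nonneg.2 (hψ (e.monotone (Fin.zero_le 1))))
  have h₄ := (Finset.sum_eq_zero_iff_of_nonneg h₃).1
    (le_antisymm (h₂.ge.trans (by linarith)) (Finset.sum_nonneg h₃)) e (Finsupp.mem_support_iff.2 he)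
  have := (mul_eq_zero.1 h₄).resolve_left he
  linarith

theorem edge_le_vertex {x : Cell n} {α : Sgn} {e : Face n 1} (he : x.chain α 1 e ≠ 0) :
    e 1 ≤ vertex .neg x := by
  by_contra hlt
  -- This potential is flat up to the source vertex and strictly increasing after it, so no edge may
  -- end beyond the source.
  have h := potential (x := x) (ψ := fun u => max ((u : ℤ) - (vertex .neg x : ℕ)) 0)
    (fun a b hab => by have : (a : ℕ) ≤ b := hab; simp only; omega) (by simp) he
  have h₁ : (e 0 : ℕ) < e 1 := e.strictMono (show (0 : Fin 2) < 1 by decide)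
  have h₂ : (vertex .neg x : ℕ) < e 1 := not_le.1 hlt
  omega

theorem vertex_le_edge {x : Cell n} {α : Sgn} {e : Face n 1} (he : x.chain α 1 e ≠ 0) :
    vertex .pos x < e 1 := by
  by_contra hlt
  -- This potential is strictly increasing up to the target vertex and flat after it, so no edge has
  -- its last vertex at or before the target.
  have h := potential (x := x) (ψ := fun u => min ((u : ℤ) - (vertex .pos x : ℕ)) 0)
    (fun a b hab => by have : (a : ℕ) ≤ b := hab; simp only; omega) (by simp) he
  have h₁ : (e 0 : ℕ) < e 1 := e.strictMono (show (0 : Fin 2) < 1 by decide)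
  have h₂ : (e 1 : ℕ) ≤ vertex .pos x := not_lt.1 hlt
  omega

theorem vertex_d_succ (α β : Sgn) (m : ℕ) (x : Cell n) :
    vertex β (Cell.d α (m + 1) x) = vertex β x :=
  vertex_eq_of_chain (by simp [Cell.d])

theorem vertex_d_zero (α β : Sgn) (x : Cell n) : vertex β (Cell.d α 0 x) = vertex α x :=
  vertex_eq_of_chain (by simp [Cell.d])

theorem vertex_of_composable {x y : Cell n} (h : Cell.d .pos 0 x = Cell.d .neg 0 y) :
    vertex .pos x = vertex .neg y :=
  vertex_eq_of_chain (chain_pos_eq_of_d_eq h)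

theorem vertex_of_composable_succ {m : ℕ} {x y : Cell n}
    (h : Cell.d .pos (m + 1) x = Cell.d .neg (m + 1) y) (α : Sgn) : vertex α x = vertex α y :=
  vertex_eq_of_chain (chain_eq_of_d_eq h α m.succ_pos)

theorem vertex_comp_succ {m : ℕ} {x y : Cell n}
    (h : Cell.d .pos (m + 1) x = Cell.d .neg (m + 1) y) (α : Sgn) :
    vertex α (Cell.comp (m + 1) x y h) = vertex α x :=
  vertex_eq_of_chain (by simp [Cell.comp])

theorem vertex_neg_comp {x y : Cell n} (h : Cell.d .pos 0 x = Cell.d .neg 0 y) :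
    vertex .neg (Cell.comp 0 x y h) = vertex .neg x :=
  vertex_eq_of_chain (by simp [Cell.comp])

theorem vertex_pos_comp {x y : Cell n} (h : Cell.d .pos 0 x = Cell.d .neg 0 y) :
    vertex .pos (Cell.comp 0 x y h) = vertex .pos y :=
  vertex_eq_of_chain (by simp [Cell.comp])

end Cell

end Simplex

/-! ### Compositions of index 0 and the resulting omega-functor -/

namespace Gauge

open Loop Cell

variable {D : OmegaCat.{u}} [D.AllInvertible] {n : ℕ} {p : D.Ob} (h : Gauge n p)

/-- The vertex shared by the two cells separates their edges: those of `x` end strictly after it and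
those of `y` end at or before it. This is the situation of `pathProd_add`. -/
theorem path_comp_zero (x y : Cell n) (hxy : Cell.d .pos 0 x = Cell.d .neg 0 y) (α : Sgn) :
    h.path ((Cell.comp 0 x y hxy).chain α 1) = h.path (x.chain α 1) * h.path (y.chain α 1) := by
  have e : (Cell.comp 0 x y hxy).chain α 1 = x.chain α 1 + y.chain α 1 := by simp [Cell.comp]
  rw [e]
  refine h.pathProd_add (w := vertex .pos x) (fun e he => vertex_le_edge he) (fun e he => ?_) _
  rw [vertex_of_composable hxy]
  exact edge_le_vertex he

/-- The path products multiply, and Eckmann-Hilton exchanges the middle factors of the two edge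
parts. The parts of higher dimension add, since they vanish on `0`-sources and `0`-targets, and they
commute with the edge parts. -/
theorem loop_comp_zero (x y : Cell n) (hxy : Cell.d .pos 0 x = Cell.d .neg 0 y) :
    h.loop (Cell.comp 0 x y hxy) = h.loop x * h.loop y := by
  have hlow : h.low (Cell.comp 0 x y hxy) = h.low x * h.low y := by
    have hc := (commute (x := h.path (y.chain .pos 1) * (h.path (y.chain .neg 1))⁻¹)
      (by rw [map_mul, map_inv, δ_neg_path, δ_neg_path, mul_inv_cancel])
      (h.δ_pos_low_factor x)).eq
    simp only [low, path_comp_zero, map_mul]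
    set a := h.path (x.chain .pos 1)
    set b := h.path (x.chain .neg 1)
    set c := h.path (y.chain .pos 1)
    set d := h.path (y.chain .neg 1)
    calc a * c * ((b * d)⁻¹ * (δ .pos 0 b * δ .pos 0 d))
        = a * (c * d⁻¹ * (b⁻¹ * δ .pos 0 b)) * δ .pos 0 d := by group
      _ = _ := by rw [hc]; group
  rw [loop, hlow, high_comp, high_d_zero, sub_zero, ofCore_add, loop, loop]
  have h₁ := h.commute_low (h.high y) x
  simp only [mul_assoc]
  rw [h₁.left_comm]

/-- The value of the omega-functor determined by loops attached to the faces and arrows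
attached to the vertices. -/
noncomputable def value (g : Fin (n + 1) → Arrow p) (x : Cell n) : D.carrier :=
  Arrow.conj (g (vertex .neg x)) (h.loop x) (g (vertex .pos x))

theorem value_d (g : Fin (n + 1) → Arrow p) (α : Sgn) (m : ℕ) (x : Cell n) :
    h.value g (Cell.d α m x) = D.d α m (h.value g x) := by
  cases m with
  | zero =>
    rw [value, vertex_d_zero, vertex_d_zero, loop_d_zero, Arrow.conj_one, value]
    cases α
    exacts [(Arrow.neg_conj _ _ _).symm, (Arrow.pos_conj _ _ _).symm]
  | succ m => rw [value, value, Arrow.d_conj, δ_loop, vertex_d_succ, vertex_d_succ]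

theorem value_comp (g : Fin (n + 1) → Arrow p) (m : ℕ) (x y : Cell n)
    (hxy : Cell.d .pos m x = Cell.d .neg m y)
    (hxy' : D.d .pos m (h.value g x) = D.d .neg m (h.value g y)) :
    h.value g (Cell.comp m x y hxy) = D.comp m (h.value g x) (h.value g y) hxy' := by
  unfold value at hxy' ⊢
  cases m with
  | zero =>
    rw [vertex_neg_comp, vertex_pos_comp, loop_comp_zero]
    have e := vertex_of_composable hxy
    revert hxy'
    rw [e]
    exact fun hxy' => (Arrow.conj_comp_zero _ _ _ _ _ hxy').symm
  | succ m =>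
    rw [vertex_comp_succ, vertex_comp_succ, loop_comp_succ]
    revert hxy'
    rw [← vertex_of_composable_succ hxy .neg, ← vertex_of_composable_succ hxy .pos]
    refine fun hxy' => (Arrow.conj_comp_succ _ _ ?_ hxy').symm
    rw [δ_loop, δ_loop]
    exact congrArg h.loop hxy

/-- The omega-functor determined by arbitrary loops attached to the faces and arbitrary arrows
attached to the vertices. -/
noncomputable def functor (g : Fin (n + 1) → Arrow p) : OmegaFunctor (simplexOmega n) D where
  toFun := h.value g
  map_d := h.value_d g
  map_comp := h.value_comp g

end Gauge

/-! ### Vertices and facets of atoms -/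

namespace Simplex

open Cell

variable {n : ℕ}

/-- A vertex as a face. -/
def vertexFace (v : Fin (n + 1)) : Face n 0 :=
  OrderEmbedding.ofStrictMono (fun _ => v) fun a b hab => absurd hab (by omega)

theorem bracket_vertex (v : Fin (n + 1)) :
    (bracket (fun _ => v) : Chain n 0) = Finsupp.single (vertexFace v) 1 :=
  bracket_coe (vertexFace v)

theorem face_zero_eq (τ : Face n 0) : τ = vertexFace (τ 0) := by
  refine DFunLike.ext _ _ fun i => ?_
  exact congrArg τ (Subsingleton.elim (α := Fin 1) i 0)

namespace Cell

theorem vertex_eq_of_ne_zero {α : Sgn} {x : Cell n} {τ : Face n 0} (h : x.chain α 0 τ ≠ 0) :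
    vertex α x = τ 0 := by
  rw [chain_zero, bracket_vertex, Finsupp.single_apply] at h
  split_ifs at h with h'
  · rw [← h']; rfl
  · exact absurd rfl h

theorem d_zero_eq_atom (α : Sgn) (x : Cell n) : Cell.d α 0 x = atom (vertexFace (vertex α x)) := by
  refine Cell.ext (funext fun γ => funext fun q => ?_)
  rcases Nat.eq_zero_or_pos q with rfl | hq
  · rw [atom_chain_self, ← bracket_vertex, ← chain_zero]
    simp [Cell.d]
  · rw [atom_chain_of_lt _ hq]
    simp [Cell.d, hq.ne']

theorem vertex_map {m : ℕ} (f : Face n m) (α : Sgn) (x : Cell m) :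
    vertex α (x.map f.toOrderHom) = f (vertex α x) := by
  refine vertex_eq ?_
  change push _ _ _ = _
  rw [chain_zero, push_bracket _ monotone_const]
  rfl

theorem vertex_atom_mem {q : ℕ} (α : Sgn) (τ : Face n q) : vertex α (atom τ) ∈ Set.range τ := by
  rw [atom, vertex_map]
  exact ⟨_, rfl⟩

theorem vertex_atom_zero (α : Sgn) (τ : Face n 0) : vertex α (atom τ) = τ 0 :=
  vertex_eq_of_ne_zero (by simp [atom_chain_self])

/-- Removing the vertex of index 0 gives the source, so an edge is directed from its larger vertex
to its smaller one. -/
theorem vertex_neg_edge (ρ : Face n 1) : vertex .neg (atom ρ) = ρ 1 := by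
  have := atom_facet ρ 0
  exact vertex_eq_of_ne_zero (α := facetSgn (0 : Fin 2)) (by rw [this]; exact one_ne_zero)

theorem vertex_pos_edge (ρ : Face n 1) : vertex .pos (atom ρ) = ρ 0 := by
  have := atom_facet ρ 1
  have e : facetSgn (1 : Fin 2) = .pos := by simp [facetSgn]
  rw [e] at this
  exact vertex_eq_of_ne_zero (by rw [this]; exact one_ne_zero)

end Cell

theorem notMem_range_facet {q : ℕ} (ρ : Face n (q + 1)) (i : Fin (q + 2)) :
    ρ i ∉ Set.range (facet ρ i) := by
  rintro ⟨j, hj⟩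
  exact Fin.succAbove_ne i j (ρ.injective hj)

theorem range_eq_insert_facet {q : ℕ} (ρ : Face n (q + 1)) (i : Fin (q + 2)) :
    Set.range ρ = insert (ρ i) (Set.range (facet ρ i)) := by
  ext v
  constructor
  · rintro ⟨j, rfl⟩
    rcases eq_or_ne j i with rfl | h
    · exact Set.mem_insert _ _
    · obtain ⟨a, rfl⟩ := Fin.exists_succAbove_eq h
      exact Set.mem_insert_of_mem _ (Set.mem_range_self (f := facet ρ i) a)
  · rintro (rfl | ⟨a, rfl⟩)
    exacts [⟨i, rfl⟩, ⟨_, rfl⟩]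

theorem facet_unique {q : ℕ} {ρ ρ' : Face n (q + 1)} {i i' : Fin (q + 2)} (h : ρ i = ρ' i')
    (h' : facet ρ i = facet ρ' i') : ρ = ρ' ∧ i = i' := by
  obtain rfl : ρ = ρ' := OrderEmbedding.range_inj.1 (by
    rw [range_eq_insert_facet ρ i, range_eq_insert_facet ρ' i', h, h'])
  exact ⟨rfl, ρ.injective h⟩

end Simplex

/-! ### The loop of an atom when only one facet carries a nontrivial loop -/

namespace Gauge

open Loop Cell

variable {D : OmegaCat.{u}} [D.AllInvertible] {n : ℕ} {p : D.Ob} (h : Gauge n p)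

theorem path_eq_zpow {c : Chain n 1} {σ : Face n 1} (hc : ∀ e, e ≠ σ → h.val 0 e ^ c e = 1) :
    h.path c = h.val 0 σ ^ c σ :=
  h.pathProd_eq_zpow hc (σ 1).isLt

theorem loop_atom_vertex (τ : Face n 0) : h.loop (atom τ) = 1 := by
  rw [← d_atom_of_le τ le_rfl .neg, loop_d_zero]

theorem loop_atom_edge {ρ : Face n 1} (hρ : h.val 0 ρ = 1) : h.loop (atom ρ) = 1 := by
  have e₁ : h.high (atom ρ) = 0 := Finset.sum_eq_zero fun j _ => by
    simp only [term, atom_chain_of_lt ρ (show 1 < j + 2 by omega), map_zero, sub_zero, add_zero]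
  have e₂ : h.path (Finsupp.single ρ 1) = 1 := by
    rw [h.path_eq_zpow (σ := ρ), hρ, one_zpow]
    intro e he
    rw [Finsupp.single_eq_of_ne he, zpow_zero]
  rw [loop, e₁, low, atom_chain_self, atom_chain_self, e₂, ofCore_zero]
  simp

/-- The element `u` or its inverse, depending on a sign. -/
def signed {G : Type*} [Group G] (s : Sgn) (u : G) : G :=
  match s with
  | .pos => u
  | .neg => u⁻¹

/-- The top component of the loop of an atom when the loops of all the faces but one vanish. -/
theorem loop_atom {j : ℕ} {ρ : Face n (j + 2)} {i : Fin (j + 3)} (hρ : h.val (j + 1) ρ = 1)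
    (hf : ∀ i', i' ≠ i → h.val j (facet ρ i') = 1) :
    h.loop (atom ρ) * (δ .neg j (h.loop (atom ρ)))⁻¹ =
      signed (facetSgn i) (h.val j (facet ρ i)) := by
  have hρ' : h.coreVal j ρ = 0 := ofCore_injective hρ
  cases j with
  | zero =>
    have e₁ : h.high (atom ρ) = 0 := Finset.sum_eq_zero fun l _ => by
      rcases Nat.eq_zero_or_pos l with rfl | hl
      · simp only [term, zero_add, atom_chain_self ρ, chainVal_single, hρ', smul_zero, sub_zero,
          map_zero, add_zero]
      · simp only [term, atom_chain_of_lt ρ (show 2 < l + 2 by omega), map_zero, sub_zero, add_zero]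
    have e₂ : ∀ α, h.path ((atom ρ).chain α 1) =
        h.val 0 (facet ρ i) ^ (atom ρ).chain α 1 (facet ρ i) := fun α => by
      refine h.path_eq_zpow fun e he => ?_
      by_cases hc : (atom ρ).chain α 1 e = 0
      · rw [hc, zpow_zero]
      · obtain ⟨i', rfl, -⟩ := exists_facet_of_atom hc
        rw [hf i' (by rintro rfl; exact he rfl), one_zpow]
    have e₃ := atom_facet ρ i
    have e₄ := atom_disjoint ρ (Nat.lt_succ_self 1) (facet ρ i)
    rw [δ_loop, loop, loop, ← coreδ_high, e₁, map_zero, ofCore_zero, one_mul, one_mul, ← δ_low, low]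
    simp only [map_mul, map_inv, δ_neg_path, δ_δ_of_le _ _ le_rfl, inv_one, one_mul, mul_assoc,
      mul_inv_cancel, mul_one]
    rw [e₂, e₂]
    cases hs : facetSgn i
    · rw [hs] at e₃
      have e₅ := e₄.resolve_left (by rw [e₃]; exact one_ne_zero)
      rw [e₃, e₅, zpow_zero, zpow_one, one_mul]
      rfl
    · rw [hs] at e₃
      have e₅ := e₄.resolve_right (by rw [e₃]; exact one_ne_zero)
      rw [e₃, e₅, zpow_zero, zpow_one, inv_one, mul_one]
      rfl
  | succ j =>
    -- The face `ρ` has dimension `j + 3`, which bounds `j` and puts the relevant term among those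
    -- of `high`.
    have hjn : j < n := by
      by_contra hc
      exact (isEmpty_face (show n < j + 1 + 2 by omega)).false ρ
    -- Terms below level `j` are not changed by passing to the source and cancel; those above
    -- vanish, because `ρ` carries the trivial loop and the atom has no larger face. At level `j`
    -- the `δ⁺` part is common to both and cancels.
    have e₁ : h.high (atom ρ) - coreδ .neg (j + 1) (h.high (atom ρ)) =
        h.chainVal j ((atom ρ).chain .pos (j + 2)) - h.chainVal j ((atom ρ).chain .neg (j + 2)) := by
      rw [high, map_sum, ← Finset.sum_sub_distrib,
        Finset.sum_eq_single_of_mem j (Finset.mem_range.2 hjn)]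
      · rw [coreδ_term, term, term]
        simp [Cell.d, sub_self]
      · intro l _ hl
        rcases lt_or_gt_of_ne hl with hl | hl
        · rw [coreδ_term, term, term]
          have : l + 2 < j + 1 + 1 := by omega
          simp only [Cell.d, this, if_true, sub_self]
        · have e : h.term l (atom ρ) = 0 := by
            rcases (show j + 1 ≤ l from hl).eq_or_lt with rfl | hl
            · simp only [term, atom_chain_self ρ, chainVal_single, hρ', smul_zero, sub_zero,
                map_zero, add_zero]
            · simp only [term, atom_chain_of_lt ρ (show j + 1 + 2 < l + 2 by omega), map_zero,
                sub_zero, add_zero]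
          rw [e, map_zero, sub_zero]
    -- Target minus source is the opposite of the boundary of `ρ`, and all its facets but the one of
    -- index `i` carry the trivial loop.
    have e₂ : h.chainVal j ((atom ρ).chain .pos (j + 2)) -
        h.chainVal j ((atom ρ).chain .neg (j + 2)) =
        -((-1 : ℤ) ^ (i : ℕ) • h.coreVal j (facet ρ i)) := by
      rw [← map_sub, ← neg_sub, ← atom_boundary, boundary_single, map_neg, map_sum,
        Finset.sum_eq_single i]
      · rw [map_smul, chainVal_single, one_smul]
      · intro i' _ hi'
        have : h.coreVal j (facet ρ i') = 0 := ofCore_injective (hf i' hi')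
        rw [map_smul, chainVal_single, this, smul_zero, smul_zero]
      · simp
    have e₃ : δ .neg (j + 1) (h.loop (atom ρ)) =
        ofCore (coreδ .neg (j + 1) (h.high (atom ρ))) * h.low (atom ρ) := by
      rw [loop, map_mul, ofCore_coreδ]
      congr 1
      rw [δ_low]
      simp [low, Cell.d]
    rw [e₃, loop, mul_inv_rev, ← mul_assoc, mul_inv_cancel_right, ← ofCore_sub, e₁, e₂]
    rcases Nat.even_or_odd (i : ℕ) with hi | hi
    · rw [show facetSgn i = .neg by simp [facetSgn, hi], hi.neg_one_pow, one_smul]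
      rfl
    · rw [show facetSgn i = .pos by simp [facetSgn, hi], hi.neg_one_pow, neg_smul, one_smul, neg_neg]
      rfl

end Gauge

namespace OmegaCat.Arrow

variable {D : OmegaCat.{u}} {p : D.Ob}

/-- The constant arrow. -/
def one (p : D.Ob) : Arrow p := ⟨p.1, p.d_eq _ _, p.d_eq _ _⟩

variable [D.AllInvertible]

theorem inv_one : (one p).inv = p.1 :=
  (one p).isInverse_inv.unique (isInverse_self (p.d_eq _ _))

theorem conj_one_one (a : Arrow p) : conj a 1 (one p) = a.inv :=
  (comp_id' (D.tgt_comp _ _ _ _ |>.trans (p.d_eq _ _)).symm _).trans (comp_id' a.pos_inv.symm _)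

theorem conj_one_one' (a : Arrow p) : conj (one p) 1 a = a.1 := by
  have e : D.comp 0 (one p).inv (1 : Loop p).1 (conj_composable₁ (one p) 1) = p.1 :=
    (comp_id' (one p).pos_inv.symm _).trans inv_one
  exact (comp_congr e rfl _ ((p.d_eq _ _).trans a.2.1.symm)).trans (id_comp' a.2.1.symm _)

end OmegaCat.Arrow

namespace Gauge

theorem signed_signed {G : Type*} [Group G] (s : Sgn) (u : G) : signed s (signed s u) = u := by
  cases s
  exacts [inv_inv u, rfl]

theorem map_signed {G G' : Type*} [Group G] [Group G'] (f : G →* G') (s : Sgn) (u : G) :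
    f (signed s u) = signed s (f u) := by
  cases s
  exacts [map_inv f u, rfl]

theorem signed_one {G : Type*} [Group G] (s : Sgn) : signed s (1 : G) = 1 := by
  cases s
  exacts [inv_one, rfl]

end Gauge

/-! ### Filling a horn -/

namespace Simplex

open Cell

variable {D : OmegaCat.{u}} [D.AllInvertible] {n : ℕ}

/-- Elements of an omega-groupoid attached to some faces of a simplex, with the dimensions and the
vertices of the atoms. -/
structure PartialFamily (D : OmegaCat.{u}) (n : ℕ) where
  val : ∀ q, Face n q → D.carrier
  mem : ∀ q, Face n q → Prop
  mem_of_subset : ∀ {q r} {τ : Face n q} {σ : Face n r}, mem q τ → Set.range σ ⊆ Set.range τ →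
    mem r σ
  d_self : ∀ {q} {τ : Face n q}, mem q τ → ∀ α, D.d α q (val q τ) = val q τ
  d_zero : ∀ {q} {τ : Face n q}, mem q τ → ∀ α,
    D.d α 0 (val q τ) = val 0 (vertexFace (vertex α (atom τ)))

namespace PartialFamily

variable (z : PartialFamily D n) {k : Fin (n + 1)}

/-- The value at a vertex. -/
def ob (hk : z.mem 0 (vertexFace k)) : D.Ob := ⟨z.val 0 (vertexFace k), z.d_self hk .neg⟩

variable {z} (hk : z.mem 0 (vertexFace k))

/-- Edges go from the larger vertex to the smaller, so the element of the edge joining `k` to `v` is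
the arrow itself when `v < k` and the inverse of the arrow when `k < v`. If the edge is not in the
family, the constant arrow is taken. -/
theorem exists_arrow (v : Fin (n + 1)) : ∃ a : Arrow (z.ob hk), (v = k → a = .one _) ∧
    (∀ ρ : Face n 1, z.mem 1 ρ → ρ 0 = k → ρ 1 = v → Arrow.conj a 1 (.one _) = z.val 1 ρ) ∧
    ∀ ρ : Face n 1, z.mem 1 ρ → ρ 1 = k → ρ 0 = v → Arrow.conj (.one _) 1 a = z.val 1 ρ := by
  have hlt : ∀ ρ : Face n 1, ρ 0 < ρ 1 := fun ρ => ρ.strictMono (show (0 : Fin 2) < 1 by decide)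
  have huniq : ∀ ρ ρ' : Face n 1, ρ 0 = ρ' 0 → ρ 1 = ρ' 1 → ρ = ρ' := fun ρ ρ' h₀ h₁ => by
    refine DFunLike.ext _ _ fun i => ?_
    obtain rfl | rfl : i = 0 ∨ i = 1 := by
      match i with
      | 0 => exact .inl rfl
      | 1 => exact .inr rfl
    exacts [h₀, h₁]
  have hneg : ∀ ρ : Face n 1, z.mem 1 ρ → D.d .neg 0 (z.val 1 ρ) = z.val 0 (vertexFace (ρ 1)) :=
    fun ρ h => by rw [z.d_zero h, vertex_neg_edge]
  have hpos : ∀ ρ : Face n 1, z.mem 1 ρ → D.d .pos 0 (z.val 1 ρ) = z.val 0 (vertexFace (ρ 0)) :=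
    fun ρ h => by rw [z.d_zero h, vertex_pos_edge]
  by_cases h₁ : ∃ ρ : Face n 1, z.mem 1 ρ ∧ ρ 0 = k ∧ ρ 1 = v
  · obtain ⟨ρ, hρ, hρ₀, hρ₁⟩ := h₁
    obtain ⟨y, hy⟩ := AllInvertible.exists_inverse (D := D) 0 (z.val 1 ρ)
    have hy₁ := hy.d .neg (Nat.zero_lt_one)
    rw [z.d_self hρ] at hy₁
    refine ⟨⟨y, hy.1.symm.trans ((hpos ρ hρ).trans (by rw [hρ₀]; rfl)), hy₁.unique hy⟩, ?_, ?_, ?_⟩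
    · rintro rfl
      exact absurd (hlt ρ) (by rw [hρ₀, hρ₁]; exact lt_irrefl _)
    · intro ρ' _ h₀' h₁'
      rw [huniq ρ' ρ (h₀'.trans hρ₀.symm) (h₁'.trans hρ₁.symm)]
      exact (Arrow.conj_one_one _).trans ((Arrow.isInverse_inv _).unique hy.symm)
    · intro ρ' _ h₁' h₀'
      have a := hlt ρ
      have b := hlt ρ'
      rw [hρ₀, hρ₁] at a
      rw [h₁', h₀'] at b
      exact absurd a b.asymm
  by_cases h₂ : ∃ ρ : Face n 1, z.mem 1 ρ ∧ ρ 1 = k ∧ ρ 0 = v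
  · obtain ⟨ρ, hρ, hρ₁, hρ₀⟩ := h₂
    refine ⟨⟨z.val 1 ρ, (hneg ρ hρ).trans (by rw [hρ₁]; rfl), z.d_self hρ _⟩, ?_, ?_, ?_⟩
    · rintro rfl
      exact absurd (hlt ρ) (by rw [hρ₀, hρ₁]; exact lt_irrefl _)
    · intro ρ' h' h₀' h₁'
      exact absurd ⟨ρ', h', h₀', h₁'⟩ h₁
    · intro ρ' _ h₁' h₀'
      rw [huniq ρ' ρ (h₀'.trans hρ₀.symm) (h₁'.trans hρ₁.symm)]
      exact Arrow.conj_one_one' _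
  · exact ⟨.one _, fun _ => rfl, fun ρ h h₀ h₁' => absurd ⟨ρ, h, h₀, h₁'⟩ h₁,
      fun ρ h h₁' h₀ => absurd ⟨ρ, h, h₁', h₀⟩ h₂⟩

/-- An arrow from the value at the vertex `k`. -/
noncomputable def arrow (v : Fin (n + 1)) : Arrow (z.ob hk) := (exists_arrow hk v).choose

theorem arrow_self : arrow hk k = .one _ := (exists_arrow hk k).choose_spec.1 rfl

theorem conj_arrow {ρ : Face n 1} (hρ : z.mem 1 ρ) (hkρ : k ∈ Set.range ρ) :
    Arrow.conj (arrow hk (ρ 1)) 1 (arrow hk (ρ 0)) = z.val 1 ρ := by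
  obtain ⟨i, hi⟩ := hkρ
  match i, hi with
  | 0, hi =>
    have := (exists_arrow hk (ρ 1)).choose_spec.2.1 ρ hρ hi rfl
    rw [hi, arrow_self]
    exact this
  | 1, hi =>
    have := (exists_arrow hk (ρ 0)).choose_spec.2.2 ρ hρ hi rfl
    rw [hi, arrow_self]
    exact this

theorem pos_arrow {q : ℕ} {ρ : Face n q} (hρ : z.mem q ρ) (hkρ : k ∈ Set.range ρ) {v : Fin (n + 1)}
    (hv : v ∈ Set.range ρ) : D.d .pos 0 (arrow hk v).1 = z.val 0 (vertexFace v) := by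
  by_cases hvk : v = k
  · subst hvk
    rw [arrow_self]
    exact z.d_self hk _
  · have hv' : v ∉ Set.range (vertexFace k) := by
      rintro ⟨_, h⟩
      exact hvk h.symm
    obtain ⟨ρ', i, hi, hf⟩ := exists_facet_eq hv'
    have hr : Set.range ρ' = insert v (Set.range (vertexFace k)) := by
      rw [range_eq_insert_facet ρ' i, hf, hi]
    have hk' : k ∈ Set.range ρ' := by
      rw [hr]
      exact Set.mem_insert_of_mem _ ⟨0, rfl⟩
    have hm : z.mem 1 ρ' := z.mem_of_subset hρ (by
      rw [hr]
      rintro _ (rfl | ⟨_, rfl⟩)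
      exacts [hv, hkρ])
    have h := conj_arrow hk hm hk'
    match i, hi with
    | 0, hi =>
      have h' := (congrArg (D.d .pos 0) h).symm.trans (Arrow.pos_conj _ _ _)
      rw [z.d_zero hm, vertex_pos_edge, hi] at h'
      exact h'.symm
    | 1, hi =>
      have h' := (congrArg (D.d .neg 0) h).symm.trans (Arrow.neg_conj _ _ _)
      rw [z.d_zero hm, vertex_neg_edge, hi] at h'
      exact h'.symm

theorem exists_loop {q : ℕ} {ρ : Face n q} (hρ : z.mem q ρ) (hkρ : k ∈ Set.range ρ) :
    ∃ Z, Arrow.conj (arrow hk (vertex .neg (atom ρ))) Z (arrow hk (vertex .pos (atom ρ))) =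
      z.val q ρ :=
  Arrow.exists_conj ((z.d_zero hρ _).trans (pos_arrow hk hρ hkρ (vertex_atom_mem _ _)).symm)
    ((z.d_zero hρ _).trans (pos_arrow hk hρ hkρ (vertex_atom_mem _ _)).symm)

/-- The loop of `σ` must produce the element attached to the face spanned by `σ` and `k`. By
`Gauge.loop_atom` it enters as the top component of that element, up to inversion, which dictates
its value. When the larger face is not in the family, the trivial loop is taken. -/
theorem exists_gauge_val (j : ℕ) (σ : Face n (j + 1)) : ∃ u : Loop (z.ob hk),
    Loop.δ .neg j u = 1 ∧ Loop.δ .neg (j + 1) u = u ∧ (k ∈ Set.range σ → u = 1) ∧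
    ∀ (ρ : Face n (j + 2)) (i : Fin (j + 3)), z.mem _ ρ → ρ i = k → facet ρ i = σ → ∀ Z,
      Arrow.conj (arrow hk (vertex .neg (atom ρ))) Z (arrow hk (vertex .pos (atom ρ))) =
        z.val _ ρ → Z * (Loop.δ .neg j Z)⁻¹ = Gauge.signed (facetSgn i) u := by
  by_cases h : ∃ (ρ : Face n (j + 2)) (i : Fin (j + 3)), z.mem _ ρ ∧ ρ i = k ∧ facet ρ i = σ
  · obtain ⟨ρ, i, hρ, hi, rfl⟩ := h
    obtain ⟨Z, hZ⟩ := exists_loop hk hρ ⟨i, hi⟩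
    have hZ' : Loop.δ .neg (j + 1) Z = Z := by
      refine Arrow.conj_injective (a := arrow hk (vertex .neg (atom ρ)))
        (b := arrow hk (vertex .pos (atom ρ))) ((Arrow.d_conj _ _ _ _ _).symm.trans ?_)
      rw [hZ, z.d_self hρ]
    refine ⟨Gauge.signed (facetSgn i) (Z * (Loop.δ .neg j Z)⁻¹), ?_, ?_, ?_, ?_⟩
    · rw [Gauge.map_signed, map_mul, map_inv, Loop.δ_δ_of_le _ _ le_rfl, mul_inv_cancel,
        Gauge.signed_one]
    · rw [Gauge.map_signed, map_mul, map_inv, Loop.δ_δ_of_le _ _ j.le_succ, hZ']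
    · intro hmem
      rw [← hi] at hmem
      exact absurd hmem (notMem_range_facet ρ i)
    · intro ρ' i' _ hi' hf Z' hZ''
      obtain ⟨rfl, rfl⟩ := facet_unique (hi'.trans hi.symm) hf
      rw [Arrow.conj_injective (hZ''.trans hZ.symm), Gauge.signed_signed]
  · exact ⟨1, map_one _, map_one _, fun _ => rfl,
      fun ρ i hρ hi hf => absurd ⟨ρ, i, hρ, hi, hf⟩ h⟩

/-- The loops attached to the faces which do not contain `k`. -/
noncomputable def gauge : Gauge n (z.ob hk) where
  val j σ := (exists_gauge_val hk j σ).choose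
  src j σ := (exists_gauge_val hk j σ).choose_spec.1
  dim j σ := (exists_gauge_val hk j σ).choose_spec.2.1

theorem gauge_eq_one (j : ℕ) {σ : Face n (j + 1)} (h : k ∈ Set.range σ) : (gauge hk).val j σ = 1 :=
  (exists_gauge_val hk j σ).choose_spec.2.2.1 h

theorem value_vertex : (gauge hk).value (arrow hk) (atom (vertexFace k)) =
    z.val 0 (vertexFace k) := by
  rw [Gauge.value, Gauge.loop_atom_vertex, vertex_atom_zero, vertex_atom_zero, Arrow.conj_one]
  exact pos_arrow hk hk ⟨0, rfl⟩ ⟨0, rfl⟩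

/-- The gauge was chosen so that the top component `Z * (δ⁻ Z)⁻¹` is correct on every face of the
family through `k`. Together with one side of the boundary it determines the element. -/
theorem value_eq {q : ℕ} {ρ : Face n (q + 1)} (hρ : z.mem (q + 1) ρ) (hkρ : k ∈ Set.range ρ) (α : Sgn)
    (h : D.d α q ((gauge hk).value (arrow hk) (atom ρ)) = D.d α q (z.val (q + 1) ρ)) :
    (gauge hk).value (arrow hk) (atom ρ) = z.val (q + 1) ρ := by
  cases q with
  | zero =>
    rw [Gauge.value, Gauge.loop_atom_edge _ (gauge_eq_one hk 0 hkρ)]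
    exact (congrArg₂ (fun v w => Arrow.conj (arrow hk v) 1 (arrow hk w)) (vertex_neg_edge ρ)
      (vertex_pos_edge ρ)).trans (conj_arrow hk hρ hkρ)
  | succ j =>
    obtain ⟨Z, hZ⟩ := exists_loop hk hρ hkρ
    have hδ : Loop.δ α j ((gauge hk).loop (atom ρ)) = Loop.δ α j Z := by
      refine Arrow.conj_injective ((Arrow.d_conj _ _ _ _ _).symm.trans (h.trans ?_))
      rw [← hZ, Arrow.d_conj]
    obtain ⟨i, hi⟩ := hkρ
    have h₁ := (gauge hk).loop_atom (i := i) (gauge_eq_one hk (j + 1) ⟨i, hi⟩) fun i' hi' =>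
      gauge_eq_one hk j (hi ▸ mem_range_facet hi')
    replace h₁ := h₁.trans
      ((exists_gauge_val hk j (facet ρ i)).choose_spec.2.2.2 ρ i hρ hi rfl Z hZ).symm
    have h₂ : Loop.δ .neg j ((gauge hk).loop (atom ρ)) = Loop.δ .neg j Z := by
      cases α with
      | neg => exact hδ
      -- Applying `δ⁺` to the top component gives `δ⁺ * (δ⁻)⁻¹`, so the source is recovered from the
      -- target.
      | pos =>
        have h₃ := congrArg (Loop.δ .pos j) h₁
        rw [map_mul, map_mul, hδ, map_inv, map_inv, Loop.δ_δ_of_le _ _ le_rfl,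
          Loop.δ_δ_of_le _ _ le_rfl] at h₃
        exact inv_injective (mul_left_cancel h₃)
    rw [h₂] at h₁
    rw [Gauge.value, mul_right_cancel h₁, hZ]

end PartialFamily

theorem exists_eq_trans {q : ℕ} {j : Fin (n + 2)} {τ : Face (n + 1) q} (h : j ∉ Set.range τ) :
    ∃ σ : Face n q, τ = σ.trans (Fin.succAboveOrderEmb j) := by
  have h' : ∀ a, ∃ b, j.succAbove b = τ a := fun a =>
    Fin.exists_succAbove_eq fun e => h ⟨a, e⟩
  choose s hs using h'
  refine ⟨OrderEmbedding.ofStrictMono s fun a b hab => ?_, DFunLike.ext _ _ fun a => (hs a).symm⟩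
  rw [← (Fin.strictMono_succAbove j).lt_iff_lt, hs, hs]
  exact τ.strictMono hab

/-- Omega-functors on all the facets of a simplex but one, with values in an omega-groupoid, that
agree on the common atoms extend to the simplex. -/
theorem exists_filler (k : Fin (n + 2))
    (f : ∀ j : Fin (n + 2), j ≠ k → OmegaFunctor (simplexOmega n) D)
    (z : ∀ q, Face (n + 1) q → D.carrier)
    (hz : ∀ j hj q (σ : Face n q),
      (f j hj).toFun (atom σ) = z q (σ.trans (Fin.succAboveOrderEmb j))) :
    ∃ F : OmegaFunctor (simplexOmega (n + 1)) D, ∀ j hj,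
      (mapOmega (Fin.succAboveOrderEmb j).toOrderHom).comp F = f j hj := by
  let Z : PartialFamily D (n + 1) :=
    { val := z
      -- These are the faces of the horn: those contained in a facet opposite to some `j ≠ k`.
      mem := fun q τ => ∃ j, j ≠ k ∧ j ∉ Set.range τ
      mem_of_subset := fun ⟨j, hj, hjτ⟩ hs => ⟨j, hj, fun h => hjτ (hs h)⟩
      d_self := by
        rintro q τ ⟨j, hj, hjτ⟩ α
        obtain ⟨σ, rfl⟩ := exists_eq_trans hjτ
        rw [← hz j hj]
        exact (map_cell_d _ α q _).symm.trans
          (congrArg (f j hj).toFun (d_atom_of_le σ le_rfl α))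
      d_zero := by
        rintro q τ ⟨j, hj, hjτ⟩ α
        obtain ⟨σ, rfl⟩ := exists_eq_trans hjτ
        rw [← hz j hj, ← map_atom, vertex_map]
        refine (map_cell_d _ α 0 _).symm.trans ((congrArg (f j hj).toFun (d_zero_eq_atom α _)).trans
          ((hz j hj 0 _).trans ?_))
        exact congrArg (z 0) (face_zero_eq _) }
  have hk : Z.mem 0 (vertexFace k) := by
    obtain ⟨j, hj⟩ := exists_ne k
    exact ⟨j, hj, by rintro ⟨_, h⟩; exact hj h.symm⟩
  refine ⟨(PartialFamily.gauge hk).functor (PartialFamily.arrow hk), fun j hj => ?_⟩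
  -- The facet opposite to `j ≠ k` contains `k`; `k'` is the index of `k` in that facet.
  obtain ⟨k', rfl⟩ := Fin.exists_succAbove_eq hj.symm
  have hF : ∀ q (σ : Face n q), ((mapOmega (Fin.succAboveOrderEmb j).toOrderHom).comp
      ((PartialFamily.gauge hk).functor (PartialFamily.arrow hk))).toFun (atom σ) =
      (PartialFamily.gauge hk).value (PartialFamily.arrow hk)
        (atom (σ.trans (Fin.succAboveOrderEmb j))) := fun q σ =>
    congrArg ((PartialFamily.gauge hk).value (PartialFamily.arrow hk)) (map_atom _ σ)
  have hmem : ∀ q (σ : Face n q), Z.mem q (σ.trans (Fin.succAboveOrderEmb j)) := fun q σ =>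
    ⟨j, hj, by rintro ⟨a, ha⟩; exact Fin.succAbove_ne j (σ a) ha⟩
  have hrange : ∀ q (σ : Face n q), k' ∈ Set.range σ →
      j.succAbove k' ∈ Set.range (σ.trans (Fin.succAboveOrderEmb j)) := by
    rintro q σ ⟨a, rfl⟩
    exact ⟨a, rfl⟩
  -- Only the faces of the facet through `k` need checking, and on these the gauge was built to give
  -- the right values.
  refine functor_ext_of_vertex k' (fun τ hτ => ?_) fun q ρ α hρ h => ?_
  · obtain ⟨a, ha⟩ := hτ
    have e : τ.trans (Fin.succAboveOrderEmb j) = vertexFace (j.succAbove k') := by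
      rw [face_zero_eq (τ.trans _), ← ha, Subsingleton.elim (α := Fin 1) a 0]
      rfl
    rw [hF, hz j hj, e]
    exact PartialFamily.value_vertex hk
  · rw [hF, hz j hj] at h ⊢
    exact PartialFamily.value_eq hk (hmem _ ρ) (hrange _ ρ hρ) α h

end Simplex

/-! ### The Kan condition for the nerve -/

open Simplicial Opposite SSet in
theorem OmegaCat.kanComplex_simplicialNerve (D : OmegaCat.{u}) [D.AllInvertible] :
    SSet.KanComplex D.simplicialNerve := by
  refine SSet.KanComplex.iff.2 fun n i f hf => ?_
  let f' : ∀ j : Fin (n + 2), j ≠ i → OmegaFunctor (simplexOmega n) D := fun j hj =>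
    SSet.yonedaEquiv (f j hj)
  obtain ⟨j₀, hj₀⟩ := exists_ne i
  classical
  -- A face of the horn is sent to a simplex of the nerve by the map induced on the horn, and that
  -- simplex is evaluated at its top cell. Defining the values through the horn makes the facets
  -- agree on their common atoms.
  let z : ∀ q, Face (n + 1) q → D.carrier := fun q τ =>
    if h : stdSimplex.objMk.{u} (n := ⦋n + 1⦌) (m := op ⦋q⦌) τ.toOrderHom ∈
        (horn.{u} (n + 1) i).obj (op ⦋q⦌) then
      OmegaFunctor.toFun (C := simplexOmega q) (hf.desc.app (op ⦋q⦌) ⟨_, h⟩) (Cell.top q)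
    -- An arbitrary value for the faces outside the horn, which lie in no facet that is compared.
    else (f' j₀ hj₀).toFun (Cell.top n)
  have hz : ∀ j hj q (σ : Face n q),
      (f' j hj).toFun (Cell.atom σ) = z q (σ.trans (Fin.succAboveOrderEmb j)) := fun j hj q σ => by
    have h : stdSimplex.objMk.{u} (n := ⦋n + 1⦌) (m := op ⦋q⦌)
        (OrderEmbedding.toOrderHom (σ.trans (Fin.succAboveOrderEmb j))) ∈ (horn.{u} (n + 1) i).obj (op ⦋q⦌) :=
      (mem_horn_iff_notMem_range _ _).2
        ⟨j, hj, by rintro ⟨a, ha⟩; exact Fin.succAbove_ne j (σ a) ha⟩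
    refine Eq.trans ?_ (dif_pos h).symm
    have e : (f j hj).app (op ⦋q⦌) (stdSimplex.objMk.{u} (n := ⦋n⦌) (m := op ⦋q⦌) σ.toOrderHom) =
        hf.desc.app (op ⦋q⦌) ⟨_, h⟩ := by
      rw [← hf.ι_desc j hj]
      rfl
    rw [← e, ← SSet.yonedaEquiv.symm_apply_apply (f j hj)]
    rfl
  obtain ⟨F, hF⟩ := exists_filler i f' z hz
  refine ⟨(SSet.yonedaEquiv (X := D.simplicialNerve) (n := ⦋n + 1⦌)).symm F, fun j hj => ?_⟩
  exact (stdSimplex.δ_comp_yonedaEquiv_symm (X := D.simplicialNerve) F j).trans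
    (SSet.yonedaEquiv.symm_apply_eq.2 (hF j hj))

theorem mainTheorem3 (C : OmegaCat.{u}) (hC : C.NonContracting)
    (hG : (C.path hC).IsGroupoid) :
    SSet.KanComplex (C.branchingSemiGlobularNerve hC) :=
  haveI := OmegaCat.allInvertible_semiPath C hC hG
  OmegaCat.kanComplex_simplicialNerve _
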